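/- **Conventions.** For a finite collection (multiset) $P$ of points of a space $U$ with finite measure $\mu$ and a class $\mathcal X$ of subsets of $U$, the discrepancy is $$\mathbf D(P,\mathcal X)=\sup_{X\in\mathcal X}\left|\frac{|P\cap X|}{|P|}-\frac{\mu(X)}{\mu(U)}\right| .$$ On $SO(3)$ take $\mu$ to be Haar measure, on $[0,1]^2$ Lebesgue measure. Let $R_y(t),R_z(t)\in SO(3)$ denote the rotations by the angle $t$ about the second and third coordinate axes. For $u=e^{i\psi}\in S^1$ and $x\in S^2$ with polar angle $\theta\in[0,\pi]$ and azimuth $\varphi\in(-\pi,\pi]$ ($\varphi=0$ at the poles), let $$h(u,x)=R_z(\varphi)R_y(\theta)R_z(-\varphi)R_z(\psi)\in SO(3)$$ be the rotation with Hopf coordinates $(\psi,\theta,\varphi)$; it lies on the fibre $\{R: Re_3=x\}$ of the Hopf fibration $SO(3)\to S^2$, $R\mapsto Re_3$. The fibered product of $F\subseteq S^1$ and $B\subseteq S^2$ is $F\,\tilde\otimes\,B=\{h(u,x):u\in F,\ x\in B\}$, and likewise, with multiplicities, for point collections. A convex set of $S^1$ is a closed arc (from a single point up to the whole circle). A convex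 set of $S^2$ is a closed set that is contained in an open hemisphere and contains with any two points the geodesic joining them. The class $\mathcal C$ of *local Cartesian convex sets* consists of all $F\,\tilde\otimes\,B$ with $F\subseteq S^1$ and $B\subseteq S^2$ convex. The Lambert map is $$\Phi(x,y)=\bigl(2\sqrt{y-y^2}\cos 2\pi x,\ 2\sqrt{y-y^2}\sin 2\pi x,\ 1-2y\bigr),\qquad (x,y)\in[0,1]^2 .$$ For $N\ge 2$ put $N_1=\bigl\lceil (N/\log^2N)^{1/3}\bigr\rceil$ and $N_2=\lfloor N/N_1\rfloor$ (so $N_2$ is about $(N\log N)^{2/3}$). For a collection $T$ of $N_2$ points of $[0,1]^2$ let $$P_N(T)=\{e^{2\pi i j/N_1}:0\le j<N_1\}\ \tilde\otimes\ \Phi(T),$$ and let $P_N=P_N(H)$, where $H=\{(i/N_2,\,v(i)):0\le i<N_2\}$ is the Hammersley point set and $v$ is the base-two radical inverse, $v(\sum_k d_k2^k)=\sum_k d_k2^{-k-1}$. **Theorem.** 1. There is an absolute constant $C$ such that for all $N\ge2$ the points of $P_N$ are distinct, $|P_N|=N_1N_2$, $N-N_1<|P_N|\le N$, and $$\mathbf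 D(P_N,\mathcal C)\le C\,\frac{\log^{2/3}N}{N^{1/3}} .$$ The same bound holds for every collection of exactly $N$ points of $SO(3)$ that contains $P_N$. 2. The sets $P_N$ are efficiently generated: there is one program for a real random access machine (finitely many named registers; unit-cost steps: the constants $0,1,\pi$, the operations $+,-,\times,/,\sqrt{\ },\log,\cos,\sin$, and the comparison $<$, with branching and loops) that on input $N\ge2$ outputs exactly the matrices in $P_N$, each once, and halts after a number of steps that is bounded by a polynomial in $N$. 3. Any discrepancy-optimal point collection of the square may be used instead of Hammersley points: for every $A$ there is a constant $C_A$ such that for all $N\ge2$ and every collection $T$ of $N_2$ points of $[0,1]^2$ (with multiplicities) whose discrepancy with respect to closed axis-aligned rectangles in $[0,1]^2$ is at most $A\log N_2/N_2$, $$\mathbf D(P_N(T),\mathcal C)\le C_A\,\frac{\log^{2/3}N}{N^{1/3}} .$$ -/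

import Mathlib

open scoped unitInterval

namespace MotionSampling

/-! ### Discrepancy -/

/-- `|P ∩ X| / |P|`, points of the finite collection `P` being counted with multiplicity. -/
noncomputable def proportion {U : Type*} (P : Multiset U) (X : Set U) : ℝ :=
  open scoped Classical in ((P.countP (· ∈ X) : ℕ) : ℝ) / (Multiset.card P : ℝ)

/-- The discrepancy `sup_{X ∈ 𝒳} | |P ∩ X| / |P| - μ(X) / μ(U) |`. -/
noncomputable def discrepancy {U : Type*} [MeasurableSpace U] (μ : MeasureTheory.Measure U)
    (P : Multiset U) (𝒳 : Set (Set U)) : ℝ :=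
  sSup ((fun X => |proportion P X - μ.real X / μ.real Set.univ|) '' 𝒳)

/-- The set of numbers whose supremum is the discrepancy is bounded. -/
theorem bddAbove_discrepancy {U : Type*} [MeasurableSpace U] (μ : MeasureTheory.Measure U)
    [MeasureTheory.IsFiniteMeasure μ] (P : Multiset U) (𝒳 : Set (Set U)) :
    BddAbove ((fun X => |proportion P X - μ.real X / μ.real Set.univ|) '' 𝒳) := by
  classical
  refine ⟨1, ?_⟩
  rintro _ ⟨X, -, rfl⟩
  have h1 : 0 ≤ proportion P X := by unfold proportion; positivity
  have h2 : proportion P X ≤ 1 := by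
    unfold proportion
    exact div_le_one_of_le₀ (by exact_mod_cast Multiset.countP_le_card _ _) (by positivity)
  have h3 : 0 ≤ μ.real X / μ.real Set.univ := by positivity
  have h4 : μ.real X / μ.real Set.univ ≤ 1 :=
    div_le_one_of_le₀ (MeasureTheory.measureReal_mono (Set.subset_univ X)) (by positivity)
  exact abs_le.2 ⟨by linarith, by linarith⟩

/-! ### The group `SO(3)` with its invariant measure -/

/-- Real orthogonal `3 × 3` matrices of determinant one. -/
abbrev SO3 : Type := Matrix.specialOrthogonalGroup (Fin 3) ℝ

theorem SO3.mem_iff (A : Matrix (Fin 3) (Fin 3) ℝ) :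
    A ∈ Matrix.specialOrthogonalGroup (Fin 3) ℝ ↔ A * A.transpose = 1 ∧ A.det = 1 := by
  rw [Matrix.mem_specialOrthogonalGroup_iff, Matrix.mem_orthogonalGroup_iff]

instance SO3.instIsTopologicalGroup : IsTopologicalGroup SO3 where
  continuous_mul := Continuous.subtype_mk
    ((continuous_subtype_val.comp continuous_fst).mul
      (continuous_subtype_val.comp continuous_snd)) _
  continuous_inv := Continuous.subtype_mk
    (continuous_subtype_val.matrix_transpose) _

instance SO3.instCompactSpace : CompactSpace SO3 := by
  suffices h : IsCompact
      (Matrix.specialOrthogonalGroup (Fin 3) ℝ : Set (Matrix (Fin 3) (Fin 3) ℝ)) from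
    isCompact_iff_compactSpace.1 h
  have hK : IsCompact (Set.univ.pi fun _ : Fin 3 => Set.univ.pi fun _ : Fin 3 =>
      Set.Icc (-1 : ℝ) 1) :=
    isCompact_univ_pi fun _ => isCompact_univ_pi fun _ => isCompact_Icc
  refine IsCompact.of_isClosed_subset hK ?_ ?_
  · have : (Matrix.specialOrthogonalGroup (Fin 3) ℝ : Set (Matrix (Fin 3) (Fin 3) ℝ))
        = {A | A * A.transpose = 1} ∩ {A | A.det = 1} := by
      ext A; exact SO3.mem_iff A
    rw [this]
    refine IsClosed.inter (isClosed_eq ?_ continuous_const) (isClosed_eq ?_ continuous_const)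
    · exact continuous_id.mul continuous_id.matrix_transpose
    · exact continuous_id.matrix_det
  · intro A hA
    have h := ((SO3.mem_iff A).1 hA).1
    intro i _ j _
    have hi : ∑ k, A i k * A i k = 1 := by
      have := congrFun (congrFun h i) i
      simpa [Matrix.mul_apply] using this
    have hj : A i j * A i j ≤ 1 := by
      rw [← hi]
      exact Finset.single_le_sum (f := fun k => A i k * A i k)
        (fun k _ => mul_self_nonneg _) (Finset.mem_univ j)
    constructor <;> nlinarith

instance SO3.instMeasurableSpace : MeasurableSpace SO3 := borel SO3

instance SO3.instBorelSpace : BorelSpace SO3 := ⟨rfl⟩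

/-- The Haar measure of total mass one: the normalised invariant volume of `SO(3)`. -/
noncomputable def haarSO3 : MeasureTheory.Measure SO3 := MeasureTheory.Measure.haarMeasure ⊤

/-! ### Hopf coordinates -/

/-- The unit sphere `S²` of `ℝ³`. -/
abbrev S2 : Type := Metric.sphere (0 : EuclideanSpace ℝ (Fin 3)) 1

/-- Rotation by the angle `t` about the third coordinate axis. -/
noncomputable def rotZ (t : ℝ) : SO3 :=
  ⟨!![Real.cos t, -Real.sin t, 0; Real.sin t, Real.cos t, 0; 0, 0, 1], by
    rw [SO3.mem_iff]
    constructor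
    · ext i j
      fin_cases i <;> fin_cases j <;>
        simp [Matrix.mul_apply, Fin.sum_univ_three] <;> nlinarith [Real.sin_sq_add_cos_sq t]
    · simp [Matrix.det_fin_three]; nlinarith [Real.sin_sq_add_cos_sq t]⟩

/-- Rotation by the angle `t` about the second coordinate axis. -/
noncomputable def rotY (t : ℝ) : SO3 :=
  ⟨!![Real.cos t, 0, Real.sin t; 0, 1, 0; -Real.sin t, 0, Real.cos t], by
    rw [SO3.mem_iff]
    constructor
    · ext i j
      fin_cases i <;> fin_cases j <;>
        simp [Matrix.mul_apply, Fin.sum_univ_three] <;> nlinarith [Real.sin_sq_add_cos_sq t]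
    · simp [Matrix.det_fin_three]; nlinarith [Real.sin_sq_add_cos_sq t]⟩

/-- The rotation with Hopf coordinates `ψ` (fibre angle), `θ` (polar angle) and `φ` (azimuth):
the rotation by `ψ` about the third axis `e₃`, followed by the rotation by `θ` that moves `e₃`
along the meridian of longitude `φ`. In unit quaternions it is
`± (cos (θ/2) cos (ψ/2), sin (θ/2) sin (ψ/2 - φ), sin (θ/2) cos (ψ/2 - φ), cos (θ/2) sin (ψ/2))`. -/
noncomputable def hopfRotation (ψ θ φ : ℝ) : SO3 := rotZ φ * rotY θ * rotZ (-φ) * rotZ ψ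

/-- The polar angle in `[0, π]` of a point of the sphere. -/
noncomputable def polarAngle (x : S2) : ℝ := Real.arccos (x.1 2)

/-- The azimuth in `(-π, π]` of a point of the sphere (`0` at the two poles). -/
noncomputable def azimuth (x : S2) : ℝ := Complex.arg ⟨x.1 0, x.1 1⟩

/-- The point of the fibre over `x ∈ S²` (the rotations that carry `e₃` to `x`) whose coordinate
on the circle `S¹` is `u`. -/
noncomputable def hopf (u : Circle) (x : S2) : SO3 :=
  hopfRotation (Complex.arg u) (polarAngle x) (azimuth x)

/-- The fibered (local Cartesian) product of a subset of `S¹` and a subset of `S²`. -/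
noncomputable def fiberedProduct (F : Set Circle) (B : Set S2) : Set SO3 := Set.image2 hopf F B

/-- The fibered (local Cartesian) product of a point collection on `S¹` and one on `S²`. -/
noncomputable def fiberedProductPoints (Q : Multiset Circle) (R : Multiset S2) : Multiset SO3 :=
  (Q ×ˢ R).map fun p => hopf p.1 p.2

/-! ### Convex sets -/

/-- Closed convex subsets of the circle: the contiguous arcs, from single points up to the whole
circle. -/
def circleConvexSets : Set (Set Circle) :=
  {F | ∃ a b : ℝ, a ≤ b ∧ b ≤ a + 2 * Real.pi ∧ F = Circle.exp '' Set.Icc a b}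

/-- Spherical convex sets: closed, contained strictly in a hemisphere (that is, in an open
hemisphere), and containing with any two points the great circle arc (the geodesic) between
them. -/
def IsSphericalConvex (B : Set S2) : Prop :=
  IsClosed B ∧
  (∃ v : EuclideanSpace ℝ (Fin 3), ∀ x ∈ B, 0 < inner ℝ v x.1) ∧
  ∀ x ∈ B, ∀ y ∈ B, ∀ z : S2,
    (∃ s t : ℝ, 0 ≤ s ∧ 0 ≤ t ∧ z.1 = s • x.1 + t • y.1) → z ∈ B

/-- Local Cartesian convex sets of `SO(3)`. -/
def localCartesianConvexSets : Set (Set SO3) :=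
  {X | ∃ F ∈ circleConvexSets, ∃ B : Set S2, IsSphericalConvex B ∧ X = fiberedProduct F B}

/-- Closed axis-aligned rectangles in the unit square. -/
def unitSquareRectangles : Set (Set (I × I)) := {R | ∃ p q : I × I, p ≤ q ∧ R = Set.Icc p q}

/-! ### The points -/

/-- `n` equispaced points on the circle. -/
noncomputable def equispacedPoints (n : ℕ) : Multiset Circle :=
  (Multiset.range n).map fun j : ℕ => Circle.exp (2 * Real.pi * j / n)

/-- The Lambert equal-area map of the unit square onto the sphere. -/
noncomputable def lambert (p : I × I) : S2 :=
  ⟨!₂[2 * √((p.2 : ℝ) - (p.2 : ℝ) ^ 2) * Real.cos (2 * Real.pi * p.1),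
      2 * √((p.2 : ℝ) - (p.2 : ℝ) ^ 2) * Real.sin (2 * Real.pi * p.1),
      1 - 2 * (p.2 : ℝ)], by
    have h0 : (0 : ℝ) ≤ (p.2 : ℝ) - (p.2 : ℝ) ^ 2 := by
      nlinarith [p.2.2.1, p.2.2.2, mul_nonneg p.2.2.1 (sub_nonneg.2 p.2.2.2)]
    rw [mem_sphere_zero_iff_norm, EuclideanSpace.norm_eq, Real.sqrt_eq_one, Fin.sum_univ_three]
    simp only [Real.norm_eq_abs, sq_abs, Matrix.cons_val]
    rw [mul_pow, mul_pow, mul_pow, mul_pow, Real.sq_sqrt h0]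
    linear_combination
      4 * ((p.2 : ℝ) - (p.2 : ℝ) ^ 2) * Real.sin_sq_add_cos_sq (2 * Real.pi * (p.1 : ℝ))⟩

/-- The van der Corput radical inverse in base two: if `i = ∑ dₖ 2ᵏ` with binary digits `dₖ`, it
is `∑ dₖ 2⁻ᵏ⁻¹`. -/
noncomputable def radicalInverse (i : ℕ) : ℝ := Nat.ofDigits (2⁻¹ : ℝ) (Nat.digits 2 i) / 2

/-- The Hammersley point set `(i / n, radicalInverse i)`, `0 ≤ i < n`, in the unit square. Both
coordinates lie in `[0, 1]` already, so that the projection to `[0, 1]` changes nothing. -/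
noncomputable def hammersleyPoints (n : ℕ) : Multiset (I × I) :=
  (Multiset.range n).map fun i : ℕ =>
    (Set.projIcc (0 : ℝ) 1 zero_le_one ((i : ℝ) / n),
      Set.projIcc (0 : ℝ) 1 zero_le_one (radicalInverse i))

/-- The number of points on each circle: `(N / log² N)^(1/3)`, rounded up. -/
noncomputable def numCircle (N : ℕ) : ℕ := ⌈((N : ℝ) / Real.log N ^ 2) ^ (1 / 3 : ℝ)⌉₊

/-- The number of points on the sphere, about `(N log N)^(2/3)`: the largest `n` such that
`numCircle N * n ≤ N`. -/
noncomputable def numSphere (N : ℕ) : ℕ := N / numCircle N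

/-- The proposed point collection in `SO(3)`, built on a point collection `T` of the square. -/
noncomputable def so3PointsOf (N : ℕ) (T : Multiset (I × I)) : Multiset SO3 :=
  fiberedProductPoints (equispacedPoints (numCircle N)) (T.map lambert)

/-- The explicit point set: `so3PointsOf` with Hammersley points. -/
noncomputable def so3Points (N : ℕ) : Multiset SO3 :=
  so3PointsOf N (hammersleyPoints (numSphere N))

/-! ### Real random access machines with a step count -/

/-- Unit-cost operations; numbers `a`, `b` are names of registers that hold real numbers. -/
inductive Op
  | zero | one | pi
  | add (a b : ℕ) | sub (a b : ℕ) | mul (a b : ℕ) | div (a b : ℕ)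
  | sqrt (a : ℕ) | log (a : ℕ) | cos (a : ℕ) | sin (a : ℕ)

noncomputable def Op.eval (r : ℕ → ℝ) : Op → ℝ
  | .zero => 0
  | .one => 1
  | .pi => Real.pi
  | .add a b => r a + r b
  | .sub a b => r a - r b
  | .mul a b => r a * r b
  | .div a b => r a / r b
  | .sqrt a => √(r a)
  | .log a => Real.log (r a)
  | .cos a => Real.cos (r a)
  | .sin a => Real.sin (r a)

/-- Programs: assignment of the value of an operation to a register `d`; output of the `3 × 3`
matrix with entries from named registers; composition; branching and loops on the test that
register `a` is smaller than register `b`. -/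
inductive Program
  | assign (d : ℕ) (o : Op)
  | output (A : Matrix (Fin 3) (Fin 3) ℕ)
  | seq (p q : Program)
  | ifLT (a b : ℕ) (p q : Program)
  | whileLT (a b : ℕ) (p : Program)

/-- A machine state: the registers, and the matrices output so far. -/
structure MachineState where
  reg : ℕ → ℝ
  out : List (Matrix (Fin 3) (Fin 3) ℝ)

/-- `Runs p s s' t`: program `p`, started in state `s`, halts in state `s'` after `t` steps. -/
inductive Runs : Program → MachineState → MachineState → ℕ → Prop
  | assign (d : ℕ) (o : Op) (s : MachineState) :
      Runs (.assign d o) s ⟨Function.update s.reg d (o.eval s.reg), s.out⟩ 1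
  | output (A : Matrix (Fin 3) (Fin 3) ℕ) (s : MachineState) :
      Runs (.output A) s ⟨s.reg, A.map s.reg :: s.out⟩ 9
  | seq {p q : Program} {s s' s'' : MachineState} {t t' : ℕ} :
      Runs p s s' t → Runs q s' s'' t' → Runs (.seq p q) s s'' (t + t')
  | ifTrue {a b : ℕ} {p q : Program} {s s' : MachineState} {t : ℕ} :
      s.reg a < s.reg b → Runs p s s' t → Runs (.ifLT a b p q) s s' (t + 1)
  | ifFalse {a b : ℕ} {p q : Program} {s s' : MachineState} {t : ℕ} :
      ¬ s.reg a < s.reg b → Runs q s s' t → Runs (.ifLT a b p q) s s' (t + 1)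
  | whileTrue {a b : ℕ} {p : Program} {s s' s'' : MachineState} {t t' : ℕ} :
      s.reg a < s.reg b → Runs p s s' t → Runs (.whileLT a b p) s' s'' t' →
      Runs (.whileLT a b p) s s'' (t + t' + 1)
  | whileFalse {a b : ℕ} {p : Program} {s : MachineState} :
      ¬ s.reg a < s.reg b → Runs (.whileLT a b p) s s 1

/-- The initial state on input `N`: register `0` holds `N`, all other registers hold `0`. -/
noncomputable def inputState (N : ℕ) : MachineState := ⟨fun i => if i = 0 then (N : ℝ) else 0, []⟩

/-- The point collections `P N ⊆ SO(3)`, `N ≥ 2`, are generated by one program, which on input `N`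
outputs the matrices of `P N` (in some order) and halts after a number of steps that is polynomial
in `N`. -/
def EfficientlyGenerated (P : ℕ → Multiset SO3) : Prop :=
  ∃ (p : Program) (C k : ℕ), ∀ N : ℕ, 2 ≤ N → ∃ (s : MachineState) (t : ℕ),
    Runs p (inputState N) s t ∧ t ≤ C * N ^ k ∧
    (s.out : Multiset (Matrix (Fin 3) (Fin 3) ℝ)) = (P N).map Subtype.val

end MotionSampling

/-!
The discrepancy of the fibered products `P_N(T)` is bounded by splitting Haar measure and the points
into a circular and a spherical factor.

In Hopf coordinates Haar measure is the product of arc length and the area of the sphere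
(`haarSO3_real_fiberedProduct`): right translations by rotations about the third axis only move the
fibre coordinate, so averaging over them makes it uniform. The image of Haar measure under the Hopf
fibration is invariant under rotations. Invariance determines the moments of the height, and then the
whole measure, which is therefore the image of Lebesgue measure under the Lambert map
(`eq_map_lambert_of_rotate_invariant`). Since `hopf` is injective, proportions of points factor in the
same way. Hence the discrepancy is at most the sum of that of the equispaced points with respect to
arcs, which is at most `2 / N₁`, and that of `Φ(T)` with respect to spherical convex sets.

For the latter, the square is cut into `m` columns. A geodesic between two points stays between their
meridians and attains all heights between theirs (`IsSphericalConvex.exists_lambert_mem`), so the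
heights at which a column meets a convex set form an interval, and so do those at which the column is
contained in it. In each column the convex set thus lies between two rectangles, which differ only
within distance `2 π / m` of its boundary. The area of this boundary layer is `O(1 / m)` uniformly in
the convex set (`exists_area_boundaryLayer_le`): area is the relative volume of a cone, the cone is
convex, and the part of a convex body that leaves it under a translation by a vector of length `h` has
volume `O(h)`, because its translates by multiples of that vector are disjoint. If `D` is the rectangle
discrepancy of `T`, the error is `O(m D + 1 / m)`. With `D = O(log N / N₂)` and `m` about `√N₂` it is
`O(log N / √N₂)`, which is of the order of `1 / N₁` by the choice of `N₁`
(`log_div_sqrt_numSphere_le`).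

Hammersley points have rectangle discrepancy `O(log N₂ / N₂)` by a recursion for segments of the van
der Corput sequence, which separates even and odd indices (`abs_countBelow_sub_le`). Adding points to
a collection of more than `N - N₁` points to obtain `N` points changes proportions by `O(N₁ / N)`,
which is smaller than `1 / N₁` up to a constant.

The program finds `N₁` and `N₂` by counting, and then runs through the points in a double loop. The
radical inverse is carried along by a binary odometer, and the entries of the rotation matrices are
polynomials in the cosines and sines of the Hopf coordinates, which for images under the Lambert map
need no inverse trigonometric functions (`hopf_lambert_val`).
-/

namespace MotionSampling

open MeasureTheory

/-! ### Haar measure on the rotation group -/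

theorem isProbabilityMeasure_haarSO3 : IsProbabilityMeasure haarSO3 := by
  constructor
  have h := Measure.haarMeasure_self (K₀ := (⊤ : TopologicalSpace.PositiveCompacts SO3))
  simpa [haarSO3] using h

instance : IsProbabilityMeasure haarSO3 := isProbabilityMeasure_haarSO3

instance : Measure.IsHaarMeasure haarSO3 := by unfold haarSO3; infer_instance

/-- A compact group is unimodular. -/
theorem map_mul_right_haarSO3 (g : SO3) : haarSO3.map (· * g) = haarSO3 := by
  have : IsProbabilityMeasure (haarSO3.map (· * g)) :=
    Measure.isProbabilityMeasure_map (measurable_mul_const g).aemeasurable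
  have h := Measure.isMulInvariant_eq_smul_of_compactSpace (haarSO3.map (· * g)) haarSO3
  have h1 := congrArg (fun μ => μ Set.univ) h
  simp only [measure_univ, Measure.smul_apply] at h1
  rw [ENNReal.smul_def, smul_eq_mul, mul_one] at h1
  have h2 : Measure.haarScalarFactor (haarSO3.map (· * g)) haarSO3 = 1 := by
    exact_mod_cast h1.symm
  rw [h, h2, one_smul]

/-! ### The action of rotations on the sphere -/

theorem SO3.sum_col (g : SO3) (i j : Fin 3) :
    ∑ k, g.1 k i * g.1 k j = if i = j then 1 else 0 := by
  have h : g.1.transpose * g.1 = 1 :=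
    mul_eq_one_comm.1 ((SO3.mem_iff g.1).1 g.2).1
  have := congrFun (congrFun h i) j
  simpa [Matrix.mul_apply, Matrix.one_apply] using this

/-- The linear isometry of `ℝ³` given by a rotation matrix. -/
noncomputable def rotIso (g : SO3) :
    EuclideanSpace ℝ (Fin 3) ≃ₗᵢ[ℝ] EuclideanSpace ℝ (Fin 3) :=
  LinearIsometry.toLinearIsometryEquiv
    { toLinearMap := Matrix.toEuclideanLin g.1
      norm_map' := by
        intro x
        have h00 := SO3.sum_col g 0 0
        have h11 := SO3.sum_col g 1 1
        have h22 := SO3.sum_col g 2 2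
        have h01 := SO3.sum_col g 0 1
        have h02 := SO3.sum_col g 0 2
        have h12 := SO3.sum_col g 1 2
        simp [Fin.sum_univ_three] at h00 h11 h22 h01 h02 h12
        rw [EuclideanSpace.norm_eq, EuclideanSpace.norm_eq]
        congr 1
        simp only [Real.norm_eq_abs, sq_abs, Fin.sum_univ_three, Matrix.toLpLin_apply,
          Matrix.mulVec, dotProduct]
        linear_combination x 0 ^ 2 * h00 + x 1 ^ 2 * h11 + x 2 ^ 2 * h22
          + 2 * x 0 * x 1 * h01 + 2 * x 0 * x 2 * h02 + 2 * x 1 * x 2 * h12 } rfl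

theorem rotIso_apply (g : SO3) (x : EuclideanSpace ℝ (Fin 3)) (i : Fin 3) :
    rotIso g x i = g.1 i 0 * x 0 + g.1 i 1 * x 1 + g.1 i 2 * x 2 := by
  simp [rotIso, Matrix.toLpLin_apply, Matrix.mulVec, dotProduct, Fin.sum_univ_three]

/-- The action of a rotation on the unit sphere. -/
noncomputable def rotate (g : SO3) (x : S2) : S2 :=
  ⟨rotIso g x.1, by
    rw [mem_sphere_zero_iff_norm, LinearIsometryEquiv.norm_map]
    exact mem_sphere_zero_iff_norm.1 x.2⟩

theorem rotate_apply (g : SO3) (x : S2) (i : Fin 3) :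
    (rotate g x).1 i = g.1 i 0 * x.1 0 + g.1 i 1 * x.1 1 + g.1 i 2 * x.1 2 :=
  rotIso_apply g x.1 i

theorem S2.ext {x y : S2} (h0 : x.1 0 = y.1 0) (h1 : x.1 1 = y.1 1) (h2 : x.1 2 = y.1 2) :
    x = y := by
  apply Subtype.ext
  ext i
  fin_cases i <;> assumption

theorem S2.sum_sq (x : S2) : x.1 0 ^ 2 + x.1 1 ^ 2 + x.1 2 ^ 2 = 1 := by
  have h := mem_sphere_zero_iff_norm.1 x.2
  rw [EuclideanSpace.norm_eq, Real.sqrt_eq_one] at h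
  simpa [Fin.sum_univ_three] using h

theorem rotate_mul (g h : SO3) (x : S2) : rotate (g * h) x = rotate g (rotate h x) := by
  apply S2.ext <;>
  · simp only [rotate_apply, Submonoid.coe_mul, Matrix.mul_apply, Fin.sum_univ_three]
    ring

theorem rotate_one (x : S2) : rotate 1 x = x := by
  apply S2.ext <;> simp [rotate_apply]

theorem continuous_rotate (g : SO3) : Continuous (rotate g) :=
  Continuous.subtype_mk ((rotIso g).continuous.comp continuous_subtype_val) _

/-- The north pole. -/
noncomputable def northPole : S2 :=
  ⟨!₂[0, 0, 1], by simp [EuclideanSpace.norm_eq, Fin.sum_univ_three]⟩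

/-- The Hopf fibration `SO(3) → S²`, `R ↦ R e₃`. -/
noncomputable def base (R : SO3) : S2 := rotate R northPole

theorem base_apply (R : SO3) (i : Fin 3) : (base R).1 i = R.1 i 2 := by
  simp [base, rotate_apply, northPole]

theorem base_mul (g R : SO3) : base (g * R) = rotate g (base R) := rotate_mul g R northPole

theorem continuous_base : Continuous base := by
  refine Continuous.subtype_mk ?_ _
  have : (fun R : SO3 => rotIso R northPole.1) = fun R : SO3 => WithLp.toLp 2 fun i => R.1 i 2 := by
    funext R
    ext i
    exact base_apply R i
  rw [this]
  refine (PiLp.continuous_toLp 2 _).comp (continuous_pi fun i => ?_)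
  exact (continuous_subtype_val).matrix_elem i 2

/-! ### Hopf coordinates -/

theorem continuous_rotZ : Continuous rotZ := by
  refine Continuous.subtype_mk (continuous_matrix fun i j => ?_) _
  fin_cases i <;> fin_cases j <;> simp <;> fun_prop

theorem continuous_rotY : Continuous rotY := by
  refine Continuous.subtype_mk (continuous_matrix fun i j => ?_) _
  fin_cases i <;> fin_cases j <;> simp <;> fun_prop

theorem rotZ_add (s t : ℝ) : rotZ (s + t) = rotZ s * rotZ t := by
  apply Subtype.ext
  ext i j
  fin_cases i <;> fin_cases j <;>
    simp [rotZ, Real.cos_add, Real.sin_add] <;> ring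

theorem rotZ_eq_of_cos_sin {s t : ℝ} (hc : Real.cos s = Real.cos t)
    (hs : Real.sin s = Real.sin t) : rotZ s = rotZ t := by
  apply Subtype.ext
  simp [rotZ, hc, hs]

/-- The rotation that carries the north pole to `x` along a geodesic. -/
noncomputable def hopfSection (x : S2) : SO3 :=
  rotZ (azimuth x) * rotY (polarAngle x) * rotZ (-azimuth x)

theorem hopf_eq (u : Circle) (x : S2) : hopf u x = hopfSection x * rotZ (Complex.arg u) := rfl

theorem cos_polarAngle (x : S2) : Real.cos (polarAngle x) = x.1 2 := by
  have := S2.sum_sq x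
  exact Real.cos_arccos (by nlinarith [sq_nonneg (x.1 0), sq_nonneg (x.1 1)])
    (by nlinarith [sq_nonneg (x.1 0), sq_nonneg (x.1 1)])

theorem sin_polarAngle (x : S2) : Real.sin (polarAngle x) = √(1 - x.1 2 ^ 2) :=
  Real.sin_arccos _

theorem norm_azimuth (x : S2) : ‖(⟨x.1 0, x.1 1⟩ : ℂ)‖ = Real.sin (polarAngle x) := by
  rw [sin_polarAngle, Complex.norm_eq_sqrt_sq_add_sq]
  congr 1
  linarith [S2.sum_sq x]

theorem sin_mul_cos_azimuth (x : S2) :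
    Real.sin (polarAngle x) * Real.cos (azimuth x) = x.1 0 := by
  rw [← norm_azimuth, azimuth, Complex.norm_mul_cos_arg]

theorem sin_mul_sin_azimuth (x : S2) :
    Real.sin (polarAngle x) * Real.sin (azimuth x) = x.1 1 := by
  rw [← norm_azimuth, azimuth, Complex.norm_mul_sin_arg]

theorem rotate_rotZ_northPole (t : ℝ) : rotate (rotZ t) northPole = northPole := by
  apply S2.ext <;> simp [rotate_apply, northPole, rotZ]

theorem base_hopfSection (x : S2) : base (hopfSection x) = x := by
  rw [hopfSection, base, rotate_mul, rotate_rotZ_northPole]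
  have h0 := sin_mul_cos_azimuth x
  have h1 := sin_mul_sin_azimuth x
  have h2 := cos_polarAngle x
  apply S2.ext
  · simp [rotate_apply, northPole, rotZ, rotY]; linarith
  · simp [rotate_apply, northPole, rotZ, rotY]; linarith
  · simp [rotate_apply, northPole, rotZ, rotY]; linarith

theorem base_hopf (u : Circle) (x : S2) : base (hopf u x) = x := by
  rw [hopf_eq, base_mul, base, rotate_rotZ_northPole]
  exact base_hopfSection x

theorem arg_circle_exp_cos (t : ℝ) : Real.cos (Complex.arg (Circle.exp t)) = Real.cos t := by
  rw [Complex.cos_arg (Circle.coe_ne_zero _), Circle.norm_coe, div_one, Circle.coe_exp,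
    Complex.exp_ofReal_mul_I_re]

theorem arg_circle_exp_sin (t : ℝ) : Real.sin (Complex.arg (Circle.exp t)) = Real.sin t := by
  rw [Complex.sin_arg, Circle.norm_coe, div_one, Circle.coe_exp,
    Complex.exp_ofReal_mul_I_im]

theorem hopf_exp (t : ℝ) (x : S2) : hopf (Circle.exp t) x = hopfSection x * rotZ t := by
  rw [hopf_eq, rotZ_eq_of_cos_sin (arg_circle_exp_cos t) (arg_circle_exp_sin t)]

theorem rotZ_injective_cos_sin {s t : ℝ} (h : rotZ s = rotZ t) :
    Circle.exp s = Circle.exp t := by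
  have h0 := congrArg (fun A : SO3 => A.1 0 0) h
  have h1 := congrArg (fun A : SO3 => A.1 1 0) h
  simp [rotZ] at h0 h1
  apply Circle.ext
  rw [Circle.coe_exp, Circle.coe_exp]
  apply Complex.ext
  · rw [Complex.exp_ofReal_mul_I_re, Complex.exp_ofReal_mul_I_re, h0]
  · rw [Complex.exp_ofReal_mul_I_im, Complex.exp_ofReal_mul_I_im, h1]

theorem hopf_injective {u v : Circle} {x y : S2} (h : hopf u x = hopf v y) : u = v ∧ x = y := by
  have hxy : x = y := by rw [← base_hopf u x, h, base_hopf]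
  subst hxy
  refine ⟨?_, rfl⟩
  rw [hopf_eq, hopf_eq] at h
  have := rotZ_injective_cos_sin (mul_left_cancel h)
  rwa [Circle.exp_arg, Circle.exp_arg] at this

/-- A rotation that fixes the third axis is a rotation about it. -/
theorem exists_rotZ_of_base_eq (g : SO3) (h : base g = northPole) : ∃ t, g = rotZ t := by
  have c0 : g.1 0 2 = 0 := by rw [← base_apply, h]; simp [northPole]
  have c1 : g.1 1 2 = 0 := by rw [← base_apply, h]; simp [northPole]
  have c2 : g.1 2 2 = 1 := by rw [← base_apply, h]; simp [northPole]
  have h00 := SO3.sum_col g 0 0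
  have h02 := SO3.sum_col g 0 2
  have h12 := SO3.sum_col g 1 2
  simp [Fin.sum_univ_three, c0, c1, c2] at h00 h02 h12
  have h11 := SO3.sum_col g 1 1
  have h01 := SO3.sum_col g 0 1
  have hdet := ((SO3.mem_iff g.1).1 g.2).2
  rw [Matrix.det_fin_three] at hdet
  simp [Fin.sum_univ_three, c0, c1, c2, h02, h12] at h00 h11 h01 hdet
  set a := g.1 0 0
  set b := g.1 1 0
  set c := g.1 0 1
  set d := g.1 1 1
  have hc : c = -b := by linear_combination d * h01 - b * h11 - c * hdet
  have hd : d = a := by linear_combination a * h11 - c * h01 - d * hdet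
  refine ⟨Complex.arg ⟨a, b⟩, ?_⟩
  have hn : ‖(⟨a, b⟩ : ℂ)‖ = 1 := by
    rw [Complex.norm_eq_sqrt_sq_add_sq, Real.sqrt_eq_one]
    simp only
    linarith
  have e1 : Real.cos (Complex.arg ⟨a, b⟩) = a := by
    have := Complex.norm_mul_cos_arg ⟨a, b⟩
    rwa [hn, one_mul] at this
  have e2 : Real.sin (Complex.arg ⟨a, b⟩) = b := by
    have := Complex.norm_mul_sin_arg ⟨a, b⟩
    rwa [hn, one_mul] at this
  apply Subtype.ext
  ext i j
  fin_cases i <;> fin_cases j <;> simp [rotZ, e1, e2, c0, c1, c2, h02, h12] <;>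
    first | rfl | assumption

theorem exists_hopf_exp (R : SO3) : ∃ t : ℝ, R = hopfSection (base R) * rotZ t := by
  have h : base ((hopfSection (base R))⁻¹ * R) = northPole := by
    rw [base_mul]
    have h1 : base R = base (hopfSection (base R)) := (base_hopfSection _).symm
    generalize hopfSection (base R) = g at h1 ⊢
    rw [h1, ← base_mul, inv_mul_cancel, base, rotate_one]
  obtain ⟨t, ht⟩ := exists_rotZ_of_base_eq _ h
  exact ⟨t, by rw [← ht]; group⟩

theorem mul_rotZ_mem_fiberedProduct {F : Set Circle} {B : Set S2} (x : S2) (s t : ℝ) :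
    hopfSection x * rotZ s * rotZ t ∈ fiberedProduct F B ↔
      Circle.exp (s + t) ∈ F ∧ x ∈ B := by
  rw [mul_assoc, ← rotZ_add, ← hopf_exp]
  constructor
  · rintro ⟨u, hu, y, hy, h⟩
    obtain ⟨rfl, rfl⟩ := hopf_injective h
    exact ⟨hu, hy⟩
  · rintro ⟨hu, hx⟩
    exact ⟨_, hu, _, hx, rfl⟩

instance : SecondCountableTopology SO3 := by
  have : SecondCountableTopology (Matrix (Fin 3) (Fin 3) ℝ) :=
    inferInstanceAs (SecondCountableTopology (Fin 3 → Fin 3 → ℝ))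
  exact inferInstanceAs (SecondCountableTopology
    (Matrix.specialOrthogonalGroup (Fin 3) ℝ : Set (Matrix (Fin 3) (Fin 3) ℝ)))

theorem S2.continuous_coord (i : Fin 3) : Continuous fun x : S2 => x.1 i :=
  (EuclideanSpace.proj (𝕜 := ℝ) i).continuous.comp continuous_subtype_val

theorem measurable_hopfSection : Measurable hopfSection := by
  have haz : Measurable azimuth := by
    refine Complex.measurable_arg.comp ?_
    have : (fun x : S2 => (⟨x.1 0, x.1 1⟩ : ℂ)) =
        fun x : S2 => ((x.1 0 : ℝ) : ℂ) + ((x.1 1 : ℝ) : ℂ) * Complex.I := by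
      funext x; apply Complex.ext <;> simp
    rw [this]
    exact (Complex.measurable_ofReal.comp (S2.continuous_coord 0).measurable).add
      ((Complex.measurable_ofReal.comp (S2.continuous_coord 1).measurable).mul_const _)
  have hpol : Measurable polarAngle :=
    Real.continuous_arccos.measurable.comp (S2.continuous_coord 2).measurable
  exact ((continuous_rotZ.measurable.comp haz).mul (continuous_rotY.measurable.comp hpol)).mul
    (continuous_rotZ.measurable.comp haz.neg)

/-- `hopf` is discontinuous at the south pole, so that measurability of a fibered product comes
from injectivity (the Lusin–Souslin theorem) rather than from compactness. -/
theorem measurableSet_fiberedProduct {F : Set Circle} {B : Set S2} (hF : IsClosed F)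
    (hB : MeasurableSet B) : MeasurableSet (fiberedProduct F B) := by
  have : fiberedProduct F B = (fun p : ℝ × S2 => hopfSection p.2 * rotZ p.1) ''
      ((Circle.exp ⁻¹' F ∩ Set.Ioc (-Real.pi) Real.pi) ×ˢ B) := by
    ext R
    constructor
    · rintro ⟨u, hu, x, hx, rfl⟩
      refine ⟨(Complex.arg u, x), ⟨⟨?_, Complex.arg_mem_Ioc _⟩, hx⟩, rfl⟩
      rwa [Set.mem_preimage, Circle.exp_arg]
    · rintro ⟨⟨t, x⟩, ⟨⟨ht, -⟩, hx⟩, rfl⟩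
      exact ⟨_, ht, x, hx, hopf_exp t x⟩
  rw [this]
  have hmeas : Measurable fun p : ℝ × S2 => hopfSection p.2 * rotZ p.1 :=
    (measurable_hopfSection.comp measurable_snd).mul
      (continuous_rotZ.measurable.comp measurable_fst)
  refine MeasurableSet.image_of_measurable_injOn
    (((hF.preimage Circle.exp.continuous).measurableSet.inter measurableSet_Ioc).prod hB)
    hmeas ?_
  rintro ⟨s, x⟩ ⟨⟨-, hs⟩, -⟩ ⟨t, y⟩ ⟨⟨-, ht⟩, -⟩ h
  simp only [← hopf_exp] at h
  obtain ⟨h1, rfl⟩ := hopf_injective h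
  have h2 := congrArg (fun u : Circle => Complex.arg u) h1
  simp only [Circle.arg_exp hs.1 hs.2, Circle.arg_exp ht.1 ht.2] at h2
  rw [h2]

/-! ### The Haar measure of a fibered product -/

theorem isClosed_circle_exp_image_Icc (a b : ℝ) : IsClosed (Circle.exp '' Set.Icc a b) :=
  (isCompact_Icc.image Circle.exp.continuous).isClosed

/-- The length of an arc, measured in a parametrisation that starts at an arbitrary point. -/
theorem integral_indicator_arc {a b : ℝ} (hab : a ≤ b) (hb : b ≤ a + 2 * Real.pi) (s : ℝ) :
    ∫ t in (0 : ℝ)..(2 * Real.pi),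
      (Circle.exp ⁻¹' (Circle.exp '' Set.Icc a b)).indicator (1 : ℝ → ℝ) (s + t) = b - a := by
  set F := Circle.exp '' Set.Icc a b with hF
  have hper : Function.Periodic ((Circle.exp ⁻¹' F).indicator (1 : ℝ → ℝ)) (2 * Real.pi) := by
    intro t
    have : t + 2 * Real.pi ∈ Circle.exp ⁻¹' F ↔ t ∈ Circle.exp ⁻¹' F := by
      rw [Set.mem_preimage, Set.mem_preimage, Circle.exp_add_two_pi]
    by_cases h : t ∈ Circle.exp ⁻¹' F
    · rw [Set.indicator_of_mem h, Set.indicator_of_mem (this.2 h)]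
      rfl
    · rw [Set.indicator_of_notMem h, Set.indicator_of_notMem fun h' => h (this.1 h')]
  have hpi := Real.pi_pos
  rw [intervalIntegral.integral_comp_add_left (fun t => (Circle.exp ⁻¹' F).indicator 1 t),
    add_zero, hper.intervalIntegral_add_eq s a, intervalIntegral.integral_of_le (by linarith)]
  have hmeas : MeasurableSet (Circle.exp ⁻¹' F) :=
    ((isClosed_circle_exp_image_Icc a b).preimage Circle.exp.continuous).measurableSet
  rw [integral_indicator_one hmeas, Measure.real, Measure.restrict_apply hmeas]
  have h1 : Set.Ioc a b ⊆ Circle.exp ⁻¹' F ∩ Set.Ioc a (a + 2 * Real.pi) := fun t ht =>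
    ⟨⟨t, ⟨ht.1.le, ht.2⟩, rfl⟩, ht.1, ht.2.trans hb⟩
  have h2 : Circle.exp ⁻¹' F ∩ Set.Ioc a (a + 2 * Real.pi) ⊆
      Set.Icc a b ∪ {a + 2 * Real.pi} := by
    rintro t ⟨⟨r, hr, hrt⟩, ht⟩
    by_cases htb : t ≤ b
    · exact Or.inl ⟨ht.1.le, htb⟩
    right
    obtain ⟨m, hm⟩ := Circle.exp_eq_exp.1 hrt.symm
    rw [Set.mem_singleton_iff]
    -- `t - r` is a positive multiple of `2 π` and at most `2 π`
    have hm0 : 0 < m := by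
      by_contra hneg
      have : (m : ℝ) ≤ 0 := by exact_mod_cast not_lt.1 hneg
      nlinarith [hr.2, not_le.1 htb]
    have hm1 : (1 : ℝ) ≤ m := by exact_mod_cast hm0
    nlinarith [ht.2, hr.1]
  have hvol : volume (Circle.exp ⁻¹' F ∩ Set.Ioc a (a + 2 * Real.pi)) = ENNReal.ofReal (b - a) := by
    refine le_antisymm ((measure_mono h2).trans ((measure_union_le _ _).trans ?_)) ?_
    · simp
    · rw [← Real.volume_Ioc]
      exact measure_mono h1
  rw [hvol, ENNReal.toReal_ofReal (by linarith)]

/-- In Hopf coordinates Haar measure is the product of arc length and its own image on the sphere: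
averaging over right translations by `rotZ t` makes the fibre coordinate uniform. -/
theorem haarSO3_real_fiberedProduct {a b : ℝ} (hab : a ≤ b) (hb : b ≤ a + 2 * Real.pi)
    {B : Set S2} (hB : MeasurableSet B) :
    haarSO3.real (fiberedProduct (Circle.exp '' Set.Icc a b) B) =
      (b - a) / (2 * Real.pi) * (haarSO3.map base).real B := by
  set F := Circle.exp '' Set.Icc a b with hF
  set X := fiberedProduct F B with hX
  have hXm : MeasurableSet X := measurableSet_fiberedProduct (isClosed_circle_exp_image_Icc a b) hB
  have hmeas : Measurable fun p : ℝ × SO3 => X.indicator (1 : SO3 → ℝ) (p.2 * rotZ p.1) :=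
    (measurable_one.indicator hXm).comp
      (measurable_snd.mul (continuous_rotZ.measurable.comp measurable_fst))
  have hswap : ∫ t in (0 : ℝ)..(2 * Real.pi), ∫ R, X.indicator (1 : SO3 → ℝ) (R * rotZ t) ∂haarSO3 =
      ∫ R, (∫ t in (0 : ℝ)..(2 * Real.pi), X.indicator (1 : SO3 → ℝ) (R * rotZ t)) ∂haarSO3 := by
    refine intervalIntegral_integral_swap ?_
    have : IsFiniteMeasure (volume.restrict (Set.uIoc 0 (2 * Real.pi))) := by
      rw [Set.uIoc]; infer_instance
    refine Integrable.of_bound hmeas.aestronglyMeasurable 1 (Filter.Eventually.of_forall ?_)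
    rintro ⟨t, R⟩
    simp only [Function.uncurry, Set.indicator]
    split_ifs <;> simp
  have hleft : ∀ t : ℝ, ∫ R, X.indicator (1 : SO3 → ℝ) (R * rotZ t) ∂haarSO3 = haarSO3.real X := by
    intro t
    rw [← integral_indicator_one hXm]
    conv_rhs => rw [← map_mul_right_haarSO3 (rotZ t)]
    rw [integral_map (measurable_mul_const _).aemeasurable
      (measurable_one.indicator hXm).aestronglyMeasurable]
  have hright : ∀ R : SO3, ∫ t in (0 : ℝ)..(2 * Real.pi), X.indicator (1 : SO3 → ℝ) (R * rotZ t) =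
      (base ⁻¹' B).indicator (fun _ => b - a) R := by
    intro R
    obtain ⟨s, hs⟩ := exists_hopf_exp R
    by_cases hR : base R ∈ B
    · rw [Set.indicator_of_mem (Set.mem_preimage.2 hR), ← integral_indicator_arc hab hb s]
      refine intervalIntegral.integral_congr fun t _ => ?_
      have : R * rotZ t ∈ X ↔ s + t ∈ Circle.exp ⁻¹' F := by
        conv_lhs => rw [hs]
        rw [hX, mul_rotZ_mem_fiberedProduct]
        simp [hR]
      by_cases h : R * rotZ t ∈ X
      · exact (Set.indicator_of_mem h _).trans (Set.indicator_of_mem (this.1 h) (1 : ℝ → ℝ)).symm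
      · exact (Set.indicator_of_notMem h _).trans
          (Set.indicator_of_notMem (fun h' => h (this.2 h')) _).symm
    · rw [Set.indicator_of_notMem (by exact hR)]
      refine (intervalIntegral.integral_congr (g := fun _ => (0 : ℝ)) fun t _ => ?_).trans (by simp)
      have : R * rotZ t ∉ X := by
        rw [hs, hX, mul_rotZ_mem_fiberedProduct]
        simp [hR]
      simp only [Set.indicator_of_notMem this]
  simp only [hleft, hright] at hswap
  rw [intervalIntegral.integral_const, integral_indicator_const _ (continuous_base.measurable hB)]
    at hswap
  rw [measureReal_def (haarSO3.map base), Measure.map_apply continuous_base.measurable hB,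
    ← measureReal_def]
  have hpi := Real.pi_pos
  simp only [smul_eq_mul, sub_zero] at hswap
  field_simp
  linarith

/-! ### The rotation-invariant measure of the sphere in Lambert coordinates -/

theorem rotate_rotY (t : ℝ) (x : S2) :
    (rotate (rotY t) x).1 0 = Real.cos t * x.1 0 + Real.sin t * x.1 2 ∧
    (rotate (rotY t) x).1 2 = -Real.sin t * x.1 0 + Real.cos t * x.1 2 := by
  simp [rotate_apply, rotY]

theorem S2.abs_coord_le (x : S2) (i : Fin 3) : |x.1 i| ≤ 1 := by
  have h := EuclideanSpace.norm_eq x.1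
  have h2 := S2.sum_sq x
  rw [abs_le_one_iff_mul_self_le_one]
  fin_cases i <;> simp <;> nlinarith [sq_nonneg (x.1 0), sq_nonneg (x.1 1), sq_nonneg (x.1 2)]

theorem integrable_of_continuous_S2 {ν : Measure S2} [IsFiniteMeasure ν] {f : S2 → ℝ}
    (hf : Continuous f) : Integrable f ν :=
  hf.integrable_of_hasCompactSupport (HasCompactSupport.of_compactSpace f)

theorem integral_comp_rotate {ν : Measure S2} {g : SO3} (hν : ν.map (rotate g) = ν) {f : S2 → ℝ}
    (hf : Continuous f) : ∫ x, f (rotate g x) ∂ν = ∫ x, f x ∂ν := by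
  conv_rhs => rw [← hν]
  rw [integral_map (continuous_rotate g).measurable.aemeasurable hf.aestronglyMeasurable]

/-- Invariance under infinitesimal rotations about the second axis, tested on `x z ^ j`. For
`j = 0` the truncated exponent on the right is harmless, because the integral is multiplied by `0`. -/
theorem integral_pow_succ_eq {ν : Measure S2} [IsFiniteMeasure ν]
    (hν : ∀ g, ν.map (rotate g) = ν) (j : ℕ) :
    ∫ x : S2, x.1 2 ^ (j + 1) ∂ν = j * ∫ x : S2, x.1 0 ^ 2 * x.1 2 ^ (j - 1) ∂ν := by
  have c0 := S2.continuous_coord 0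
  have c2 := S2.continuous_coord 2
  let u : ℝ → S2 → ℝ := fun t x => Real.cos t * x.1 0 + Real.sin t * x.1 2
  let w : ℝ → S2 → ℝ := fun t x => -Real.sin t * x.1 0 + Real.cos t * x.1 2
  let F : ℝ → S2 → ℝ := fun t x => u t x * w t x ^ j
  let F' : ℝ → S2 → ℝ := fun t x =>
    w t x * w t x ^ j + u t x * (j * w t x ^ (j - 1) * (-u t x))
  have hu : ∀ t, Continuous (u t) := fun t => by fun_prop
  have hw : ∀ t, Continuous (w t) := fun t => by fun_prop
  have hF : ∀ t, Continuous (F t) := fun t => (hu t).mul ((hw t).pow j)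
  have hF' : ∀ t, Continuous (F' t) := fun t => by
    have := hu t
    have := hw t
    fun_prop
  have habs : ∀ a b c d : ℝ, |a| ≤ 1 → |b| ≤ 1 → |c| ≤ 1 → |d| ≤ 1 → |a * b + c * d| ≤ 2 := by
    intro a b c d ha hb hc hd
    refine (abs_add_le _ _).trans ?_
    rw [abs_mul, abs_mul]
    nlinarith [abs_nonneg a, abs_nonneg b, abs_nonneg c, abs_nonneg d]
  have hub : ∀ t x, |u t x| ≤ 2 := fun t x =>
    habs _ _ _ _ (Real.abs_cos_le_one t) (S2.abs_coord_le x 0) (Real.abs_sin_le_one t)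
      (S2.abs_coord_le x 2)
  have hwb : ∀ t x, |w t x| ≤ 2 := fun t x =>
    habs _ _ _ _ (by rw [abs_neg]; exact Real.abs_sin_le_one t) (S2.abs_coord_le x 0)
      (Real.abs_cos_le_one t) (S2.abs_coord_le x 2)
  have hderu : ∀ t x, HasDerivAt (fun t => u t x) (w t x) t := fun t x =>
    ((Real.hasDerivAt_cos t).mul_const _).add ((Real.hasDerivAt_sin t).mul_const _)
  have hderw : ∀ t x, HasDerivAt (fun t => w t x) (-u t x) t := fun t x => by
    have h := ((Real.hasDerivAt_sin t).neg.mul_const (x.1 0)).add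
      ((Real.hasDerivAt_cos t).mul_const (x.1 2))
    refine h.congr_deriv ?_
    simp only [u]
    ring
  have key := (hasDerivAt_integral_of_dominated_loc_of_deriv_le (μ := ν) (F := F) (F' := F')
    (x₀ := (0 : ℝ)) (s := Set.univ) (bound := fun _ => 2 * 2 ^ j + 2 * (j * 2 ^ (j - 1) * 2))
    Filter.univ_mem (Filter.Eventually.of_forall fun t => (hF t).aestronglyMeasurable)
    (integrable_of_continuous_S2 (hF 0)) (hF' 0).aestronglyMeasurable
    (Filter.Eventually.of_forall fun x t _ => by
      refine (norm_add_le _ _).trans ?_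
      simp only [norm_mul, norm_pow, norm_neg, Real.norm_eq_abs, Nat.abs_cast]
      have := hub t x
      have := hwb t x
      gcongr)
    (integrable_const _)
    (Filter.Eventually.of_forall fun x t _ => (hderu t x).mul ((hderw t x).pow j))).2
  -- `F t` is the function `x z ^ j` rotated by the angle `t`, so that its integral is constant
  have hconst : (fun t => ∫ x, F t x ∂ν) = fun _ => ∫ x, F 0 x ∂ν := by
    funext t
    have h0 : ∀ s, ∫ x, F s x ∂ν = ∫ x : S2, x.1 0 * x.1 2 ^ j ∂ν := by
      intro s
      rw [← integral_comp_rotate (hν (rotY s)) (f := fun x => x.1 0 * x.1 2 ^ j)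
        (c0.mul (c2.pow j))]
      refine integral_congr_ae (Filter.Eventually.of_forall fun x => ?_)
      simp only [F, u, w, (rotate_rotY s x).1, (rotate_rotY s x).2]
    rw [h0, h0]
  rw [hconst] at key
  have h0 := (hasDerivAt_const (0 : ℝ) (∫ x, F 0 x ∂ν)).unique key
  have hsplit : ∫ x, F' 0 x ∂ν =
      ∫ x : S2, x.1 2 ^ (j + 1) ∂ν - j * ∫ x : S2, x.1 0 ^ 2 * x.1 2 ^ (j - 1) ∂ν := by
    rw [← integral_const_mul, ← integral_sub
      (integrable_of_continuous_S2 (f := fun x => x.1 2 ^ (j + 1)) (c2.pow _))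
      (integrable_of_continuous_S2 (f := fun x => j * (x.1 0 ^ 2 * x.1 2 ^ (j - 1)))
        (by fun_prop))]
    refine integral_congr_ae (Filter.Eventually.of_forall fun x => ?_)
    simp only [F', u, w, Real.cos_zero, Real.sin_zero]
    ring
  linarith

/-- A quarter turn about the third axis exchanges `x ^ 2` and `y ^ 2`, whose sum is `1 - z ^ 2`. -/
theorem integral_sq_coord_eq {ν : Measure S2} [IsFiniteMeasure ν]
    (hν : ∀ g, ν.map (rotate g) = ν) (j : ℕ) :
    2 * ∫ x : S2, x.1 0 ^ 2 * x.1 2 ^ j ∂ν =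
      ∫ x : S2, x.1 2 ^ j ∂ν - ∫ x : S2, x.1 2 ^ (j + 2) ∂ν := by
  have c0 := S2.continuous_coord 0
  have c1 := S2.continuous_coord 1
  have c2 := S2.continuous_coord 2
  have h : ∫ x : S2, x.1 0 ^ 2 * x.1 2 ^ j ∂ν = ∫ x : S2, x.1 1 ^ 2 * x.1 2 ^ j ∂ν := by
    rw [← integral_comp_rotate (hν (rotZ (Real.pi / 2))) (by fun_prop)]
    refine integral_congr_ae (Filter.Eventually.of_forall fun x => ?_)
    simp [rotate_apply, rotZ]
  rw [two_mul]
  nth_rw 2 [h]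
  rw [← integral_add (integrable_of_continuous_S2 (by fun_prop))
    (integrable_of_continuous_S2 (by fun_prop)),
    ← integral_sub (integrable_of_continuous_S2 (by fun_prop))
    (integrable_of_continuous_S2 (by fun_prop))]
  refine integral_congr_ae (Filter.Eventually.of_forall fun x => ?_)
  have := S2.sum_sq x
  simp only
  linear_combination x.1 2 ^ j * this

/-- The moments of the height under a rotation-invariant probability measure are those of the
uniform distribution on `[-1, 1]`. -/
theorem integral_height_pow {ν : Measure S2} [IsProbabilityMeasure ν]
    (hν : ∀ g, ν.map (rotate g) = ν) (k : ℕ) :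
    ∫ x : S2, x.1 2 ^ k ∂ν = (1 + (-1) ^ k) / (2 * (k + 1)) := by
  induction k using Nat.strong_induction_on with
  | _ k ih =>
    match k with
    | 0 => simp
    | 1 => simpa using integral_pow_succ_eq hν 0
    | j + 2 =>
      have h1 := integral_pow_succ_eq hν (j + 1)
      have h2 := integral_sq_coord_eq hν j
      rw [ih j (by omega)] at h2
      simp only [Nat.add_sub_cancel] at h1
      push_cast at h1 ⊢
      have h3 : (∫ x : S2, x.1 2 ^ (j + 2) ∂ν) * (j + 3) = (1 + (-1) ^ j) / 2 := by
        have : ((j : ℝ) + 1) * ((1 + (-1) ^ j) / (2 * (j + 1))) = (1 + (-1) ^ j) / 2 := by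
          field_simp
        linear_combination 2 * h1 + ((j : ℝ) + 1) * h2 + this
      rw [eq_div_iff (by positivity), pow_add]
      linear_combination 2 * h3

theorem integral_one_sub_two_mul_pow (k : ℕ) :
    ∫ y in (0 : ℝ)..1, (1 - 2 * y) ^ k = (1 + (-1) ^ k) / (2 * (k + 1)) := by
  rw [intervalIntegral.integral_comp_sub_mul (fun z => z ^ k) two_ne_zero, integral_pow]
  norm_num
  have : (k : ℝ) + 1 ≠ 0 := by positivity
  field_simp
  ring

/-- The height is uniformly distributed under a rotation-invariant probability measure, because a
distribution on `[-1, 1]` is determined by its moments. -/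
theorem integral_height_comp {ν : Measure S2} [IsProbabilityMeasure ν]
    (hν : ∀ g, ν.map (rotate g) = ν) {F : ℝ → ℝ} (hF : Continuous F) :
    ∫ x : S2, F (x.1 2) ∂ν = ∫ y in (0 : ℝ)..1, F (1 - 2 * y) := by
  have c2 := S2.continuous_coord 2
  have hpoly : ∀ p : Polynomial ℝ,
      ∫ x : S2, p.eval (x.1 2) ∂ν = ∫ y in (0 : ℝ)..1, p.eval (1 - 2 * y) := by
    intro p
    simp only [Polynomial.eval_eq_sum_range]
    rw [integral_finsetSum _ fun i _ => integrable_of_continuous_S2 (by fun_prop),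
      intervalIntegral.integral_finsetSum fun i _ =>
        Continuous.intervalIntegrable (by fun_prop) _ _]
    refine Finset.sum_congr rfl fun i _ => ?_
    rw [integral_const_mul, intervalIntegral.integral_const_mul, integral_height_pow hν,
      integral_one_sub_two_mul_pow]
  refine eq_of_forall_dist_le fun ε hε => ?_
  obtain ⟨p, hp⟩ := exists_polynomial_near_of_continuousOn (-1) 1 F hF.continuousOn (ε / 2)
    (by positivity)
  have h1 : |∫ x : S2, F (x.1 2) ∂ν - ∫ x : S2, p.eval (x.1 2) ∂ν| ≤ ε / 2 := by
    rw [← integral_sub (integrable_of_continuous_S2 (f := fun x => F (x.1 2)) (by fun_prop))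
      (integrable_of_continuous_S2 (f := fun x => p.eval (x.1 2)) (p.continuous.comp c2))]
    have := norm_integral_le_of_norm_le_const (μ := ν) (C := ε / 2)
      (f := fun x : S2 => F (x.1 2) - p.eval (x.1 2)) (Filter.Eventually.of_forall fun x => by
        rw [Real.norm_eq_abs, abs_sub_comm]
        exact (hp _ (abs_le.1 (S2.abs_coord_le x 2))).le)
    simpa using this
  have h2 : |(∫ y in (0 : ℝ)..1, F (1 - 2 * y)) - ∫ y in (0 : ℝ)..1, p.eval (1 - 2 * y)| ≤ ε / 2 := by
    rw [← intervalIntegral.integral_sub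
      (Continuous.intervalIntegrable (u := fun y => F (1 - 2 * y)) (by fun_prop) _ _)
      (Continuous.intervalIntegrable (u := fun y => p.eval (1 - 2 * y)) (by fun_prop) _ _)]
    have := intervalIntegral.norm_integral_le_of_norm_le_const (C := ε / 2) (a := (0 : ℝ)) (b := 1)
      (f := fun y : ℝ => F (1 - 2 * y) - p.eval (1 - 2 * y)) (fun y hy => by
        rw [Set.uIoc_of_le zero_le_one] at hy
        rw [Real.norm_eq_abs, abs_sub_comm]
        exact (hp _ ⟨by linarith [hy.2], by linarith [hy.1]⟩).le)
    simpa using this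
  rw [hpoly] at h1
  rw [Real.dist_eq]
  dsimp only at h1 h2
  rw [abs_le] at h1 h2 ⊢
  constructor <;> linarith [h1.1, h1.2, h2.1, h2.2]

theorem continuous_lambert : Continuous lambert := by
  refine Continuous.subtype_mk ((PiLp.continuous_toLp 2 _).comp (continuous_pi fun i => ?_)) _
  fin_cases i <;> simp <;> fun_prop

theorem integral_unitInterval (g : ℝ → ℝ) : ∫ s : I, g s = ∫ s in (0 : ℝ)..1, g s := by
  rw [intervalIntegral.integral_of_le zero_le_one, ← integral_Icc_eq_integral_Ioc]
  exact integral_subtype measurableSet_Icc g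

theorem lambert_eq_rotate (s y : I) :
    lambert (s, y) = rotate (rotZ (2 * Real.pi * s)) (lambert (0, y)) := by
  apply S2.ext <;> simp [lambert, rotate_apply, rotZ] <;> ring

theorem exists_rotate_lambert (x : S2) :
    ∃ t : ℝ, x = rotate (rotZ t) (lambert (0, Set.projIcc 0 1 zero_le_one ((1 - x.1 2) / 2))) := by
  have hz := abs_le.1 (S2.abs_coord_le x 2)
  have hy : (1 - x.1 2) / 2 ∈ Set.Icc (0 : ℝ) 1 := ⟨by linarith [hz.2], by linarith [hz.1]⟩
  rw [Set.projIcc_of_mem _ hy]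
  refine ⟨azimuth x, ?_⟩
  have hr : 2 * √((1 - x.1 2) / 2 - ((1 - x.1 2) / 2) ^ 2) = Real.sin (polarAngle x) := by
    rw [sin_polarAngle, show (1 - x.1 2) / 2 - ((1 - x.1 2) / 2) ^ 2 =
      (1 - x.1 2 ^ 2) / 2 ^ 2 by ring, Real.sqrt_div' _ (by positivity), Real.sqrt_sq (by norm_num)]
    ring
  have h0 := sin_mul_cos_azimuth x
  have h1 := sin_mul_sin_azimuth x
  apply S2.ext
  · simp [lambert, rotate_apply, rotZ, hr]; linarith
  · simp [lambert, rotate_apply, rotZ, hr]; linarith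
  · simp [lambert, rotate_apply, rotZ]; ring

/-- The image of the Lebesgue measure under the Lambert map is the only rotation-invariant
probability measure on the sphere: averaging over the rotations about the third axis reduces the
integral of a function to that of a function of the height. -/
theorem eq_map_lambert_of_rotate_invariant {ν : Measure S2} [IsProbabilityMeasure ν]
    (hν : ∀ g, ν.map (rotate g) = ν) : ν = (volume : Measure (I × I)).map lambert := by
  have : IsProbabilityMeasure ((volume : Measure (I × I)).map lambert) :=
    Measure.isProbabilityMeasure_map continuous_lambert.measurable.aemeasurable
  refine ext_of_forall_integral_eq_of_IsFiniteMeasure fun f => ?_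
  have hf := f.continuous
  let F : ℝ → ℝ := fun z => ∫ s : I, f (lambert (s, Set.projIcc 0 1 zero_le_one ((1 - z) / 2)))
  have hF : Continuous F := by
    have h := continuous_parametric_integral_of_continuous (μ := (volume : Measure I))
      (f := fun (z : ℝ) (s : I) => f (lambert (s, Set.projIcc 0 1 zero_le_one ((1 - z) / 2))))
      (hf.comp (continuous_lambert.comp (continuous_snd.prodMk
        (continuous_projIcc.comp (by fun_prop))))) isCompact_univ
    simpa only [Measure.restrict_univ] using h
  have hcont : Continuous fun p : ℝ × S2 => rotate (rotZ (2 * Real.pi * p.1)) p.2 := by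
    refine Continuous.subtype_mk ?_ _
    have : (fun p : ℝ × S2 => rotIso (rotZ (2 * Real.pi * p.1)) p.2.1) = fun p : ℝ × S2 =>
        WithLp.toLp 2 fun i : Fin 3 => (rotZ (2 * Real.pi * p.1)).1 i 0 * p.2.1 0 +
          (rotZ (2 * Real.pi * p.1)).1 i 1 * p.2.1 1 + (rotZ (2 * Real.pi * p.1)).1 i 2 * p.2.1 2 := by
      funext p
      ext i
      exact rotIso_apply _ _ i
    rw [this]
    have hc : ∀ i j : Fin 3, Continuous fun p : ℝ × S2 => (rotZ (2 * Real.pi * p.1)).1 i j :=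
      fun i j => (continuous_subtype_val.comp (continuous_rotZ.comp (by fun_prop))).matrix_elem i j
    have hd : ∀ i : Fin 3, Continuous fun p : ℝ × S2 => p.2.1 i :=
      fun i => (S2.continuous_coord i).comp continuous_snd
    exact (PiLp.continuous_toLp 2 _).comp (continuous_pi fun i =>
      (((hc i 0).mul (hd 0)).add ((hc i 1).mul (hd 1))).add ((hc i 2).mul (hd 2)))
  -- averaging over the rotations about the third axis makes the azimuth uniform
  have hav : ∀ x : S2, ∫ t in (0 : ℝ)..1, f (rotate (rotZ (2 * Real.pi * t)) x) = F (x.1 2) := by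
    intro x
    obtain ⟨θ, hθ⟩ := exists_rotate_lambert x
    simp only [F]
    set y : I := Set.projIcc 0 1 zero_le_one ((1 - x.1 2) / 2)
    let g : ℝ → ℝ := fun t => f (rotate (rotZ (2 * Real.pi * t)) (lambert (0, y)))
    have hg : Function.Periodic g 1 := by
      intro t
      simp only [g]
      rw [rotZ_eq_of_cos_sin (s := 2 * Real.pi * (t + 1)) (t := 2 * Real.pi * t)
        (by rw [mul_add, mul_one, Real.cos_add_two_pi])
        (by rw [mul_add, mul_one, Real.sin_add_two_pi])]
    have h1 : ∫ s : I, f (lambert (s, y)) = ∫ s in (0 : ℝ)..1, g s := by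
      rw [← integral_unitInterval]
      exact integral_congr_ae (Filter.Eventually.of_forall fun s => by
        simp only [g, lambert_eq_rotate s y])
    have h2 : ∀ t : ℝ, f (rotate (rotZ (2 * Real.pi * t)) x) = g (θ / (2 * Real.pi) + t) := by
      intro t
      have hpi := Real.pi_pos
      simp only [g]
      rw [hθ, ← rotate_mul, ← rotZ_add]
      congr 4
      field_simp
      ring
    rw [h1]
    simp only [h2]
    rw [intervalIntegral.integral_comp_add_left g, add_zero,
      hg.intervalIntegral_add_eq (θ / (2 * Real.pi)) 0, zero_add]
  have hswap : ∫ t in (0 : ℝ)..1, ∫ x, f (rotate (rotZ (2 * Real.pi * t)) x) ∂ν =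
      ∫ x, (∫ t in (0 : ℝ)..1, f (rotate (rotZ (2 * Real.pi * t)) x)) ∂ν := by
    refine intervalIntegral_integral_swap ?_
    have : IsFiniteMeasure (volume.restrict (Set.uIoc (0 : ℝ) 1)) := by
      rw [Set.uIoc]; infer_instance
    refine Integrable.of_bound (hf.comp hcont).aestronglyMeasurable ‖f‖
      (Filter.Eventually.of_forall fun p => ?_)
    exact f.norm_coe_le_norm _
  have hleft : ∀ t : ℝ, ∫ x, f (rotate (rotZ (2 * Real.pi * t)) x) ∂ν = ∫ x, f x ∂ν := fun t =>
    integral_comp_rotate (hν _) hf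
  simp only [hleft, hav, intervalIntegral.integral_const, sub_zero, one_smul] at hswap
  rw [hswap, integral_height_comp hν hF, integral_map continuous_lambert.measurable.aemeasurable
    hf.aestronglyMeasurable]
  have hint : Integrable (fun p : I × I => f (lambert p)) (volume.prod volume) :=
    Integrable.of_bound (hf.comp continuous_lambert).aestronglyMeasurable ‖f‖
      (Filter.Eventually.of_forall fun p => f.norm_coe_le_norm _)
  rw [Measure.volume_eq_prod, integral_prod_symm _ hint, ← integral_unitInterval]
  refine integral_congr_ae (Filter.Eventually.of_forall fun y => ?_)
  simp only [F]
  have : (1 - (1 - 2 * (y : ℝ))) / 2 = y := by ring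
  simp only [this, Set.projIcc_val]

/-- The image of Haar measure under the Hopf fibration is the area measure of the sphere. -/
theorem map_base_haarSO3 : haarSO3.map base = (volume : Measure (I × I)).map lambert := by
  have : IsProbabilityMeasure (haarSO3.map base) :=
    Measure.isProbabilityMeasure_map continuous_base.measurable.aemeasurable
  refine eq_map_lambert_of_rotate_invariant fun g => ?_
  rw [Measure.map_map (continuous_rotate g).measurable continuous_base.measurable]
  have : rotate g ∘ base = base ∘ (g * ·) := by
    funext R
    simp [base_mul]
  rw [this, ← Measure.map_map continuous_base.measurable (measurable_const_mul g),
    map_mul_left_eq_self]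

open scoped Pointwise

/-! ### Boundary layers of convex sets in space -/

local notation "E3" => EuclideanSpace ℝ (Fin 3)

/-- The part of a convex set that leaves it when translated by `h • e` has volume `O(h)`, because
its translates by the multiples of `h • e` are disjoint. -/
theorem Convex.volume_translate_diff_le {K : Set E3} (hK : Convex ℝ K) {e : E3} (he : ‖e‖ = 1)
    {h : ℝ} (hh : 0 < h) :
    volume.real {x | x ∈ K ∧ ‖x‖ ≤ 1 ∧ x + h • e ∉ K} ≤
      h * volume.real (Metric.closedBall (0 : E3) 2) := by
  set A : Set E3 := {x | x ∈ K ∧ ‖x‖ ≤ 1 ∧ x + h • e ∉ K} with hA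
  set V := volume.real (Metric.closedBall (0 : E3) 2) with hV
  have hAnull : NullMeasurableSet A volume := by
    have h1 : A = (K ∩ Metric.closedBall 0 1) ∩ ((fun x => x + h • e) ⁻¹' K)ᶜ := by
      ext x
      simp only [hA, Set.mem_ofPred_eq, Set.mem_inter_iff, mem_closedBall_zero_iff, Set.mem_compl_iff,
        Set.mem_preimage, and_assoc]
    rw [h1]
    exact ((hK.nullMeasurableSet volume).inter
      Metric.isClosed_closedBall.measurableSet.nullMeasurableSet).inter
      ((hK.translate_preimage_left (h • e)).nullMeasurableSet volume).compl
  let T : ℕ → Set E3 := fun j => (fun x => x + (-(j * h)) • e) ⁻¹' A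
  have hT : ∀ j, volume (T j) = volume A := fun j => measure_preimage_add_right _ _ _
  have hdisj : ∀ i j, i < j → Disjoint (T i) (T j) := by
    intro i j hij
    rw [Set.disjoint_left]
    rintro x ⟨h1, -, h2⟩ ⟨h3, -, h4⟩
    simp only at h1 h2 h3 h4
    -- the translate of the point of `T j` lies on the segment to the point of `T i`
    apply h4
    have hji : (1 : ℝ) ≤ (j : ℝ) - i := by
      have : (i : ℝ) + 1 ≤ j := by exact_mod_cast hij
      linarith
    have hcv := hK h3 h1 (a := 1 - 1 / ((j : ℝ) - i)) (b := 1 / ((j : ℝ) - i))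
      (by rw [sub_nonneg, div_le_one (by linarith)]; exact hji) (by positivity) (by ring)
    convert hcv using 1
    have hne : (j : ℝ) - i ≠ 0 := by linarith
    ext k
    simp only [PiLp.add_apply, PiLp.smul_apply, smul_eq_mul]
    field_simp
    ring
  set J := ⌈1 / h⌉₊ with hJ
  have hJ1 : 1 / h ≤ J := Nat.le_ceil _
  have hsub : (⋃ j ∈ Finset.range J, T j) ⊆ Metric.closedBall (0 : E3) 2 := by
    intro x hx
    simp only [Set.mem_iUnion, Finset.mem_range] at hx
    obtain ⟨j, hj, -, hx, -⟩ := hx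
    have hj1 : (j : ℝ) < 1 / h := Nat.lt_ceil.1 hj
    have hj2 : (j : ℝ) * h ≤ 1 := by
      rw [lt_div_iff₀ hh] at hj1
      exact hj1.le
    rw [mem_closedBall_zero_iff]
    have : x = (x + (-(j * h)) • e) + (j * h) • e := by module
    rw [this]
    refine (norm_add_le _ _).trans ?_
    rw [norm_smul, he, mul_one, Real.norm_eq_abs, abs_of_nonneg (by positivity)]
    simp only at hx
    linarith
  have hsum : (J : ENNReal) * volume A ≤ volume (Metric.closedBall (0 : E3) 2) := by
    refine le_trans (le_of_eq ?_) (measure_mono hsub)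
    rw [measure_biUnion_finset₀]
    · simp [hT]
    · intro i _ j _ hij
      rcases lt_or_gt_of_ne hij with h' | h'
      · exact (hdisj i j h').aedisjoint
      · exact (hdisj j i h').symm.aedisjoint
    · intro j _
      exact hAnull.preimage (measurePreserving_add_right volume _).quasiMeasurePreserving
  have hfin : volume (Metric.closedBall (0 : E3) 2) ≠ ⊤ := measure_closedBall_lt_top.ne
  have hreal : (J : ℝ) * volume.real A ≤ V := by
    have := ENNReal.toReal_mono hfin hsum
    simpa [Measure.real, hV] using this
  have h0 : 0 ≤ volume.real A := measureReal_nonneg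
  have : 1 / h * volume.real A ≤ V := (mul_le_mul_of_nonneg_right hJ1 h0).trans hreal
  rw [div_mul_eq_mul_div, one_mul, div_le_iff₀ hh] at this
  linarith

/-- A point that stays in a convex set under the six translations by `± 3 ε` along the axes has
distance more than `ε` to the complement. -/
theorem Convex.mem_of_translates_mem {K : Set E3} (hK : Convex ℝ K) {ε : ℝ} (hε : 0 < ε) {x q : E3}
    (h : ∀ (k : Fin 3) (s : ℝ), s = 1 ∨ s = -1 →
      x + (3 * ε) • (s • EuclideanSpace.single k (1 : ℝ)) ∈ K)
    (hq : dist x q ≤ ε) : q ∈ K := by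
  have hk : ∀ k : Fin 3, x + (3 * (q k - x k)) • EuclideanSpace.single k (1 : ℝ) ∈ K := by
    intro k
    have hw : |q k - x k| ≤ ε := by
      have h1 := PiLp.norm_apply_le (q - x) k
      rw [dist_comm, dist_eq_norm] at hq
      simpa using h1.trans hq
    rw [abs_le] at hw
    have hcv := hK (h k 1 (Or.inl rfl)) (h k (-1) (Or.inr rfl))
      (a := (ε + (q k - x k)) / (2 * ε)) (b := (ε - (q k - x k)) / (2 * ε))
      (div_nonneg (by linarith) (by linarith)) (div_nonneg (by linarith) (by linarith))
      (by field_simp; ring)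
    convert hcv using 1
    ext i
    simp only [PiLp.add_apply, PiLp.smul_apply, smul_eq_mul]
    field_simp
    ring
  have hsum := hK.sum_mem (t := Finset.univ) (w := fun _ : Fin 3 => (1 / 3 : ℝ))
    (fun _ _ => by norm_num) (by norm_num) (fun k _ => hk k)
  convert hsum using 1
  ext i
  fin_cases i <;> simp [Fin.sum_univ_three] <;> ring

/-- The points of the unit ball in a convex set that are close to its complement have volume
`O(ε)`: each of them leaves the set under one of six translations. -/
theorem Convex.volume_inner_layer_le {K : Set E3} (hK : Convex ℝ K) {ε : ℝ} (hε : 0 < ε) :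
    volume.real {x | x ∈ K ∧ ‖x‖ ≤ 1 ∧ ∃ q ∉ K, dist x q ≤ ε} ≤
      18 * ε * volume.real (Metric.closedBall (0 : E3) 2) := by
  set V := volume.real (Metric.closedBall (0 : E3) 2)
  let A : Fin 3 × Bool → Set E3 := fun p => {x | x ∈ K ∧ ‖x‖ ≤ 1 ∧
    x + (3 * ε) • ((if p.2 then (1 : ℝ) else -1) • EuclideanSpace.single p.1 (1 : ℝ)) ∉ K}
  have hA : ∀ p, volume.real (A p) ≤ 3 * ε * V := by
    rintro ⟨k, b⟩
    refine Convex.volume_translate_diff_le hK ?_ (by positivity)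
    cases b <;> simp
  have hsub : {x | x ∈ K ∧ ‖x‖ ≤ 1 ∧ ∃ q ∉ K, dist x q ≤ ε} ⊆ ⋃ p ∈ Finset.univ, A p := by
    rintro x ⟨hx, hx1, q, hq, hxq⟩
    by_contra hcon
    refine hq (Convex.mem_of_translates_mem hK hε ?_ hxq)
    intro k s hs
    by_contra hks
    refine hcon (Set.mem_biUnion (x := (k, decide (s = 1)))
      (Finset.mem_coe.2 (Finset.mem_univ _)) ⟨hx, hx1, ?_⟩)
    rcases hs with rfl | rfl
    · simpa using hks
    · norm_num at hks ⊢
      exact hks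
  have hfin : volume (⋃ p ∈ (Finset.univ : Finset (Fin 3 × Bool)), A p) ≠ ⊤ := by
    refine ((measure_mono ?_).trans_lt
      (measure_closedBall_lt_top (x := (0 : E3)) (r := 1))).ne
    simp only [Set.iUnion_subset_iff]
    rintro p - x ⟨-, hx, -⟩
    simpa using hx
  refine (measureReal_mono hsub hfin).trans ((measureReal_biUnion_finset_le _ _).trans ?_)
  refine (Finset.sum_le_sum fun p _ => hA p).trans (le_of_eq ?_)
  simp
  ring

/-- Outside a closed convex set `K` the layer of width `ε` is an inner layer of the convex set of
all points at distance at most `ε` from `K`. -/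
theorem Convex.volume_outer_layer_le {K : Set E3} (hK : Convex ℝ K) (hcl : IsClosed K) {ε : ℝ}
    (hε : 0 < ε) :
    volume.real {x | x ∉ K ∧ ‖x‖ ≤ 1 ∧ ∃ q ∈ K, dist x q ≤ ε} ≤
      36 * ε * volume.real (Metric.closedBall (0 : E3) 2) := by
  have h := Convex.volume_inner_layer_le (hK.cthickening ε) (ε := 2 * ε) (by positivity)
  refine (measureReal_mono ?_ ?_).trans (h.trans (le_of_eq (by ring)))
  · rintro x ⟨hx, hx1, q, hq, hxq⟩
    refine ⟨Metric.mem_cthickening_of_dist_le x q ε K hq hxq, hx1, ?_⟩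
    -- moving away from a hyperplane that separates `x` from `K` increases the distance to `K`
    obtain ⟨f, u, hfx, hfK⟩ := geometric_hahn_banach_point_closed hK hcl hx
    set ν := (InnerProductSpace.toDual ℝ E3).symm f with hν
    have hf : ∀ y, f y = inner ℝ ν y := fun y => by
      rw [hν, InnerProductSpace.toDual_symm_apply]
    have hν0 : 0 < ‖ν‖ := by
      rw [norm_pos_iff]
      intro h0
      have h1 := hfK q hq
      rw [hf, h0, inner_zero_left] at h1 hfx
      linarith
    refine ⟨x - (2 * ε / ‖ν‖) • ν, ?_, ?_⟩
    · intro hmem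
      have hd : ∀ b ∈ K, 2 * ε ≤ dist (x - (2 * ε / ‖ν‖) • ν) b := by
        intro b hb
        rw [dist_comm, dist_eq_norm]
        have h1 := real_inner_le_norm ν (b - (x - (2 * ε / ‖ν‖) • ν))
        rw [inner_sub_right, inner_sub_right, inner_smul_right, real_inner_self_eq_norm_sq,
          ← hf, ← hf] at h1
        have h2 := hfK b hb
        have h3 : 2 * ε / ‖ν‖ * ‖ν‖ ^ 2 = ‖ν‖ * (2 * ε) := by field_simp
        rw [h3] at h1
        exact le_of_mul_le_mul_left (by linarith) hν0
      have h4 : 2 * ε ≤ Metric.infDist (x - (2 * ε / ‖ν‖) • ν) K :=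
        (Metric.le_infDist ⟨q, hq⟩).2 fun {b} hb => hd b hb
      rw [Metric.cthickening_eq_preimage_infEDist, Set.mem_preimage, Set.mem_Iic] at hmem
      have h5 : Metric.infDist (x - (2 * ε / ‖ν‖) • ν) K ≤ ε :=
        ENNReal.toReal_le_of_le_ofReal hε.le hmem
      linarith
    · rw [dist_eq_norm, sub_sub_cancel, norm_smul, Real.norm_eq_abs, abs_of_nonneg (by positivity)]
      exact (div_mul_cancel₀ _ hν0.ne').le
  · refine ((measure_mono ?_).trans_lt
      (measure_closedBall_lt_top (x := (0 : E3)) (r := 1))).ne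
    rintro x ⟨-, hx, -⟩
    simpa using hx

/-! ### Boundary layers of spherical convex sets -/

/-- The part of the closed ball of radius `2` that lies in the cone over a set of directions. -/
def truncatedCone (B : Set S2) : Set E3 :=
  (fun p : ℝ × S2 => p.1 • p.2.1) '' (Set.Icc 0 2 ×ˢ B)

theorem smul_mem_truncatedCone_iff {B : Set S2} {t : ℝ} (ht : 0 < t) (ht2 : t ≤ 2) {u : S2} :
    t • u.1 ∈ truncatedCone B ↔ u ∈ B := by
  constructor
  · rintro ⟨⟨s, b⟩, ⟨hs, hb⟩, h⟩
    simp only at h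
    have hn := congrArg norm h
    rw [norm_smul, norm_smul, mem_sphere_zero_iff_norm.1 u.2, mem_sphere_zero_iff_norm.1 b.2,
      mul_one, mul_one, Real.norm_of_nonneg hs.1, Real.norm_of_nonneg ht.le] at hn
    simp only at hn
    rw [hn] at h
    have : b = u := Subtype.ext (smul_right_injective _ ht.ne' h)
    exact this ▸ hb
  · exact fun hu => ⟨(t, u), ⟨⟨ht.le, ht2⟩, hu⟩, rfl⟩

theorem isClosed_truncatedCone {B : Set S2} (hB : IsClosed B) : IsClosed (truncatedCone B) := by
  refine (IsCompact.image (isCompact_Icc.prod hB.isCompact) ?_).isClosed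
  fun_prop

theorem IsSphericalConvex.convex_truncatedCone {B : Set S2} (hB : IsSphericalConvex B) :
    Convex ℝ (truncatedCone B) := by
  obtain ⟨-, ⟨v, hv⟩, hgeo⟩ := hB
  rintro _ ⟨⟨s, x⟩, ⟨hs, hx⟩, rfl⟩ _ ⟨⟨t, y⟩, ⟨ht, hy⟩, rfl⟩ a b ha hb hab
  simp only at hs ht ⊢
  set w : E3 := a • s • x.1 + b • t • y.1 with hw
  by_cases h0 : w = 0
  · exact ⟨(0, x), ⟨⟨le_rfl, by norm_num⟩, hx⟩, by simp [h0]⟩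
  have hn : 0 < ‖w‖ := norm_pos_iff.2 h0
  have hle : ‖w‖ ≤ 2 := by
    refine (norm_add_le _ _).trans ?_
    rw [norm_smul, norm_smul, norm_smul, norm_smul, mem_sphere_zero_iff_norm.1 x.2,
      mem_sphere_zero_iff_norm.1 y.2, Real.norm_of_nonneg hs.1, Real.norm_of_nonneg ht.1,
      Real.norm_of_nonneg ha, Real.norm_of_nonneg hb]
    nlinarith [hs.2, ht.2]
  let z : S2 := ⟨‖w‖⁻¹ • w, by
    rw [mem_sphere_zero_iff_norm, norm_smul, norm_inv, norm_norm, inv_mul_cancel₀ hn.ne']⟩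
  refine ⟨(‖w‖, z), ⟨⟨hn.le, hle⟩, hgeo x hx y hy z ⟨‖w‖⁻¹ * (a * s), ‖w‖⁻¹ * (b * t), ?_, ?_, ?_⟩⟩,
    ?_⟩
  · have := hs.1
    positivity
  · have := ht.1
    positivity
  · simp only [z, hw, smul_add, smul_smul]
  · simp only [z, smul_smul, mul_inv_cancel₀ hn.ne', one_smul]

/-- The points of the sphere that are close both to a set and to its complement. The closed and the
open thickening make the set measurable; the radius `2 ε` of the latter gives room for points at
distance exactly `ε` from the complement. -/
def boundaryLayer (ε : ℝ) (B : Set S2) : Set S2 :=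
  Metric.cthickening ε B ∩ Metric.thickening (2 * ε) Bᶜ

theorem measurableSet_boundaryLayer (ε : ℝ) (B : Set S2) : MeasurableSet (boundaryLayer ε B) :=
  Metric.isClosed_cthickening.measurableSet.inter Metric.isOpen_thickening.measurableSet

theorem map_rotate_toSphere (g : SO3) :
    (volume : Measure E3).toSphere.map (rotate g) = (volume : Measure E3).toSphere := by
  ext A hA
  rw [Measure.map_apply (continuous_rotate g).measurable hA,
    Measure.toSphere_apply' _ ((continuous_rotate g).measurable hA), Measure.toSphere_apply' _ hA]
  congr 1
  have : Set.Ioo (0 : ℝ) 1 • (Subtype.val '' (rotate g ⁻¹' A)) =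
      rotIso g ⁻¹' (Set.Ioo (0 : ℝ) 1 • (Subtype.val '' A)) := by
    ext x
    constructor
    · rintro ⟨t, ht, _, ⟨u, hu, rfl⟩, rfl⟩
      refine ⟨t, ht, (rotate g u).1, ⟨_, hu, rfl⟩, ?_⟩
      simp [rotate]
    · rintro ⟨t, ht, _, ⟨u, hu, rfl⟩, h⟩
      refine ⟨t, ht, (rotate g⁻¹ u).1, ⟨_, ?_, rfl⟩, ?_⟩
      · rw [Set.mem_preimage, ← rotate_mul, mul_inv_cancel, rotate_one]
        exact hu
      · apply (rotIso g).injective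
        have h1 : rotIso g (rotate g⁻¹ u).1 = u.1 := by
          have h2 : rotate g (rotate g⁻¹ u) = u := by
            rw [← rotate_mul, mul_inv_cancel, rotate_one]
          exact congrArg Subtype.val h2
        simp only [map_smul, h1]
        exact h
  rw [this]
  exact (rotIso g).measurePreserving.measure_preimage_emb
    (rotIso g).toHomeomorph.measurableEmbedding _

/-- The normalised area of a part of the sphere is the relative volume of its cone. -/
theorem map_lambert_real_apply {A : Set S2} (hA : MeasurableSet A) :
    ((volume : Measure (I × I)).map lambert).real A =
      volume.real (Set.Ioo (0 : ℝ) 1 • (Subtype.val '' A)) /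
        volume.real (Metric.ball (0 : E3) 1) := by
  set τ := (volume : Measure E3).toSphere with hτ
  have hτ0 : τ Set.univ ≠ 0 := by
    rw [Ne, Measure.measure_univ_eq_zero]
    exact Measure.toSphere_ne_zero _
  have hprob : IsProbabilityMeasure ((τ Set.univ)⁻¹ • τ) := by
    constructor
    rw [Measure.smul_apply, smul_eq_mul, ENNReal.inv_mul_cancel hτ0 (measure_ne_top _ _)]
  have hinv : ∀ g, ((τ Set.univ)⁻¹ • τ).map (rotate g) = (τ Set.univ)⁻¹ • τ := by
    intro g
    rw [Measure.map_smul, map_rotate_toSphere]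
  rw [← eq_map_lambert_of_rotate_invariant hinv, measureReal_ennreal_smul_apply, ENNReal.toReal_inv]
  have h1 : (τ Set.univ).toReal = 3 * volume.real (Metric.ball (0 : E3) 1) := by
    have := (volume : Measure E3).toSphere_real_apply_univ
    rwa [finrank_euclideanSpace_fin] at this
  have h2 : τ.real A = 3 * volume.real (Set.Ioo (0 : ℝ) 1 • (Subtype.val '' A)) := by
    rw [Measure.real, Measure.toSphere_apply' _ hA]
    simp [Measure.real]
  rw [h1, h2, mul_inv, div_eq_inv_mul]
  ring

/-- The boundary layers of spherical convex sets of any shape have area `O(ε)`. -/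
theorem exists_area_boundaryLayer_le : ∃ C : ℝ, 0 ≤ C ∧ ∀ (B : Set S2), IsSphericalConvex B →
    ∀ ε : ℝ, 0 < ε → (volume : Measure (I × I)).real (lambert ⁻¹' boundaryLayer ε B) ≤ C * ε := by
  refine ⟨72 * volume.real (Metric.closedBall (0 : E3) 2) / volume.real (Metric.ball (0 : E3) 1),
    by positivity, fun B hB ε hε => ?_⟩
  have hm := measurableSet_boundaryLayer ε B
  have h0 := map_lambert_real_apply hm
  rw [Measure.real, Measure.map_apply continuous_lambert.measurable hm, ← measureReal_def] at h0
  rw [h0, div_mul_eq_mul_div]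
  refine div_le_div_of_nonneg_right ?_ measureReal_nonneg
  set K := truncatedCone B
  have hK := hB.convex_truncatedCone
  have h1 := Convex.volume_inner_layer_le hK (ε := 2 * ε) (by positivity)
  have h2 := Convex.volume_outer_layer_le hK (isClosed_truncatedCone hB.1) hε
  have hsub : Set.Ioo (0 : ℝ) 1 • (Subtype.val '' boundaryLayer ε B) ⊆
      {x | x ∈ K ∧ ‖x‖ ≤ 1 ∧ ∃ q ∉ K, dist x q ≤ 2 * ε} ∪
        {x | x ∉ K ∧ ‖x‖ ≤ 1 ∧ ∃ q ∈ K, dist x q ≤ ε} := by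
    rintro _ ⟨t, ht, _, ⟨u, ⟨hu1, hu2⟩, rfl⟩, rfl⟩
    have hn : ‖t • u.1‖ ≤ 1 := by
      rw [norm_smul, mem_sphere_zero_iff_norm.1 u.2, mul_one, Real.norm_of_nonneg ht.1.le]
      exact ht.2.le
    have hdist : ∀ w : S2, dist (t • u.1) (t • w.1) ≤ dist u w := fun w => by
      rw [dist_smul₀, Real.norm_of_nonneg ht.1.le, Subtype.dist_eq]
      exact mul_le_of_le_one_left dist_nonneg ht.2.le
    have ht2 : t ≤ 2 := by linarith [ht.2]
    simp only
    by_cases huB : u ∈ B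
    · left
      rw [Metric.mem_thickening_iff] at hu2
      obtain ⟨w, hw, hwd⟩ := hu2
      exact ⟨(smul_mem_truncatedCone_iff ht.1 ht2).2 huB, hn, t • w.1,
        fun h => hw ((smul_mem_truncatedCone_iff ht.1 ht2).1 h), (hdist w).trans hwd.le⟩
    · right
      rw [hB.1.isCompact.cthickening_eq_biUnion_closedBall hε.le] at hu1
      simp only [Set.mem_iUnion, Metric.mem_closedBall] at hu1
      obtain ⟨w, hw, hwd⟩ := hu1
      exact ⟨fun h => huB ((smul_mem_truncatedCone_iff ht.1 ht2).1 h), hn, t • w.1,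
        (smul_mem_truncatedCone_iff ht.1 ht2).2 hw, (hdist w).trans hwd⟩
  have hfin : volume ({x | x ∈ K ∧ ‖x‖ ≤ 1 ∧ ∃ q ∉ K, dist x q ≤ 2 * ε} ∪
        {x | x ∉ K ∧ ‖x‖ ≤ 1 ∧ ∃ q ∈ K, dist x q ≤ ε}) ≠ ⊤ := by
    refine ((measure_mono ?_).trans_lt
      (measure_closedBall_lt_top (x := (0 : E3)) (r := 1))).ne
    rintro x (⟨-, hx, -⟩ | ⟨-, hx, -⟩) <;> simpa using hx
  refine (measureReal_mono hsub hfin).trans ((measureReal_union_le _ _).trans ?_)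
  linarith

/-! ### Spherical convex sets in Lambert coordinates -/

/-- A nonnegative combination of two planar directions at an angle of at most `π / 2` has a
direction between them. -/
theorem exists_polar_combination {α β a b : ℝ} (hαβ : |α - β| ≤ Real.pi / 2) (ha : 0 ≤ a)
    (hb : 0 ≤ b) : ∃ γ ∈ Set.uIcc α β, ∃ ρ : ℝ, 0 ≤ ρ ∧
      a * Real.cos α + b * Real.cos β = ρ * Real.cos γ ∧
      a * Real.sin α + b * Real.sin β = ρ * Real.sin γ := by
  wlog h : α ≤ β generalizing α β a b
  · obtain ⟨γ, hγ, ρ, hρ, h1, h2⟩ := this (by rwa [abs_sub_comm]) hb ha (le_of_not_ge h)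
    exact ⟨γ, by rwa [Set.uIcc_comm], ρ, hρ, by linarith, by linarith⟩
  have hle : β - α ≤ Real.pi / 2 := by
    rw [abs_sub_comm, abs_of_nonneg (sub_nonneg.2 h)] at hαβ
    exact hαβ
  have hpi := Real.pi_pos
  -- the cross product with the direction `γ` changes sign between `α` and `β`
  have hivt := intermediate_value_Icc h (f := fun γ => a * Real.sin (γ - α) + b * Real.sin (γ - β))
    (by fun_prop)
  have h0 : (0 : ℝ) ∈ Set.Icc (a * Real.sin (α - α) + b * Real.sin (α - β))
      (a * Real.sin (β - α) + b * Real.sin (β - β)) := by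
    have hs : 0 ≤ Real.sin (β - α) :=
      Real.sin_nonneg_of_nonneg_of_le_pi (by linarith) (by linarith)
    have hs' : Real.sin (α - β) = -Real.sin (β - α) := by rw [← Real.sin_neg, neg_sub]
    rw [hs', sub_self, sub_self, Real.sin_zero]
    constructor <;> nlinarith [mul_nonneg ha hs, mul_nonneg hb hs]
  obtain ⟨γ, hγ, hγ0⟩ := hivt h0
  simp only at hγ0
  refine ⟨γ, by rwa [Set.uIcc_of_le h], a * Real.cos (γ - α) + b * Real.cos (γ - β), ?_, ?_, ?_⟩
  · have h1 : 0 ≤ Real.cos (γ - α) :=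
      Real.cos_nonneg_of_neg_pi_div_two_le_of_le (by linarith [hγ.1]) (by linarith [hγ.2])
    have h2 : 0 ≤ Real.cos (γ - β) :=
      Real.cos_nonneg_of_neg_pi_div_two_le_of_le (by linarith [hγ.1]) (by linarith [hγ.2])
    positivity
  · have e1 : Real.cos α = Real.cos (γ - α) * Real.cos γ + Real.sin (γ - α) * Real.sin γ := by
      rw [mul_comm, mul_comm (Real.sin _), ← Real.cos_sub]; congr 1; ring
    have e2 : Real.cos β = Real.cos (γ - β) * Real.cos γ + Real.sin (γ - β) * Real.sin γ := by
      rw [mul_comm, mul_comm (Real.sin _), ← Real.cos_sub]; congr 1; ring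
    rw [e1, e2]
    linear_combination Real.sin γ * hγ0
  · have e1 : Real.sin α = Real.sin γ * Real.cos (γ - α) - Real.cos γ * Real.sin (γ - α) := by
      rw [← Real.sin_sub]; congr 1; ring
    have e2 : Real.sin β = Real.sin γ * Real.cos (γ - β) - Real.cos γ * Real.sin (γ - β) := by
      rw [← Real.sin_sub]; congr 1; ring
    rw [e1, e2]
    linear_combination -Real.cos γ * hγ0

/-- The geodesic between two points of a convex set stays in the lune between their meridians and
attains all intermediate heights. -/
theorem IsSphericalConvex.exists_lambert_mem {B : Set S2} (hB : IsSphericalConvex B)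
    {x₁ x₂ y₁ y₂ y : I} (hx : |(x₁ : ℝ) - x₂| ≤ 1 / 4) (h₁ : lambert (x₁, y₁) ∈ B)
    (h₂ : lambert (x₂, y₂) ∈ B) (hy₁ : y₁ ≤ y) (hy₂ : y ≤ y₂) :
    ∃ x ∈ Set.uIcc x₁ x₂, lambert (x, y) ∈ B := by
  obtain ⟨-, ⟨v, hv⟩, hgeo⟩ := hB
  have hpi := Real.pi_pos
  set p := lambert (x₁, y₁) with hp
  set q := lambert (x₂, y₂) with hq
  let V : ℝ → EuclideanSpace ℝ (Fin 3) := fun τ => (1 - τ) • p.1 + τ • q.1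
  have hV0 : ∀ τ ∈ Set.Icc (0 : ℝ) 1, 0 < ‖V τ‖ := by
    intro τ hτ
    rw [norm_pos_iff]
    intro h0
    have h : inner ℝ v (V τ) = (1 - τ) * inner ℝ v p.1 + τ * inner ℝ v q.1 := by
      simp only [V, inner_add_right, inner_smul_right]
    rw [h0, inner_zero_right] at h
    have hvp := hv p h₁
    have hvq := hv q h₂
    rcases eq_or_lt_of_le hτ.1 with h' | h'
    · rw [← h'] at h; linarith
    · nlinarith [mul_pos h' hvq, mul_nonneg (sub_nonneg.2 hτ.2) hvp.le]
  have hV2 : Continuous fun τ => V τ 2 := by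
    simp only [V, PiLp.add_apply, PiLp.smul_apply]
    fun_prop
  have hVn : Continuous fun τ => ‖V τ‖ := by
    simp only [V]
    fun_prop
  have hcont : ContinuousOn (fun τ => V τ 2 / ‖V τ‖) (Set.Icc 0 1) :=
    hV2.continuousOn.div hVn.continuousOn fun τ hτ => (hV0 τ hτ).ne'
  have hmem : (1 - 2 * (y : ℝ)) ∈ Set.Icc (V 1 2 / ‖V 1‖) (V 0 2 / ‖V 0‖) := by
    have e0 : V 0 = p.1 := by simp [V]
    have e1 : V 1 = q.1 := by simp [V]
    have hy1' : (y₁ : ℝ) ≤ y := hy₁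
    have hy2' : (y : ℝ) ≤ y₂ := hy₂
    rw [e0, e1, mem_sphere_zero_iff_norm.1 p.2, mem_sphere_zero_iff_norm.1 q.2, div_one, div_one]
    simp only [hp, hq, lambert, Matrix.cons_val]
    constructor <;> linarith
  obtain ⟨τ, hτ, hτz⟩ := intermediate_value_Icc' zero_le_one hcont hmem
  simp only at hτz
  have hn := hV0 τ hτ
  let z : S2 := ⟨‖V τ‖⁻¹ • V τ, by
    rw [mem_sphere_zero_iff_norm, norm_smul, norm_inv, norm_norm, inv_mul_cancel₀ hn.ne']⟩
  have hzB : z ∈ B := by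
    refine hgeo p h₁ q h₂ z ⟨‖V τ‖⁻¹ * (1 - τ), ‖V τ‖⁻¹ * τ, ?_, ?_, ?_⟩
    · have := sub_nonneg.2 hτ.2
      positivity
    · have := hτ.1
      positivity
    · simp only [z, V, smul_add, smul_smul]
  set r₁ := 2 * √((y₁ : ℝ) - (y₁ : ℝ) ^ 2) with hr₁
  set r₂ := 2 * √((y₂ : ℝ) - (y₂ : ℝ) ^ 2) with hr₂
  obtain ⟨γ, hγ, ρ, hρ, hc, hs⟩ := exists_polar_combination (α := 2 * Real.pi * x₁)
    (β := 2 * Real.pi * x₂) (a := (1 - τ) * r₁) (b := τ * r₂)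
    (by
      rw [← mul_sub, abs_mul, abs_of_pos (by positivity)]
      nlinarith)
    (mul_nonneg (sub_nonneg.2 hτ.2) (by positivity)) (mul_nonneg hτ.1 (by positivity))
  have hγx : γ / (2 * Real.pi) ∈ Set.uIcc (x₁ : ℝ) x₂ := by
    rw [Set.mem_uIcc] at hγ ⊢
    rcases hγ with h | h
    · left
      constructor
      · rw [le_div_iff₀ (by positivity)]; linarith
      · rw [div_le_iff₀ (by positivity)]; linarith
    · right
      constructor
      · rw [le_div_iff₀ (by positivity)]; linarith
      · rw [div_le_iff₀ (by positivity)]; linarith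
  have hγI : γ / (2 * Real.pi) ∈ Set.Icc (0 : ℝ) 1 := by
    rw [Set.mem_uIcc] at hγx
    rcases hγx with h | h
    · exact ⟨x₁.2.1.trans h.1, h.2.trans x₂.2.2⟩
    · exact ⟨x₂.2.1.trans h.1, h.2.trans x₁.2.2⟩
  refine ⟨⟨γ / (2 * Real.pi), hγI⟩, ?_, ?_⟩
  · rw [Set.mem_uIcc] at hγx ⊢
    exact hγx
  have hV0' : V τ 0 = ρ * Real.cos γ := by
    rw [← hc]
    simp [V, hp, hq, lambert, hr₁, hr₂]
    ring
  have hV1' : V τ 1 = ρ * Real.sin γ := by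
    rw [← hs]
    simp [V, hp, hq, lambert, hr₁, hr₂]
    ring
  have z0 : z.1 0 = ρ / ‖V τ‖ * Real.cos γ := by
    simp only [z, PiLp.smul_apply, hV0', smul_eq_mul]; ring
  have z1 : z.1 1 = ρ / ‖V τ‖ * Real.sin γ := by
    simp only [z, PiLp.smul_apply, hV1', smul_eq_mul]; ring
  have z2 : z.1 2 = 1 - 2 * (y : ℝ) := by
    rw [← hτz]; simp only [z, PiLp.smul_apply, smul_eq_mul]; ring
  have hρ2 : 2 * √((y : ℝ) - (y : ℝ) ^ 2) = ρ / ‖V τ‖ := by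
    have hsq := S2.sum_sq z
    rw [z0, z1, z2] at hsq
    have hsq' : (y : ℝ) - (y : ℝ) ^ 2 = (ρ / ‖V τ‖ / 2) ^ 2 := by
      linear_combination (1 / 4) * (ρ / ‖V τ‖) ^ 2 * Real.sin_sq_add_cos_sq γ - (1 / 4) * hsq
    rw [hsq', Real.sqrt_sq (by positivity)]
    ring
  have hang : 2 * Real.pi * (γ / (2 * Real.pi)) = γ := by field_simp
  have : lambert (⟨γ / (2 * Real.pi), hγI⟩, y) = z := by
    apply S2.ext
    · rw [z0, ← hρ2]; simp [lambert, hang]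
    · rw [z1, ← hρ2]; simp [lambert, hang]
    · rw [z2]; simp [lambert]
  rw [this]
  exact hzB

theorem dist_lambert_le (x x' y : I) :
    dist (lambert (x, y)) (lambert (x', y)) ≤ 2 * Real.pi * |(x : ℝ) - x'| := by
  have hpi := Real.pi_pos
  rw [Subtype.dist_eq, EuclideanSpace.dist_eq]
  refine Real.sqrt_le_iff.2 ⟨by positivity, ?_⟩
  simp only [Fin.sum_univ_three, Real.dist_eq, sq_abs, lambert, Matrix.cons_val]
  set r := √((y : ℝ) - (y : ℝ) ^ 2) with hr
  have hr2 : r ^ 2 ≤ 1 / 4 := by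
    have h0 : (0 : ℝ) ≤ (y : ℝ) - (y : ℝ) ^ 2 := by nlinarith [y.2.1, y.2.2]
    rw [hr, Real.sq_sqrt h0]
    nlinarith [sq_nonneg ((y : ℝ) - 1 / 2)]
  have hcos := Real.one_sub_sq_div_two_le_cos (x := 2 * Real.pi * x - 2 * Real.pi * x')
  rw [mul_pow, sq_abs]
  have hle : 2 - 2 * Real.cos (2 * Real.pi * x - 2 * Real.pi * x') ≤
      (2 * Real.pi) ^ 2 * ((x : ℝ) - x') ^ 2 := by nlinarith
  have hge : 0 ≤ 2 - 2 * Real.cos (2 * Real.pi * x - 2 * Real.pi * x') := by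
    linarith [Real.cos_le_one (2 * Real.pi * x - 2 * Real.pi * x')]
  refine le_trans (le_of_eq ?_) ((mul_le_mul_of_nonneg_right (by linarith : 4 * r ^ 2 ≤ 1) hge).trans
    (by linarith))
  rw [Real.cos_sub]
  linear_combination 4 * r ^ 2 * (Real.sin_sq_add_cos_sq (2 * Real.pi * (x : ℝ)) +
    Real.sin_sq_add_cos_sq (2 * Real.pi * (x' : ℝ)))

/-! ### Proportions -/

theorem proportion_le_sum {U ι : Type*} (P : Multiset U) (X : Set U) (s : Finset ι)
    (Y : ι → Set U) (h : ∀ u ∈ X, ∃ i ∈ s, u ∈ Y i) :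
    proportion P X ≤ ∑ i ∈ s, proportion P (Y i) := by
  classical
  unfold proportion
  rw [← Finset.sum_div]
  refine div_le_div_of_nonneg_right ?_ (Nat.cast_nonneg _)
  rw [← Nat.cast_sum]
  refine Nat.cast_le.2 ?_
  induction P using Multiset.induction with
  | empty => simp
  | cons u P ih =>
    simp only [Multiset.countP_cons, Finset.sum_add_distrib]
    refine add_le_add ih ?_
    split_ifs with hu
    · obtain ⟨i, hi, hui⟩ := h u hu
      refine le_trans ?_ (Finset.single_le_sum (f := fun i => if u ∈ Y i then 1 else 0)
        (fun _ _ => Nat.zero_le _) hi)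
      simp [hui]
    · exact Nat.zero_le _

theorem sum_proportion_le {U ι : Type*} (P : Multiset U) (X : Set U) (s : Finset ι)
    (Y : ι → Set U) (hY : ∀ i ∈ s, Y i ⊆ X)
    (hd : ∀ i ∈ s, ∀ j ∈ s, i ≠ j → Disjoint (Y i) (Y j)) :
    ∑ i ∈ s, proportion P (Y i) ≤ proportion P X := by
  classical
  unfold proportion
  rw [← Finset.sum_div]
  refine div_le_div_of_nonneg_right ?_ (Nat.cast_nonneg _)
  rw [← Nat.cast_sum]
  refine Nat.cast_le.2 ?_
  induction P using Multiset.induction with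
  | empty => simp
  | cons u P ih =>
    simp only [Multiset.countP_cons, Finset.sum_add_distrib]
    refine add_le_add ih ?_
    by_cases hu : ∃ i ∈ s, u ∈ Y i
    · obtain ⟨i, hi, hui⟩ := hu
      rw [Finset.sum_eq_single_of_mem i hi, if_pos hui, if_pos (hY i hi hui)]
      intro j hj hji
      rw [if_neg fun huj => Set.disjoint_left.1 (hd j hj i hi hji) huj hui]
    · push Not at hu
      rw [Finset.sum_eq_zero fun i hi => if_neg (hu i hi)]
      exact Nat.zero_le _

theorem proportion_empty {U : Type*} (P : Multiset U) : proportion P (∅ : Set U) = 0 := by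
  simp [proportion]

theorem proportion_nonneg {U : Type*} (P : Multiset U) (X : Set U) : 0 ≤ proportion P X := by
  unfold proportion
  positivity

theorem proportion_le_one {U : Type*} (P : Multiset U) (X : Set U) : proportion P X ≤ 1 := by
  classical
  unfold proportion
  exact div_le_one_of_le₀ (by exact_mod_cast Multiset.countP_le_card _ _) (by positivity)

theorem proportion_le_add {U : Type*} (P : Multiset U) {X Y Z : Set U} (h : X ⊆ Y ∪ Z) :
    proportion P X ≤ proportion P Y + proportion P Z := by
  have := proportion_le_sum P X Finset.univ (fun b : Bool => if b then Y else Z) (by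
    intro u hu
    rcases h hu with h | h
    · exact ⟨true, by simp, by simpa using h⟩
    · exact ⟨false, by simp, by simpa using h⟩)
  simpa using this

/-! ### From rectangles to spherical convex sets -/

theorem eq_empty_or_eq_Icc {J : Set I} (hJ : IsClosed J) (hc : J.OrdConnected) :
    J = ∅ ∨ ∃ c d, c ≤ d ∧ J = Set.Icc c d := by
  rcases J.eq_empty_or_nonempty with h | h
  · exact Or.inl h
  · right
    obtain ⟨c, hc1, hc2⟩ := hJ.isCompact.exists_isLeast h
    obtain ⟨d, hd1, hd2⟩ := hJ.isCompact.exists_isGreatest h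
    exact ⟨c, d, hc2 hd1, Set.Subset.antisymm (fun y hy => ⟨hc2 hy, hd2 hy⟩) (hc.out hc1 hd1)⟩

/-- The part of a band of heights `J` over the column `[a, b]`: its proportion of points and its
area differ by at most the rectangle discrepancy. -/
theorem abs_proportion_sub_volume_le {T : Multiset (I × I)} {D : ℝ} (hD0 : 0 ≤ D)
    (hD : ∀ p q : I × I, p ≤ q → |proportion T (Set.Icc p q) - volume.real (Set.Icc p q)| ≤ D)
    {a b : I} (hab : a ≤ b) {J : Set I} (hJ : IsClosed J) (hc : J.OrdConnected) :
    |proportion T (Set.Icc a b ×ˢ J) - volume.real (Set.Icc a b ×ˢ J)| ≤ D := by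
  rcases eq_empty_or_eq_Icc hJ hc with rfl | ⟨c, d, hcd, rfl⟩
  · simpa [proportion_empty] using hD0
  · rw [Set.Icc_prod_Icc]
    exact hD _ _ ⟨hab, hcd⟩

theorem volume_real_Ico_prod (a b : I) (J : Set I) :
    (volume : Measure (I × I)).real (Set.Ico a b ×ˢ J) =
      (volume : Measure (I × I)).real (Set.Icc a b ×ˢ J) := by
  simp only [Measure.real, Measure.volume_eq_prod, Measure.prod_prod, unitInterval.volume_Ico,
    unitInterval.volume_Icc]

/-- The left edge of column `i` if the square is cut into `m` columns. -/
noncomputable def columnEdge (m i : ℕ) : I := Set.projIcc (0 : ℝ) 1 zero_le_one ((i : ℝ) / m)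

theorem columnEdge_mono (m : ℕ) : Monotone (columnEdge m) := fun i j hij =>
  Set.monotone_projIcc _ (div_le_div_of_nonneg_right (by exact_mod_cast hij) (Nat.cast_nonneg m))

theorem coe_columnEdge {m i : ℕ} (hi : i ≤ m) : (columnEdge m i : ℝ) = i / m := by
  rw [columnEdge, Set.projIcc_of_mem]
  exact ⟨by positivity, div_le_one_of_le₀ (by exact_mod_cast hi) (by positivity)⟩

theorem exists_mem_column {m : ℕ} (hm : 0 < m) (x : I) :
    ∃ i ∈ Finset.range m, x ∈ Set.Icc (columnEdge m i) (columnEdge m (i + 1)) := by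
  have hm' : (0 : ℝ) < m := by exact_mod_cast hm
  have key : ∀ i : ℕ, i < m → (i : ℝ) ≤ m * x → m * (x : ℝ) ≤ i + 1 →
      ∃ i ∈ Finset.range m, x ∈ Set.Icc (columnEdge m i) (columnEdge m (i + 1)) := by
    intro i hi h1 h2
    refine ⟨i, Finset.mem_range.2 hi, ?_, ?_⟩
    · rw [← Subtype.coe_le_coe, coe_columnEdge hi.le, div_le_iff₀ hm']
      linarith
    · rw [← Subtype.coe_le_coe, coe_columnEdge hi, le_div_iff₀ hm']
      push_cast
      linarith
  have h0 : 0 ≤ m * (x : ℝ) := mul_nonneg hm'.le x.2.1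
  by_cases h : ⌊(m : ℝ) * x⌋₊ < m
  · exact key _ h (Nat.floor_le h0) (Nat.lt_floor_add_one _).le
  · -- only the right edge `x = 1` of the square is left
    have h1 : (m : ℝ) ≤ m * x := by
      have : ((m : ℕ) : ℝ) ≤ ⌊(m : ℝ) * x⌋₊ := by exact_mod_cast not_lt.1 h
      exact this.trans (Nat.floor_le h0)
    have h2 : m * (x : ℝ) ≤ m := mul_le_of_le_one_right hm'.le x.2.2
    refine key (m - 1) (by omega) ?_ ?_ <;> rw [Nat.cast_sub hm] <;> push_cast <;> linarith

/-- Discrepancy with respect to spherical convex sets is controlled by the discrepancy `D` with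
respect to rectangles: in each of `m` columns the preimage of a convex set lies between two
rectangles, and the difference of the rectangles is within `2 π / m` of the boundary. -/
theorem abs_proportion_lambert_preimage_sub_le {T : Multiset (I × I)} {D : ℝ} (hD0 : 0 ≤ D)
    (hD : ∀ p q : I × I, p ≤ q → |proportion T (Set.Icc p q) - volume.real (Set.Icc p q)| ≤ D)
    {m : ℕ} (hm : 4 ≤ m) {B : Set S2} (hB : IsSphericalConvex B) :
    |proportion T (lambert ⁻¹' B) - (volume : Measure (I × I)).real (lambert ⁻¹' B)| ≤
      2 * m * D + (volume : Measure (I × I)).real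
        (lambert ⁻¹' boundaryLayer (2 * Real.pi / m) B) := by
  have hm' : (4 : ℝ) ≤ m := by exact_mod_cast hm
  have hm0 : (0 : ℝ) < m := by linarith
  have hpi := Real.pi_pos
  set ε := 2 * Real.pi / m with hε
  have hε0 : 0 < ε := by positivity
  set G := lambert ⁻¹' B with hG
  set W := lambert ⁻¹' boundaryLayer ε B with hW
  let col : ℕ → Set I := fun i => Set.Icc (columnEdge m i) (columnEdge m (i + 1))
  let hcol : ℕ → Set I := fun i => Set.Ico (columnEdge m i) (columnEdge m (i + 1))
  have hhcol : ∀ i, hcol i ⊆ col i := fun i => Set.Ico_subset_Icc_self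
  have hclosedG : IsClosed G := hB.1.preimage continuous_lambert
  have hdiam : ∀ i ∈ Finset.range m, ∀ x ∈ col i, ∀ x' ∈ col i, |(x : ℝ) - x'| ≤ 1 / m := by
    intro i hi x hx x' hx'
    rw [Finset.mem_range] at hi
    have e1 := coe_columnEdge hi.le
    have e2 := coe_columnEdge (m := m) (i := i + 1) hi
    have a1 : (columnEdge m i : ℝ) ≤ x := hx.1
    have a2 : (x : ℝ) ≤ columnEdge m (i + 1) := hx.2
    have a3 : (columnEdge m i : ℝ) ≤ x' := hx'.1
    have a4 : (x' : ℝ) ≤ columnEdge m (i + 1) := hx'.2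
    push_cast at e2
    rw [add_div] at e2
    rw [abs_le]
    constructor <;> linarith
  have hdist : ∀ i ∈ Finset.range m, ∀ x ∈ col i, ∀ x' ∈ col i, ∀ y,
      dist (lambert (x, y)) (lambert (x', y)) ≤ ε := by
    intro i hi x hx x' hx' y
    refine (dist_lambert_le x x' y).trans ?_
    rw [hε, div_eq_mul_one_div]
    exact mul_le_mul_of_nonneg_left (hdiam i hi x hx x' hx') (by positivity)
  -- with at least four columns, two meridians of the same column enclose an angle of at most `π / 2`
  have hquarter : ∀ i ∈ Finset.range m, ∀ x ∈ col i, ∀ x' ∈ col i, |(x : ℝ) - x'| ≤ 1 / 4 :=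
    fun i hi x hx x' hx' => (hdiam i hi x hx x' hx').trans
      (one_div_le_one_div_of_le (by norm_num) hm')
  have hWmem : ∀ p q r : I × I, lambert q ∈ B → lambert r ∉ B → dist (lambert p) (lambert q) ≤ ε →
      dist (lambert p) (lambert r) ≤ ε → p ∈ W := by
    intro p q r hq hr h1 h2
    refine ⟨Metric.mem_cthickening_of_dist_le _ _ _ _ hq h1, ?_⟩
    rw [Metric.mem_thickening_iff]
    exact ⟨_, hr, by linarith⟩
  -- the heights at which column `i` lies in `B` entirely, and those at which it meets `B`
  let Jin : ℕ → Set I := fun i => {y | ∀ x ∈ col i, lambert (x, y) ∈ B}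
  let Jout : ℕ → Set I := fun i => {y | ∃ x ∈ col i, lambert (x, y) ∈ B}
  have hJinC : ∀ i, IsClosed (Jin i) := by
    intro i
    have : Jin i = ⋂ x ∈ col i, (fun y => lambert (x, y)) ⁻¹' B := by
      ext y
      simp [Jin]
    rw [this]
    exact isClosed_biInter fun x _ => hB.1.preimage (continuous_lambert.comp (by fun_prop))
  have hJoutC : ∀ i, IsClosed (Jout i) := by
    intro i
    have : Jout i = Prod.snd '' (G ∩ col i ×ˢ Set.univ) := by
      ext y
      constructor
      · rintro ⟨x, hx, hxy⟩
        exact ⟨(x, y), ⟨hxy, hx, trivial⟩, rfl⟩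
      · rintro ⟨⟨x, y⟩, ⟨hxy, hx, -⟩, rfl⟩
        exact ⟨x, hx, hxy⟩
    rw [this]
    exact ((hclosedG.inter (isClosed_Icc.prod isClosed_univ)).isCompact.image
      continuous_snd).isClosed
  have hJinO : ∀ i, (Jin i).OrdConnected := by
    intro i
    refine ⟨fun y₁ h₁ y₂ h₂ y hy x hx => ?_⟩
    obtain ⟨x', hx', h⟩ := hB.exists_lambert_mem (x₁ := x) (x₂ := x) (by simp) (h₁ x hx)
      (h₂ x hx) hy.1 hy.2
    rw [Set.uIcc_self, Set.mem_singleton_iff] at hx'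
    rwa [hx'] at h
  have hJoutO : ∀ i ∈ Finset.range m, (Jout i).OrdConnected := by
    intro i hi
    refine ⟨?_⟩
    rintro y₁ ⟨x₁, hx₁, h₁⟩ y₂ ⟨x₂, hx₂, h₂⟩ y hy
    obtain ⟨x', hx', h⟩ := hB.exists_lambert_mem (hquarter i hi _ hx₁ _ hx₂) h₁ h₂ hy.1 hy.2
    exact ⟨x', (Set.ordConnected_Icc.uIcc_subset hx₁ hx₂) hx', h⟩
  have hdisj : ∀ J : ℕ → Set I, ∀ i ∈ Finset.range m, ∀ j ∈ Finset.range m, i ≠ j →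
      Disjoint (hcol i ×ˢ J i) (hcol j ×ˢ J j) := fun J i _ j _ hij =>
    Set.Disjoint.set_prod_left ((columnEdge_mono m).pairwise_disjoint_on_Ico_succ hij) _ _
  have hcolle : ∀ i, columnEdge m i ≤ columnEdge m (i + 1) := fun i => columnEdge_mono m i.le_succ
  have hGm : MeasurableSet G := hclosedG.measurableSet
  have hWm : MeasurableSet W :=
    continuous_lambert.measurable (measurableSet_boundaryLayer ε B)
  have hupper : proportion T G ≤ (volume : Measure (I × I)).real G +
      (volume : Measure (I × I)).real W + m * D := by
    have h1 : proportion T G ≤ ∑ i ∈ Finset.range m, proportion T (col i ×ˢ Jout i) := by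
      refine proportion_le_sum _ _ _ _ ?_
      rintro ⟨x, y⟩ hxy
      obtain ⟨i, hi, hx⟩ := exists_mem_column (m := m) (by omega) x
      exact ⟨i, hi, hx, x, hx, hxy⟩
    have h2 : ∀ i ∈ Finset.range m, proportion T (col i ×ˢ Jout i) ≤
        (volume : Measure (I × I)).real (hcol i ×ˢ Jout i) + D := by
      intro i hi
      rw [volume_real_Ico_prod]
      have := (abs_le.1 (abs_proportion_sub_volume_le hD0 hD (hcolle i) (hJoutC i)
        (hJoutO i hi))).2
      linarith
    have h3 : ∑ i ∈ Finset.range m, (volume : Measure (I × I)).real (hcol i ×ˢ Jout i) ≤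
        (volume : Measure (I × I)).real (G ∪ W) := by
      rw [← measureReal_biUnion_finset (fun i hi j hj hij => hdisj Jout i hi j hj hij)
        fun i _ => measurableSet_Ico.prod (hJoutC i).measurableSet]
      refine measureReal_mono ?_
      simp only [Set.iUnion_subset_iff]
      rintro i hi ⟨x, y⟩ ⟨hx, x', hx', hxy⟩
      by_cases hp : lambert (x, y) ∈ B
      · exact Or.inl hp
      · exact Or.inr (hWmem _ (x', y) (x, y) hxy hp (hdist i hi _ (hhcol i hx) _ hx' y)
          (by rw [dist_self]; exact hε0.le))
    have h4 := measureReal_union_le (μ := (volume : Measure (I × I))) G W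
    refine h1.trans ((Finset.sum_le_sum h2).trans ?_)
    rw [Finset.sum_add_distrib, Finset.sum_const, Finset.card_range, nsmul_eq_mul]
    linarith
  have hlower : (volume : Measure (I × I)).real G - (volume : Measure (I × I)).real W -
      2 * m * D ≤ proportion T G := by
    have h1 : ∑ i ∈ Finset.range m, proportion T (hcol i ×ˢ Jin i) ≤ proportion T G := by
      refine sum_proportion_le _ _ _ _ ?_ (hdisj Jin)
      rintro i hi ⟨x, y⟩ ⟨hx, hy⟩
      exact hy x (hhcol i hx)
    have h2 : ∀ i ∈ Finset.range m, (volume : Measure (I × I)).real (col i ×ˢ Jin i) - 2 * D ≤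
        proportion T (hcol i ×ˢ Jin i) := by
      intro i hi
      have e1 := (abs_le.1 (abs_proportion_sub_volume_le hD0 hD (hcolle i) (hJinC i)
        (hJinO i))).1
      -- a half-open column is a closed one without its right edge, a rectangle of area zero
      have e2 := (abs_le.1 (abs_proportion_sub_volume_le hD0 hD
        (le_refl (columnEdge m (i + 1))) (hJinC i) (hJinO i))).2
      have e3 : (volume : Measure (I × I)).real
          (Set.Icc (columnEdge m (i + 1)) (columnEdge m (i + 1)) ×ˢ Jin i) = 0 := by
        rw [← volume_real_Ico_prod]
        simp
      have e4 : proportion T (col i ×ˢ Jin i) ≤ proportion T (hcol i ×ˢ Jin i) +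
          proportion T (Set.Icc (columnEdge m (i + 1)) (columnEdge m (i + 1)) ×ˢ Jin i) := by
        refine proportion_le_add T ?_
        rintro ⟨x, y⟩ ⟨hx, hy⟩
        rcases lt_or_eq_of_le hx.2 with h | h
        · exact Or.inl ⟨⟨hx.1, h⟩, hy⟩
        · exact Or.inr ⟨⟨h.ge, h.le⟩, hy⟩
      simp only [col] at e4 ⊢
      linarith
    have h3 : (volume : Measure (I × I)).real (G \ W) ≤
        ∑ i ∈ Finset.range m, (volume : Measure (I × I)).real (col i ×ˢ Jin i) := by
      refine (measureReal_mono ?_ (measure_ne_top _ _)).trans (measureReal_biUnion_finset_le _ _)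
      rintro ⟨x, y⟩ ⟨hxy, hnW⟩
      obtain ⟨i, hi, hx⟩ := exists_mem_column (m := m) (by omega) x
      refine Set.mem_biUnion (Finset.mem_coe.2 hi) ⟨hx, fun x' hx' => ?_⟩
      by_contra hx'B
      exact hnW (hWmem _ (x, y) (x', y) hxy hx'B (by rw [dist_self]; exact hε0.le)
        (hdist i hi _ hx _ hx' y))
    have h4 : (volume : Measure (I × I)).real G ≤ (volume : Measure (I × I)).real (G \ W) +
        (volume : Measure (I × I)).real W :=
      (measureReal_mono (fun p hp => by by_cases h : p ∈ W <;> simp [h, hp])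
        (measure_ne_top _ _)).trans (measureReal_union_le _ _)
    have h5 := Finset.sum_le_sum h2
    rw [Finset.sum_sub_distrib, Finset.sum_const, Finset.card_range, nsmul_eq_mul] at h5
    linarith
  rw [abs_le]
  constructor
  · linarith
  · nlinarith

/-! ### Equispaced points and products of point collections -/

theorem proportion_map {U V : Type*} (P : Multiset U) (f : U → V) (X : Set V) :
    proportion (P.map f) X = proportion P (f ⁻¹' X) := by
  classical
  unfold proportion
  rw [Multiset.countP_map, Multiset.card_map, Multiset.countP_eq_card_filter]
  congr! 3

theorem proportion_range (n : ℕ) (X : Set ℕ) [DecidablePred (· ∈ X)] :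
    proportion (Multiset.range n) X = ((Finset.range n).filter (· ∈ X)).card / n := by
  unfold proportion
  rw [Multiset.countP_eq_card_filter, Multiset.card_range, Finset.card_def]
  rw [Finset.filter_val, Finset.range_val]
  congr!

theorem proportion_product {U V : Type*} (Q : Multiset U) (R : Multiset V) (F : Set U)
    (B : Set V) : proportion (Q ×ˢ R) (F ×ˢ B) = proportion Q F * proportion R B := by
  classical
  have h : (Q ×ˢ R).countP (· ∈ F ×ˢ B) = Q.countP (· ∈ F) * R.countP (· ∈ B) := by
    induction Q using Multiset.induction with
    | empty => simp
    | cons u Q ih =>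
      rw [Multiset.cons_product, Multiset.countP_add, ih, Multiset.countP_map,
        Multiset.countP_cons, add_mul, add_comm]
      congr 1
      by_cases hu : u ∈ F
      · simp [hu, Multiset.countP_eq_card_filter]
      · simp [hu]
  have h' : ((Q ×ˢ R).countP (· ∈ F ×ˢ B) : ℝ) = Q.countP (· ∈ F) * R.countP (· ∈ B) := by
    exact_mod_cast h
  unfold proportion
  rw [Multiset.card_product, Nat.cast_mul, ← mul_div_mul_comm, ← h']
  congr!

/-- The indices of the points in an arc are the residues modulo `n` of the integers of an interval
that is `n / (2 π)` times as long as the arc. -/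
theorem abs_proportion_equispacedPoints_sub_le {n : ℕ} (hn : 0 < n) {a b : ℝ} (hab : a ≤ b)
    (hb : b ≤ a + 2 * Real.pi) :
    |proportion (equispacedPoints n) (Circle.exp '' Set.Icc a b) - (b - a) / (2 * Real.pi)| ≤
      2 / n := by
  classical
  have hpi := Real.pi_pos
  have hn' : (0 : ℝ) < n := by exact_mod_cast hn
  set X : Set ℕ := (fun j : ℕ => Circle.exp (2 * Real.pi * j / n)) ⁻¹'
    (Circle.exp '' Set.Icc a b) with hX
  rw [equispacedPoints, proportion_map, ← hX, proportion_range]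
  set S := (Finset.range n).filter (· ∈ X) with hS
  set α := n * a / (2 * Real.pi) with hα
  set β := n * b / (2 * Real.pi) with hβ
  have hαβ : β - α = n * ((b - a) / (2 * Real.pi)) := by rw [hα, hβ]; ring
  have hβn : β ≤ α + n := by
    rw [hα, hβ, div_add' _ _ _ (by positivity)]
    refine div_le_div_of_nonneg_right ?_ (by positivity)
    nlinarith
  have hmem : ∀ k : ℤ, α ≤ k → k ≤ β → (k % n).toNat ∈ S := by
    intro k h1 h2
    have hk0 : 0 ≤ k % n := Int.emod_nonneg _ (by omega)
    have hkn : k % n < n := Int.emod_lt_of_pos _ (by omega)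
    rw [hS, Finset.mem_filter, Finset.mem_range]
    refine ⟨by omega, 2 * Real.pi * k / n, ⟨?_, ?_⟩, ?_⟩
    · rw [hα, div_le_iff₀ (by positivity)] at h1
      rw [le_div_iff₀ hn']
      linarith
    · rw [hβ, le_div_iff₀ (by positivity)] at h2
      rw [div_le_iff₀ hn']
      linarith
    · rw [Circle.exp_eq_exp]
      refine ⟨k / n, ?_⟩
      have h3 : ((k % n).toNat : ℝ) = ((k % n : ℤ) : ℝ) := by
        exact_mod_cast congrArg (Int.cast (R := ℝ)) (Int.toNat_of_nonneg hk0)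
      have h4 : (k : ℝ) = n * ((k / n : ℤ) : ℝ) + ((k % n : ℤ) : ℝ) := by
        exact_mod_cast (Int.mul_ediv_add_emod k n).symm
      rw [h3]
      nth_rewrite 1 [h4]
      field_simp
      ring
  have hsurj : S ⊆ (Finset.Icc ⌈α⌉ ⌊β⌋).image fun k : ℤ => (k % n).toNat := by
    intro j hj
    rw [hS, Finset.mem_filter, Finset.mem_range] at hj
    obtain ⟨hjn, r, hr, hrj⟩ := hj
    obtain ⟨k, hk⟩ := Circle.exp_eq_exp.1 hrj
    rw [Finset.mem_image]
    have hr' : (n : ℝ) * r / (2 * Real.pi) = j + k * n := by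
      rw [hk]
      field_simp
    refine ⟨j + k * n, Finset.mem_Icc.2 ⟨Int.ceil_le.2 ?_, Int.le_floor.2 ?_⟩, ?_⟩
    · push_cast
      rw [← hr', hα]
      exact div_le_div_of_nonneg_right (mul_le_mul_of_nonneg_left hr.1 hn'.le) (by positivity)
    · push_cast
      rw [← hr', hβ]
      exact div_le_div_of_nonneg_right (mul_le_mul_of_nonneg_left hr.2 hn'.le) (by positivity)
    · simp only [Int.add_mul_emod_self_right]
      rw [Int.emod_eq_of_lt (by omega) (by omega)]
      simp
  have hαβ0 : α ≤ β := by
    have : 0 ≤ n * ((b - a) / (2 * Real.pi)) := by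
      have := sub_nonneg.2 hab
      positivity
    linarith
  have hfl := Int.floor_le β
  have hfl' := Int.lt_floor_add_one β
  have hce := Int.le_ceil α
  have hce' := Int.ceil_lt_add_one α
  have hup : (S.card : ℝ) ≤ β - α + 1 := by
    have h1 : S.card ≤ (⌊β⌋ + 1 - ⌈α⌉).toNat :=
      (Finset.card_le_card hsurj).trans (Finset.card_image_le.trans (by rw [Int.card_Icc]))
    rcases le_or_gt 0 (⌊β⌋ + 1 - ⌈α⌉) with h | h
    · have h2 : (S.card : ℤ) ≤ ⌊β⌋ + 1 - ⌈α⌉ := by omega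
      have h3 : (S.card : ℝ) ≤ ⌊β⌋ + 1 - ⌈α⌉ := by exact_mod_cast h2
      linarith
    · have h2 : S.card = 0 := by omega
      rw [h2]
      push_cast
      linarith
  have hlow : β - α - 2 ≤ S.card := by
    -- the right endpoint is dropped, so that the indices are distinct modulo `n`
    have h1 : (⌊β⌋ - ⌈α⌉).toNat ≤ S.card := by
      rw [← Int.card_Ico]
      refine Finset.card_le_card_of_injOn (fun k : ℤ => (k % n).toNat) ?_ ?_
      · intro k hk
        rw [Finset.mem_coe, Finset.mem_Ico] at hk
        refine hmem k (Int.ceil_le.1 hk.1) (Int.le_floor.1 hk.2.le)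
      · intro k hk l hl hkl
        rw [Finset.mem_coe, Finset.mem_Ico] at hk hl
        have hlen : (⌊β⌋ : ℝ) - ⌈α⌉ ≤ n := by linarith
        have hlen' : ⌊β⌋ - ⌈α⌉ ≤ n := by exact_mod_cast hlen
        have e0 : 0 ≤ k % n := Int.emod_nonneg _ (by omega)
        have e1 : 0 ≤ l % n := Int.emod_nonneg _ (by omega)
        simp only at hkl
        have hmod : k % n = l % n := by omega
        have hdvd : (n : ℤ) ∣ k - l := Int.ModEq.dvd (show l ≡ k [ZMOD n] from hmod.symm)
        have := Int.eq_zero_of_abs_lt_dvd hdvd (by rw [abs_lt]; constructor <;> omega)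
        omega
    have h2 : ⌊β⌋ - ⌈α⌉ ≤ (S.card : ℤ) := by omega
    have h3 : (⌊β⌋ : ℝ) - ⌈α⌉ ≤ S.card := by exact_mod_cast h2
    linarith
  have : (S.card : ℝ) / n - (b - a) / (2 * Real.pi) = (S.card - (β - α)) / n := by
    rw [hαβ]
    field_simp
  rw [this, abs_div, abs_of_pos hn']
  refine div_le_div_of_nonneg_right ?_ hn'.le
  rw [abs_le]
  constructor <;> linarith

theorem proportion_fiberedProductPoints (Q : Multiset Circle) (R : Multiset S2) (F : Set Circle)
    (B : Set S2) : proportion (fiberedProductPoints Q R) (fiberedProduct F B) =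
      proportion Q F * proportion R B := by
  rw [fiberedProductPoints, proportion_map, ← proportion_product]
  congr 1
  ext ⟨u, x⟩
  constructor
  · rintro ⟨v, hv, y, hy, h⟩
    obtain ⟨rfl, rfl⟩ := hopf_injective h
    exact ⟨hv, hy⟩
  · rintro ⟨hu, hx⟩
    exact ⟨u, hu, x, hx, rfl⟩

/-! ### The discrepancy of fibered products -/

theorem abs_mul_sub_mul_le {a b c d : ℝ} (ha : 0 ≤ a) (ha1 : a ≤ 1) (hd : 0 ≤ d) (hd1 : d ≤ 1) :
    |a * b - c * d| ≤ |a - c| + |b - d| := by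
  have : a * b - c * d = (a - c) * d + a * (b - d) := by ring
  rw [this]
  refine (abs_add_le _ _).trans (add_le_add ?_ ?_)
  · rw [abs_mul, abs_of_nonneg hd]
    exact mul_le_of_le_one_right (abs_nonneg _) hd1
  · rw [abs_mul, abs_of_nonneg ha]
    exact mul_le_of_le_one_left (abs_nonneg _) ha1

/-- The discrepancy of the fibered product of `n` equispaced points and the image of a collection
with rectangle discrepancy `D`; the number `m` of columns is still to be chosen. -/
theorem exists_discrepancy_le : ∃ C : ℝ, 0 ≤ C ∧ ∀ (n m : ℕ) (T : Multiset (I × I)) (D : ℝ),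
    0 < n → 4 ≤ m → 0 ≤ D →
    (∀ p q : I × I, p ≤ q → |proportion T (Set.Icc p q) - volume.real (Set.Icc p q)| ≤ D) →
    ∀ X ∈ localCartesianConvexSets,
      |proportion (fiberedProductPoints (equispacedPoints n) (T.map lambert)) X -
        haarSO3.real X / haarSO3.real Set.univ| ≤ 2 / n + (2 * m * D + C / m) := by
  obtain ⟨C, hC0, hC⟩ := exists_area_boundaryLayer_le
  have hpi := Real.pi_pos
  refine ⟨C * (2 * Real.pi), by positivity, ?_⟩
  rintro n m T D hn hm hD0 hD _ ⟨_, ⟨a, b, hab, hb, rfl⟩, B, hB, rfl⟩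
  have hm0 : (0 : ℝ) < m := by
    have : 0 < m := by omega
    exact_mod_cast this
  rw [probReal_univ, div_one, proportion_fiberedProductPoints,
    haarSO3_real_fiberedProduct hab hb hB.1.measurableSet, map_base_haarSO3, Measure.real,
    Measure.map_apply continuous_lambert.measurable hB.1.measurableSet, ← measureReal_def,
    proportion_map]
  refine (abs_mul_sub_mul_le (proportion_nonneg _ _) (proportion_le_one _ _) measureReal_nonneg
    measureReal_le_one).trans (add_le_add (abs_proportion_equispacedPoints_sub_le hn hab hb) ?_)
  refine (abs_proportion_lambert_preimage_sub_le hD0 hD hm hB).trans ?_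
  have := hC B hB (2 * Real.pi / m) (by positivity)
  have e : C * (2 * Real.pi / m) = C * (2 * Real.pi) / m := by ring
  linarith

/-! ### The sizes of the two factors -/

/-- The number `(N / log² N)^(1/3)`, whose reciprocal is the rate of convergence. -/
noncomputable def circleScale (N : ℕ) : ℝ := ((N : ℝ) / Real.log N ^ 2) ^ (1 / 3 : ℝ)

theorem half_lt_log {N : ℕ} (hN : 2 ≤ N) : 1 / 2 < Real.log N := by
  have h1 : Real.log 2 ≤ Real.log N :=
    Real.log_le_log (by norm_num) (by exact_mod_cast hN)
  linarith [Real.log_two_gt_d9]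

theorem rate_eq {N : ℕ} (hN : 2 ≤ N) :
    Real.log N ^ (2 / 3 : ℝ) / (N : ℝ) ^ (1 / 3 : ℝ) = 1 / circleScale N := by
  have hL := half_lt_log hN
  have hL0 : 0 ≤ Real.log N := by linarith
  rw [circleScale, Real.div_rpow (Nat.cast_nonneg N) (by positivity), one_div_div,
    ← Real.rpow_natCast, ← Real.rpow_mul hL0]
  norm_num

theorem circleScale_pow {N : ℕ} : circleScale N ^ 3 = N / Real.log N ^ 2 := by
  rw [circleScale, ← Real.rpow_natCast, ← Real.rpow_mul (by positivity)]
  norm_num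

theorem half_le_circleScale {N : ℕ} (hN : 2 ≤ N) : 1 / 2 ≤ circleScale N := by
  have hL := half_lt_log hN
  have hN' : (0 : ℝ) < N := by
    have : 0 < N := by omega
    exact_mod_cast this
  have h1 : Real.log N ≤ 2 * √N := by
    have h2 := Real.log_le_sub_one_of_pos (Real.sqrt_pos.2 hN')
    rw [Real.log_sqrt hN'.le] at h2
    linarith
  have h3 : Real.log N ^ 2 ≤ 4 * N := by
    have h4 := Real.sq_sqrt hN'.le
    nlinarith [Real.sqrt_nonneg (N : ℝ)]
  have h5 : (1 / 2 : ℝ) ^ 3 ≤ circleScale N ^ 3 := by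
    rw [circleScale_pow, le_div_iff₀ (by positivity)]
    linarith
  exact le_of_pow_le_pow_left₀ (by norm_num) (Real.rpow_nonneg (by positivity) _) h5

theorem circleScale_le_numCircle (N : ℕ) : circleScale N ≤ numCircle N := Nat.le_ceil _

theorem numCircle_le_mul {N : ℕ} (hN : 2 ≤ N) : (numCircle N : ℝ) ≤ 3 * circleScale N := by
  have h := half_le_circleScale hN
  have h1 : (numCircle N : ℝ) < circleScale N + 1 := Nat.ceil_lt_add_one
    (show 0 ≤ circleScale N by linarith)
  linarith

theorem numCircle_pos {N : ℕ} (hN : 2 ≤ N) : 0 < numCircle N := by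
  have h := half_le_circleScale hN
  exact Nat.ceil_pos.2 (lt_of_lt_of_le (by norm_num) h)

theorem numCircle_le {N : ℕ} (hN : 2 ≤ N) : numCircle N ≤ N := by
  have hL := half_lt_log hN
  have hN' : (2 : ℝ) ≤ N := by exact_mod_cast hN
  refine Nat.ceil_le.2 (le_of_pow_le_pow_left₀ three_ne_zero (Nat.cast_nonneg N) ?_)
  have h1 : circleScale N ^ 3 ≤ (N : ℝ) ^ 3 := by
    rw [circleScale_pow, div_le_iff₀ (by positivity)]
    have h2 : 1 ≤ (N : ℝ) ^ 2 * Real.log N ^ 2 := by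
      rw [← mul_pow]
      exact one_le_pow₀ (by nlinarith)
    nlinarith
  exact h1

theorem numSphere_pos {N : ℕ} (hN : 2 ≤ N) : 0 < numSphere N :=
  Nat.div_pos (numCircle_le hN) (numCircle_pos hN)

theorem numCircle_mul_numSphere_le (N : ℕ) : numCircle N * numSphere N ≤ N := Nat.mul_div_le _ _

theorem lt_numCircle_mul_numSphere_add {N : ℕ} (hN : 2 ≤ N) :
    N < numCircle N * numSphere N + numCircle N := by
  have := Nat.lt_mul_div_succ N (numCircle_pos hN)
  rw [mul_add, mul_one] at this
  exact this

theorem le_mul_numSphere {N : ℕ} (hN : 2 ≤ N) : (N : ℝ) ≤ 6 * circleScale N * numSphere N := by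
  have h1 : (N : ℝ) ≤ numCircle N * numSphere N + numCircle N := by
    exact_mod_cast (lt_numCircle_mul_numSphere_add hN).le
  have h2 : (1 : ℝ) ≤ numSphere N := by exact_mod_cast numSphere_pos hN
  have h3 := numCircle_le_mul hN
  have h4 : (0 : ℝ) ≤ numCircle N := Nat.cast_nonneg _
  nlinarith

/-- This is the balance between the two factors: `log N / √N₂` and `1 / N₁` have the same order. -/
theorem log_div_sqrt_numSphere_le {N : ℕ} (hN : 2 ≤ N) :
    Real.log N / √(numSphere N : ℝ) ≤ 3 / circleScale N := by
  have hx := half_le_circleScale hN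
  have hL := half_lt_log hN
  have hs : (0 : ℝ) < numSphere N := by exact_mod_cast numSphere_pos hN
  have hN' : (0 : ℝ) < N := by
    have : 0 < N := by omega
    exact_mod_cast this
  rw [div_le_div_iff₀ (Real.sqrt_pos.2 hs) (by linarith)]
  refine le_of_pow_le_pow_left₀ two_ne_zero (by positivity) ?_
  rw [mul_pow, mul_pow, Real.sq_sqrt hs.le]
  have h1 := le_mul_numSphere hN
  have h2 := circleScale_pow (N := N)
  rw [eq_div_iff (by positivity)] at h2
  have h3 : circleScale N * (Real.log N ^ 2 * circleScale N ^ 2) ≤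
      circleScale N * (6 * numSphere N) := by
    linarith
  have h4 := le_of_mul_le_mul_left h3 (by linarith)
  linarith

/-! ### Discrepancy bounds on the rotation group -/

/-- The bound with `1 + log N` in place of `log N₂`: the latter vanishes if there is only one point
on the sphere. -/
theorem exists_abs_proportion_so3PointsOf_sub_le (A : ℝ) (hA : 0 ≤ A) :
    ∃ C : ℝ, 0 ≤ C ∧ ∀ N : ℕ, 2 ≤ N → ∀ T : Multiset (I × I),
      (∀ p q : I × I, p ≤ q → |proportion T (Set.Icc p q) - volume.real (Set.Icc p q)| ≤
        A * ((1 + Real.log N) / numSphere N)) →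
      ∀ X ∈ localCartesianConvexSets,
        |proportion (so3PointsOf N T) X - haarSO3.real X / haarSO3.real Set.univ| ≤
          C * (1 / circleScale N) := by
  obtain ⟨C, hC0, hC⟩ := exists_discrepancy_le
  refine ⟨2 + (108 * A + 6 * C), by positivity, fun N hN T hT X hX => ?_⟩
  have hx := half_le_circleScale hN
  have hL := half_lt_log hN
  set s : ℝ := (numSphere N : ℝ) with hs
  have hs1 : 1 ≤ s := Nat.one_le_cast.2 (numSphere_pos hN)
  have hr1 : 1 ≤ √s := Real.one_le_sqrt.2 hs1
  have hr : √s * √s = s := Real.mul_self_sqrt (by linarith)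
  -- as many columns as points in each column, up to constants
  set m := ⌈√s⌉₊ + 4 with hm
  have hm1 : √s ≤ m := by
    rw [hm]; push_cast; linarith [Nat.le_ceil (√s)]
  have hm2 : (m : ℝ) ≤ 6 * √s := by
    rw [hm]; push_cast; linarith [Nat.ceil_lt_add_one (Real.sqrt_nonneg s)]
  have hD0 : 0 ≤ A * ((1 + Real.log N) / s) := by
    have : 0 ≤ 1 + Real.log N := by linarith
    positivity
  refine (hC (numCircle N) m T _ (numCircle_pos hN) (by omega) hD0 hT X hX).trans ?_
  have hbal := log_div_sqrt_numSphere_le hN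
  have h1 : 2 / (numCircle N : ℝ) ≤ 2 * (1 / circleScale N) := by
    rw [← div_eq_mul_one_div]
    exact div_le_div_of_nonneg_left zero_le_two (lt_of_lt_of_le one_half_pos hx)
      (circleScale_le_numCircle N)
  have h2 : 2 * m * (A * ((1 + Real.log N) / s)) ≤ 108 * A * (1 / circleScale N) := by
    have e1 : (1 + Real.log N) / s ≤ 3 * (Real.log N / √s) / √s := by
      rw [← mul_div_assoc, div_div, hr]
      exact div_le_div_of_nonneg_right (by linarith) (by positivity)
    calc 2 * m * (A * ((1 + Real.log N) / s))
        ≤ 2 * (6 * √s) * (A * (3 * (Real.log N / √s) / √s)) := by gcongr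
      _ = 36 * A * (Real.log N / √s) := by field_simp; ring
      _ ≤ 36 * A * (3 / circleScale N) := by gcongr
      _ = 108 * A * (1 / circleScale N) := by ring
  have h3 : C / m ≤ 6 * C * (1 / circleScale N) := by
    calc C / m ≤ C / √s := by gcongr
      _ = C * (1 / √s) := by ring
      _ ≤ C * (2 * (Real.log N / √s)) := by
        refine mul_le_mul_of_nonneg_left ?_ hC0
        rw [← mul_div_assoc]
        exact div_le_div_of_nonneg_right (by linarith) (by positivity)
      _ ≤ C * (2 * (3 / circleScale N)) := by gcongr
      _ = 6 * C * (1 / circleScale N) := by ring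
  linarith

theorem discrepancy_le {U : Type*} [MeasurableSpace U] {μ : Measure U} {P : Multiset U}
    {𝒳 : Set (Set U)} {b : ℝ} (hb : 0 ≤ b)
    (h : ∀ X ∈ 𝒳, |proportion P X - μ.real X / μ.real Set.univ| ≤ b) :
    discrepancy μ P 𝒳 ≤ b := by
  refine Real.sSup_le ?_ hb
  rintro _ ⟨X, hX, rfl⟩
  exact h X hX

theorem abs_proportion_sub_le_discrepancy {U : Type*} [MeasurableSpace U] {μ : Measure U}
    [IsFiniteMeasure μ] {P : Multiset U} {𝒳 : Set (Set U)} {X : Set U} (hX : X ∈ 𝒳) :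
    |proportion P X - μ.real X / μ.real Set.univ| ≤ discrepancy μ P 𝒳 :=
  le_csSup (bddAbove_discrepancy μ P 𝒳) ⟨X, hX, rfl⟩

theorem exists_discrepancy_so3PointsOf_le (A : ℝ) :
    ∃ C : ℝ, ∀ N : ℕ, 2 ≤ N → ∀ T : Multiset (I × I), Multiset.card T = numSphere N →
      discrepancy volume T unitSquareRectangles ≤
        A * (Real.log (numSphere N) / numSphere N) →
      discrepancy haarSO3 (so3PointsOf N T) localCartesianConvexSets ≤
        C * (Real.log N ^ (2 / 3 : ℝ) / (N : ℝ) ^ (1 / 3 : ℝ)) := by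
  obtain ⟨C, hC0, hC⟩ := exists_abs_proportion_so3PointsOf_sub_le (max A 0) (le_max_right _ _)
  refine ⟨C, fun N hN T _ hT => ?_⟩
  have hx := half_le_circleScale hN
  have hL := half_lt_log hN
  rw [rate_eq hN]
  refine discrepancy_le (mul_nonneg hC0 (by rw [one_div_nonneg]; linarith))
    (hC N hN T fun p q hpq => ?_)
  have h1 := abs_proportion_sub_le_discrepancy (μ := (volume : Measure (I × I))) (P := T)
    (𝒳 := unitSquareRectangles) ⟨p, q, hpq, rfl⟩
  rw [probReal_univ, div_one] at h1
  refine h1.trans (hT.trans ?_)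
  have hs1 : (1 : ℝ) ≤ numSphere N := by exact_mod_cast numSphere_pos hN
  have hsN : (numSphere N : ℝ) ≤ N := by exact_mod_cast Nat.div_le_self _ _
  have hlog : Real.log (numSphere N) ≤ 1 + Real.log N := by
    linarith [Real.log_le_log (by linarith) hsN]
  have hlog0 := Real.log_nonneg hs1
  refine (mul_le_mul_of_nonneg_right (le_max_left A 0) (by positivity)).trans ?_
  refine mul_le_mul_of_nonneg_left ?_ (le_max_right _ _)
  exact div_le_div_of_nonneg_right hlog (by positivity)

/-- Adding points to a collection changes proportions by at most the proportion of new points. -/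
theorem abs_proportion_sub_proportion_le {U : Type*} {P Q : Multiset U} (h : P ≤ Q)
    (hP : 0 < Multiset.card P) (X : Set U) :
    |proportion Q X - proportion P X| ≤
      ((Multiset.card Q : ℝ) - Multiset.card P) / Multiset.card Q := by
  classical
  obtain ⟨R, rfl⟩ := Multiset.le_iff_exists_add.1 h
  unfold proportion
  rw [Multiset.countP_add, Multiset.card_add]
  push_cast
  have hR : (R.countP (· ∈ X) : ℝ) ≤ Multiset.card R := by
    exact_mod_cast Multiset.countP_le_card _ _
  have hPc : (P.countP (· ∈ X) : ℝ) ≤ Multiset.card P := by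
    exact_mod_cast Multiset.countP_le_card _ _
  have hR0 : (0 : ℝ) ≤ R.countP (· ∈ X) := Nat.cast_nonneg _
  have hP0 : (0 : ℝ) ≤ P.countP (· ∈ X) := Nat.cast_nonneg _
  have hP' : (0 : ℝ) < Multiset.card P := by exact_mod_cast hP
  generalize (R.countP (· ∈ X) : ℝ) = r at *
  generalize (P.countP (· ∈ X) : ℝ) = p at *
  have hRc : (0 : ℝ) ≤ Multiset.card R := Nat.cast_nonneg _
  generalize (Multiset.card P : ℝ) = n at *
  generalize (Multiset.card R : ℝ) = e at *
  have hn : 0 < n + e := by linarith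
  have : (p + r) / (n + e) - p / n = (r - p * e / n) / (n + e) := by
    field_simp
    ring
  rw [this, abs_div, abs_of_pos hn]
  refine div_le_div_of_nonneg_right ?_ hn.le
  have h1 : p * e / n ≤ e := by
    rw [div_le_iff₀ hP']
    nlinarith
  have h2 : 0 ≤ p * e / n := by positivity
  rw [abs_le]
  constructor <;> linarith

/-! ### The radical inverse -/

theorem radicalInverse_zero : radicalInverse 0 = 0 := by
  simp [radicalInverse, Nat.ofDigits]

theorem radicalInverse_two_mul (i : ℕ) : radicalInverse (2 * i) = radicalInverse i / 2 := by
  rcases Nat.eq_zero_or_pos i with rfl | hi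
  · simp [radicalInverse, Nat.ofDigits]
  · rw [radicalInverse, Nat.digits_def' one_lt_two (by omega), radicalInverse]
    simp [Nat.ofDigits]
    ring

theorem radicalInverse_two_mul_add_one (i : ℕ) :
    radicalInverse (2 * i + 1) = 1 / 2 + radicalInverse i / 2 := by
  rw [radicalInverse, Nat.digits_def' one_lt_two (by omega), radicalInverse,
    show (2 * i + 1) % 2 = 1 by omega, show (2 * i + 1) / 2 = i by omega]
  simp [Nat.ofDigits]
  ring

theorem radicalInverse_mem_Ico (i : ℕ) : radicalInverse i ∈ Set.Ico (0 : ℝ) 1 := by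
  induction i using Nat.strong_induction_on with
  | _ i ih =>
    obtain ⟨j, hj | hj⟩ := Nat.even_or_odd' i
    · rcases Nat.eq_zero_or_pos j with rfl | hj0
      · subst hj
        rw [radicalInverse_two_mul, radicalInverse_zero]
        norm_num
      · have := ih j (by omega)
        rw [hj, radicalInverse_two_mul]
        constructor <;> linarith [this.1, this.2]
    · have := ih j (by omega)
      rw [hj, radicalInverse_two_mul_add_one]
      constructor <;> linarith [this.1, this.2]

theorem radicalInverse_injective : Function.Injective radicalInverse := by
  intro i
  induction i using Nat.strong_induction_on with
  | _ i ih =>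
    intro k hik
    have hodd : ∀ a b : ℕ, radicalInverse (2 * a) ≠ radicalInverse (2 * b + 1) := by
      intro a b h
      rw [radicalInverse_two_mul, radicalInverse_two_mul_add_one] at h
      linarith [(radicalInverse_mem_Ico a).2, (radicalInverse_mem_Ico b).1]
    obtain ⟨a, ha | ha⟩ := Nat.even_or_odd' i <;> obtain ⟨b, hb | hb⟩ := Nat.even_or_odd' k
    · rw [ha, hb, radicalInverse_two_mul, radicalInverse_two_mul] at hik
      rcases Nat.eq_zero_or_pos a with h0 | h0
      · -- `i = 0`, and `0` is the only number with radical inverse `0`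
        by_contra hne
        have hb0 : ∀ c : ℕ, radicalInverse c = 0 → c = 0 := by
          intro c
          induction c using Nat.strong_induction_on with
          | _ c ihc =>
            intro hc
            obtain ⟨d, hd | hd⟩ := Nat.even_or_odd' c
            · rcases Nat.eq_zero_or_pos d with h | h
              · omega
              · rw [hd, radicalInverse_two_mul] at hc
                have := ihc d (by omega) (by linarith)
                omega
            · rw [hd, radicalInverse_two_mul_add_one] at hc
              linarith [(radicalInverse_mem_Ico d).1]
        have := hb0 b (by rw [h0, radicalInverse_zero] at hik; linarith)
        omega
      · have := ih a (by omega) (show radicalInverse a = radicalInverse b by linarith)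
        omega
    · exact absurd (by rw [← ha, ← hb]; exact hik) (hodd a b)
    · exact absurd (by rw [← ha, ← hb]; exact hik.symm) (hodd b a)
    · rw [ha, hb, radicalInverse_two_mul_add_one, radicalInverse_two_mul_add_one] at hik
      have := ih a (by omega) (show radicalInverse a = radicalInverse b by linarith)
      omega

/-! ### Segments of the van der Corput sequence -/

theorem sum_Ico_even_odd (f : ℕ → ℕ) {a b : ℕ} (hab : a ≤ b) :
    ∑ i ∈ Finset.Ico a b, f i = ∑ j ∈ Finset.Ico ((a + 1) / 2) ((b + 1) / 2), f (2 * j) +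
      ∑ j ∈ Finset.Ico (a / 2) (b / 2), f (2 * j + 1) := by
  induction b, hab using Nat.le_induction with
  | base => simp
  | succ b hb ih =>
    rw [Finset.sum_Ico_succ_top hb, ih]
    obtain ⟨c, hc | hc⟩ := Nat.even_or_odd' b
    · rw [show (b + 1 + 1) / 2 = c + 1 by omega, show (b + 1) / 2 = c by omega,
        show b / 2 = c by omega, Finset.sum_Ico_succ_top (a := (a + 1) / 2) (b := c) (by omega), hc]
      ring
    · rw [show (b + 1 + 1) / 2 = c + 1 by omega, show (b + 1) / 2 = c + 1 by omega,
        show b / 2 = c by omega, Finset.sum_Ico_succ_top (a := a / 2) (b := c) (by omega), hc]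
      ring

/-- `v < β`, or `v ≤ β` if `s` holds: both are counted by the same recursion. -/
def belowThreshold (s : Prop) (β v : ℝ) : Prop := v < β ∨ (s ∧ v = β)

open scoped Classical in
/-- The number of terms of the van der Corput sequence below `β` with index in `[a, b)`. -/
noncomputable def countBelow (s : Prop) (a b : ℕ) (β : ℝ) : ℕ :=
  ∑ i ∈ Finset.Ico a b, if belowThreshold s β (radicalInverse i) then 1 else 0

/-- The discrepancy of a segment of the van der Corput sequence is logarithmic: separating even
and odd indices halves the length of the segment and doubles the interval, at the cost `1 / 2`. -/
theorem abs_countBelow_sub_le (s : Prop) (K : ℕ) : ∀ {a b : ℕ} {β : ℝ}, a ≤ b → b ≤ a + 2 ^ K →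
    0 ≤ β → β ≤ 1 → |(countBelow s a b β : ℝ) - ((b : ℝ) - a) * β| ≤ K / 2 + 1 := by
  classical
  induction K with
  | zero =>
    intro a b β hab hb h0 h1
    have hle : countBelow s a b β ≤ b - a := by
      refine (Finset.sum_le_card_nsmul _ _ 1 fun i _ => by split_ifs <;> simp).trans ?_
      simp
    have hle' : (countBelow s a b β : ℝ) ≤ (b : ℝ) - a := by
      rw [← Nat.cast_sub hab]
      exact_mod_cast hle
    have hba : (b : ℝ) ≤ a + 1 := by exact_mod_cast hb
    have hab' : (a : ℝ) ≤ b := by exact_mod_cast hab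
    have hc : (0 : ℝ) ≤ countBelow s a b β := Nat.cast_nonneg _
    rw [abs_le]
    push_cast
    constructor <;> nlinarith
  | succ K ih =>
    intro a b β hab hb h0 h1
    have hpow : 2 ^ (K + 1) = 2 * 2 ^ K := by ring
    rw [hpow] at hb
    have heven := fun {β : ℝ} => ih (a := (a + 1) / 2) (b := (b + 1) / 2) (β := β)
      (by omega) (by omega)
    have hodd := fun {β : ℝ} => ih (a := a / 2) (b := b / 2) (β := β) (by omega) (by omega)
    have hsplit : countBelow s a b β =
        (∑ j ∈ Finset.Ico ((a + 1) / 2) ((b + 1) / 2),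
          if belowThreshold s β (radicalInverse j / 2) then 1 else 0) +
        ∑ j ∈ Finset.Ico (a / 2) (b / 2),
          if belowThreshold s β (1 / 2 + radicalInverse j / 2) then 1 else 0 := by
      rw [countBelow, sum_Ico_even_odd _ hab]
      simp only [radicalInverse_two_mul, radicalInverse_two_mul_add_one]
    have hle1 : (a + 1) / 2 ≤ (b + 1) / 2 := by omega
    have hle2 : a / 2 ≤ b / 2 := by omega
    have hsum : ((((b + 1) / 2 : ℕ) : ℝ) - ((a + 1) / 2 : ℕ)) + (((b / 2 : ℕ) : ℝ) - (a / 2 : ℕ)) =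
        (b : ℝ) - a := by
      have : (b + 1) / 2 + b / 2 + a = b + (a + 1) / 2 + a / 2 := by omega
      have : (((b + 1) / 2 : ℕ) : ℝ) + (b / 2 : ℕ) + a = b + ((a + 1) / 2 : ℕ) + (a / 2 : ℕ) := by
        exact_mod_cast this
      linarith
    have hd1 : (((b + 1) / 2 : ℕ) : ℝ) - ((a + 1) / 2 : ℕ) ≤
        ((b / 2 : ℕ) : ℝ) - (a / 2 : ℕ) + 1 := by
      have : (b + 1) / 2 + a / 2 ≤ b / 2 + 1 + (a + 1) / 2 := by omega
      have : (((b + 1) / 2 : ℕ) : ℝ) + (a / 2 : ℕ) ≤ (b / 2 : ℕ) + 1 + ((a + 1) / 2 : ℕ) := by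
        exact_mod_cast this
      linarith
    have hd2 : ((b / 2 : ℕ) : ℝ) - (a / 2 : ℕ) ≤
        (((b + 1) / 2 : ℕ) : ℝ) - ((a + 1) / 2 : ℕ) + 1 := by
      have : b / 2 + (a + 1) / 2 ≤ (b + 1) / 2 + 1 + a / 2 := by omega
      have : ((b / 2 : ℕ) : ℝ) + ((a + 1) / 2 : ℕ) ≤ ((b + 1) / 2 : ℕ) + 1 + (a / 2 : ℕ) := by
        exact_mod_cast this
      linarith
    rw [← hsum, hsplit]
    push_cast
    rcases lt_or_ge β (1 / 2) with hβ | hβ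
    · have e1 : ∀ j, belowThreshold s β (radicalInverse j / 2) ↔
          belowThreshold s (2 * β) (radicalInverse j) := by
        intro j
        unfold belowThreshold
        constructor
        · rintro (h | ⟨hs, h⟩)
          · left; linarith
          · right; exact ⟨hs, by linarith⟩
        · rintro (h | ⟨hs, h⟩)
          · left; linarith
          · right; exact ⟨hs, by linarith⟩
      have e2 : ∀ j, ¬ belowThreshold s β (1 / 2 + radicalInverse j / 2) := by
        intro j
        have := (radicalInverse_mem_Ico j).1
        rintro (h | ⟨-, h⟩) <;> linarith
      have h3 := heven (β := 2 * β) (by linarith) (by linarith)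
      simp only [countBelow] at h3
      push_cast at h3
      simp only [e1, e2, if_false, Finset.sum_const_zero, add_zero]
      generalize (∑ j ∈ Finset.Ico ((a + 1) / 2) ((b + 1) / 2),
          if belowThreshold s (2 * β) (radicalInverse j) then (1 : ℝ) else 0) = c at *
      generalize (((b + 1) / 2 : ℕ) : ℝ) - ((a + 1) / 2 : ℕ) = x at *
      generalize ((b / 2 : ℕ) : ℝ) - (a / 2 : ℕ) = y at *
      rw [abs_le] at h3 ⊢
      constructor <;> nlinarith [h3.1, h3.2]
    · have e1 : ∀ j, belowThreshold s β (radicalInverse j / 2) := by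
        intro j
        left
        linarith [(radicalInverse_mem_Ico j).2]
      have e2 : ∀ j, belowThreshold s β (1 / 2 + radicalInverse j / 2) ↔
          belowThreshold s (2 * β - 1) (radicalInverse j) := by
        intro j
        unfold belowThreshold
        constructor
        · rintro (h | ⟨hs, h⟩)
          · left; linarith
          · right; exact ⟨hs, by linarith⟩
        · rintro (h | ⟨hs, h⟩)
          · left; linarith
          · right; exact ⟨hs, by linarith⟩
      have h3 := hodd (β := 2 * β - 1) (by linarith) (by linarith)
      simp only [countBelow] at h3
      push_cast at h3
      simp only [e1, e2, if_true, Finset.sum_const, Nat.card_Ico, nsmul_eq_mul, mul_one,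
        Nat.cast_sub hle1]
      generalize (∑ j ∈ Finset.Ico (a / 2) (b / 2),
          if belowThreshold s (2 * β - 1) (radicalInverse j) then (1 : ℝ) else 0) = c at *
      generalize (((b + 1) / 2 : ℕ) : ℝ) - ((a + 1) / 2 : ℕ) = x at *
      generalize ((b / 2 : ℕ) : ℝ) - (a / 2 : ℕ) = y at *
      rw [abs_le] at h3 ⊢
      constructor <;> nlinarith [h3.1, h3.2]

/-! ### Hammersley points -/

theorem coe_hammersley_fst {n i : ℕ} (hi : i < n) :
    ((Set.projIcc (0 : ℝ) 1 zero_le_one ((i : ℝ) / n) : I) : ℝ) = i / n := by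
  rw [Set.projIcc_of_mem]
  exact ⟨by positivity, div_le_one_of_le₀ (by exact_mod_cast hi.le) (by positivity)⟩

theorem coe_hammersley_snd (i : ℕ) :
    ((Set.projIcc (0 : ℝ) 1 zero_le_one (radicalInverse i) : I) : ℝ) = radicalInverse i := by
  rw [Set.projIcc_of_mem]
  exact ⟨(radicalInverse_mem_Ico i).1, (radicalInverse_mem_Ico i).2.le⟩

theorem volume_real_Icc_prod {p q : I × I} (h : p ≤ q) :
    (volume : Measure (I × I)).real (Set.Icc p q) =
      ((q.1 : ℝ) - p.1) * ((q.2 : ℝ) - p.2) := by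
  have h1 : (0 : ℝ) ≤ (q.1 : ℝ) - p.1 := sub_nonneg.2 h.1
  have h2 : (0 : ℝ) ≤ (q.2 : ℝ) - p.2 := sub_nonneg.2 h.2
  rw [Set.Icc_prod_eq, Measure.real, Measure.volume_eq_prod, Measure.prod_prod,
    unitInterval.volume_Icc, unitInterval.volume_Icc, ENNReal.toReal_mul,
    ENNReal.toReal_ofReal h1, ENNReal.toReal_ofReal h2]

/-- The Hammersley points in a rectangle are terms of a segment of the van der Corput sequence
between two thresholds. -/
theorem abs_proportion_hammersleyPoints_sub_le {n K : ℕ} (hn : 0 < n) (hK : n ≤ 2 ^ K)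
    {p q : I × I} (hpq : p ≤ q) :
    |proportion (hammersleyPoints n) (Set.Icc p q) - (volume : Measure (I × I)).real (Set.Icc p q)| ≤
      (K + 3) / n := by
  classical
  have hn' : (0 : ℝ) < n := by exact_mod_cast hn
  rw [volume_real_Icc_prod hpq]
  have hp1 : (0 : ℝ) ≤ p.1 := p.1.2.1
  have hp2 : (0 : ℝ) ≤ p.2 := p.2.2.1
  have hq1 : (q.1 : ℝ) ≤ 1 := q.1.2.2
  have hq2 : (q.2 : ℝ) ≤ 1 := q.2.2.2
  have hpq1 : (p.1 : ℝ) ≤ q.1 := hpq.1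
  have hpq2 : (p.2 : ℝ) ≤ q.2 := hpq.2
  rw [hammersleyPoints, proportion_map, proportion_range]
  set a := ⌈(n : ℝ) * p.1⌉₊ with ha
  set b := min n (⌊(n : ℝ) * q.1⌋₊ + 1) with hb
  have hnq : 0 ≤ (n : ℝ) * q.1 := by have := q.1.2.1; positivity
  have hb1 : (b : ℝ) ≤ n * q.1 + 1 := by
    rw [hb]
    push_cast
    exact (min_le_right _ _).trans (by linarith [Nat.floor_le hnq])
  have hb2 : (n : ℝ) * q.1 ≤ b := by
    rw [hb]
    push_cast
    exact le_min (mul_le_of_le_one_right hn'.le hq1) (Nat.lt_floor_add_one _).le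
  have ha1 : (n : ℝ) * p.1 ≤ a := Nat.le_ceil _
  have ha2 : (a : ℝ) < n * p.1 + 1 := Nat.ceil_lt_add_one (by positivity)
  have hab : a ≤ b := by
    refine le_min (Nat.ceil_le.2 ?_) (Nat.ceil_le.2 ?_)
    · exact mul_le_of_le_one_right hn'.le (hpq1.trans hq1)
    · push_cast
      exact (mul_le_mul_of_nonneg_left hpq1 hn'.le).trans (Nat.lt_floor_add_one _).le
  have hbn : b ≤ n := min_le_left _ _
  have hmem : ∀ i ∈ Finset.range n,
      (i ∈ (fun i : ℕ => (Set.projIcc (0 : ℝ) 1 zero_le_one ((i : ℝ) / n),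
        Set.projIcc (0 : ℝ) 1 zero_le_one (radicalInverse i))) ⁻¹' Set.Icc p q ↔
      i ∈ Finset.Ico a b ∧ (p.2 : ℝ) ≤ radicalInverse i ∧ radicalInverse i ≤ q.2) := by
    intro i hi
    rw [Finset.mem_range] at hi
    rw [Set.mem_preimage, Set.mem_Icc, Prod.le_def, Prod.le_def, ← Subtype.coe_le_coe,
      ← Subtype.coe_le_coe, ← Subtype.coe_le_coe, ← Subtype.coe_le_coe, coe_hammersley_fst hi,
      coe_hammersley_snd, le_div_iff₀ hn', div_le_iff₀ hn', Finset.mem_Ico, ha, hb, lt_min_iff,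
      Nat.lt_succ_iff, Nat.ceil_le, Nat.le_floor_iff hnq, mul_comm (p.1 : ℝ), mul_comm (q.1 : ℝ)]
    tauto
  have hcount : (((Finset.range n).filter (· ∈ (fun i : ℕ =>
      (Set.projIcc (0 : ℝ) 1 zero_le_one ((i : ℝ) / n),
        Set.projIcc (0 : ℝ) 1 zero_le_one (radicalInverse i))) ⁻¹' Set.Icc p q)).card +
      countBelow False a b p.2 : ℕ) = countBelow True a b q.2 := by
    rw [Finset.filter_congr hmem, Finset.card_filter]
    have h1 : (∑ i ∈ Finset.range n, if i ∈ Finset.Ico a b ∧ (p.2 : ℝ) ≤ radicalInverse i ∧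
          radicalInverse i ≤ q.2 then 1 else 0) =
        ∑ i ∈ Finset.Ico a b, if (p.2 : ℝ) ≤ radicalInverse i ∧ radicalInverse i ≤ q.2
          then 1 else 0 := by
      have hsub : Finset.Ico a b ⊆ Finset.range n := fun i hi => by
        rw [Finset.mem_Ico] at hi
        rw [Finset.mem_range]
        omega
      rw [← Finset.sum_subset hsub]
      · exact Finset.sum_congr rfl fun i hi => by simp only [hi, true_and]
      · intro i _ hi
        rw [if_neg fun h => hi h.1]
    rw [h1, countBelow, countBelow, ← Finset.sum_add_distrib]
    refine Finset.sum_congr rfl fun i _ => ?_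
    simp only [belowThreshold, false_and, or_false, true_and, ← le_iff_lt_or_eq]
    by_cases h2 : radicalInverse i < p.2
    · simp [h2, not_le.2 h2, (h2.trans_le hpq2).le]
    · simp [h2, not_lt.1 h2]
  have hcount' : (((Finset.range n).filter (· ∈ (fun i : ℕ =>
      (Set.projIcc (0 : ℝ) 1 zero_le_one ((i : ℝ) / n),
        Set.projIcc (0 : ℝ) 1 zero_le_one (radicalInverse i))) ⁻¹' Set.Icc p q)).card : ℝ) =
      countBelow True a b q.2 - countBelow False a b p.2 := by
    rw [← hcount]
    push_cast
    ring
  have hlen : b ≤ a + 2 ^ K := by omega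
  have h1 := abs_le.1 (abs_countBelow_sub_le True K hab hlen (hp2.trans hpq2) hq2)
  have h2 := abs_le.1 (abs_countBelow_sub_le False K hab hlen hp2 (hpq2.trans hq2))
  rw [hcount', div_sub' hn'.ne', abs_div, abs_of_pos hn']
  refine div_le_div_of_nonneg_right ?_ hn'.le
  generalize (countBelow True a b q.2 : ℝ) = c at *
  generalize (countBelow False a b p.2 : ℝ) = d at *
  -- the number of indices differs by at most one from `n` times the width
  have h3 : |((b : ℝ) - a - n * ((q.1 : ℝ) - p.1)) * ((q.2 : ℝ) - p.2)| ≤ 1 := by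
    rw [abs_mul, ← one_mul (1 : ℝ)]
    refine mul_le_mul ?_ ?_ (abs_nonneg _) zero_le_one
    · rw [abs_le]; constructor <;> linarith
    · rw [abs_le]; constructor <;> linarith
  rw [abs_le] at h3 ⊢
  constructor <;> nlinarith [h1.1, h1.2, h2.1, h2.2, h3.1, h3.2]

theorem abs_proportion_hammersleyPoints_sub_le_log {n : ℕ} (hn : 0 < n) {p q : I × I}
    (hpq : p ≤ q) :
    |proportion (hammersleyPoints n) (Set.Icc p q) - (volume : Measure (I × I)).real (Set.Icc p q)| ≤
      4 * ((1 + Real.log n) / n) := by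
  have hn' : (1 : ℝ) ≤ n := by exact_mod_cast hn
  refine (abs_proportion_hammersleyPoints_sub_le hn
    (Nat.lt_pow_succ_log_self one_lt_two n).le hpq).trans ?_
  rw [← mul_div_assoc]
  refine div_le_div_of_nonneg_right ?_ (by linarith)
  have h1 : ((2 : ℝ) ^ Nat.log 2 n) ≤ n := by exact_mod_cast Nat.pow_log_le_self 2 hn.ne'
  have h2 := Real.log_le_log (by positivity) h1
  rw [Real.log_pow] at h2
  have h3 := Real.log_two_gt_d9
  have h4 : (0 : ℝ) ≤ Nat.log 2 n := Nat.cast_nonneg _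
  have h5 := Real.log_nonneg hn'
  push_cast
  nlinarith

/-! ### The explicit point set -/

theorem card_so3PointsOf (N : ℕ) (T : Multiset (I × I)) :
    Multiset.card (so3PointsOf N T) = numCircle N * Multiset.card T := by
  simp [so3PointsOf, fiberedProductPoints, equispacedPoints]

theorem card_so3Points (N : ℕ) :
    Multiset.card (so3Points N) = numCircle N * numSphere N := by
  rw [so3Points, card_so3PointsOf, hammersleyPoints, Multiset.card_map, Multiset.card_range]

theorem nodup_equispacedPoints (n : ℕ) : (equispacedPoints n).Nodup := by
  refine Multiset.Nodup.map_on ?_ (Multiset.nodup_range n)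
  intro i hi j hj h
  rw [Multiset.mem_range] at hi hj
  obtain ⟨m, hm⟩ := Circle.exp_eq_exp.1 h
  have hn : (0 : ℝ) < n := by
    have : 0 < n := by omega
    exact_mod_cast this
  have hpi := Real.pi_pos
  have h1 : (i : ℝ) = j + m * n := by
    field_simp at hm
    linarith
  have h2 : (i : ℤ) = j + m * n := by exact_mod_cast h1
  have h3 : (n : ℤ) ∣ (i : ℤ) - j := ⟨m, by rw [h2]; ring⟩
  have h4 := Int.eq_zero_of_abs_lt_dvd h3 (by rw [abs_lt]; constructor <;> omega)
  omega

theorem nodup_so3Points (N : ℕ) : (so3Points N).Nodup := by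
  rw [so3Points, so3PointsOf, fiberedProductPoints]
  refine Multiset.Nodup.map ?_ (Multiset.Nodup.product (nodup_equispacedPoints _) ?_)
  · rintro ⟨u, x⟩ ⟨v, y⟩ h
    obtain ⟨rfl, rfl⟩ := hopf_injective h
    rfl
  · rw [hammersleyPoints, Multiset.map_map]
    refine Multiset.Nodup.map ?_ (Multiset.nodup_range _)
    intro i j h
    have h1 := congrArg (fun x : S2 => x.1 2) h
    simp only [Function.comp_apply, lambert, Matrix.cons_val, coe_hammersley_snd] at h1
    exact radicalInverse_injective (by linarith)

theorem exists_so3Points_bound :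
    ∃ C : ℝ, ∀ N : ℕ, 2 ≤ N →
      (so3Points N).Nodup ∧
      Multiset.card (so3Points N) = numCircle N * numSphere N ∧
      Multiset.card (so3Points N) ≤ N ∧
      N < Multiset.card (so3Points N) + numCircle N ∧
      discrepancy haarSO3 (so3Points N) localCartesianConvexSets
        ≤ C * (Real.log N ^ (2 / 3 : ℝ) / (N : ℝ) ^ (1 / 3 : ℝ)) ∧
      ∀ Q : Multiset SO3, so3Points N ≤ Q → Multiset.card Q = N →
        discrepancy haarSO3 Q localCartesianConvexSets
          ≤ C * (Real.log N ^ (2 / 3 : ℝ) / (N : ℝ) ^ (1 / 3 : ℝ)) := by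
  obtain ⟨C, hC0, hC⟩ := exists_abs_proportion_so3PointsOf_sub_le 4 (by norm_num)
  refine ⟨C + 24, fun N hN => ?_⟩
  have hx := half_le_circleScale hN
  have hL := half_lt_log hN
  have hcard := card_so3Points N
  have hs1 : (1 : ℝ) ≤ numSphere N := by exact_mod_cast numSphere_pos hN
  have hsN : (numSphere N : ℝ) ≤ N := by exact_mod_cast Nat.div_le_self _ _
  have hx0 : 0 ≤ 1 / circleScale N := by rw [one_div_nonneg]; linarith
  have hbound : ∀ X ∈ localCartesianConvexSets,
      |proportion (so3Points N) X - haarSO3.real X / haarSO3.real Set.univ| ≤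
        C * (1 / circleScale N) := by
    refine hC N hN _ fun p q hpq => ?_
    refine (abs_proportion_hammersleyPoints_sub_le_log (numSphere_pos hN) hpq).trans ?_
    have := Real.log_le_log (by linarith) hsN
    refine mul_le_mul_of_nonneg_left ?_ (by norm_num)
    exact div_le_div_of_nonneg_right (by linarith) (by linarith)
  rw [rate_eq hN]
  refine ⟨nodup_so3Points N, hcard, hcard ▸ numCircle_mul_numSphere_le N,
    hcard ▸ lt_numCircle_mul_numSphere_add hN, ?_, ?_⟩
  · exact discrepancy_le (by positivity) fun X hX => (hbound X hX).trans (by linarith)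
  · intro Q hQ hQN
    have hlt : (N : ℝ) < Multiset.card (so3Points N) + numCircle N := by
      rw [hcard]
      exact_mod_cast lt_numCircle_mul_numSphere_add hN
    have hN' : (0 : ℝ) < N := by linarith
    -- at most `N₁ = O(N^(1/3))` points have been added
    have hadd : ((Multiset.card Q : ℝ) - Multiset.card (so3Points N)) / Multiset.card Q ≤
        24 * (1 / circleScale N) := by
      have h1 := numCircle_le_mul hN
      have h2 := circleScale_pow (N := N)
      rw [eq_div_iff (by positivity)] at h2
      have h3 : circleScale N ^ 2 ≤ 8 * N := by
        rw [← h2]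
        have h4 : 1 ≤ 8 * (circleScale N * Real.log N ^ 2) := by nlinarith
        nlinarith [sq_nonneg (circleScale N)]
      rw [hQN, mul_one_div, div_le_div_iff₀ hN' (by linarith)]
      nlinarith
    refine discrepancy_le (by positivity) fun X hX => ?_
    have h5 := abs_proportion_sub_proportion_le hQ
      (by rw [hcard]; exact Nat.mul_pos (numCircle_pos hN) (numSphere_pos hN)) X
    have h6 := hbound X hX
    have h7 := abs_sub_le (proportion Q X) (proportion (so3Points N) X)
      (haarSO3.real X / haarSO3.real Set.univ)
    linarith

/-! ### Straight-line programs and counting loops -/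

/-- A nonempty list of assignments, as a program. -/
def assigns : ℕ × Op → List (ℕ × Op) → Program
  | p, [] => .assign p.1 p.2
  | p, q :: l => .seq (.assign p.1 p.2) (assigns q l)

/-- The effect of a list of assignments on the registers. -/
noncomputable def execAssigns : List (ℕ × Op) → (ℕ → ℝ) → ℕ → ℝ
  | [], r => r
  | p :: l, r => execAssigns l (Function.update r p.1 (p.2.eval r))

theorem runs_assigns (p : ℕ × Op) (l : List (ℕ × Op)) (s : MachineState) :
    Runs (assigns p l) s ⟨execAssigns (p :: l) s.reg, s.out⟩ (l.length + 1) := by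
  induction l generalizing p s with
  | nil => exact Runs.assign p.1 p.2 s
  | cons q l ih =>
    have h := Runs.seq (Runs.assign p.1 p.2 s) (ih q _)
    rw [add_comm] at h
    exact h

theorem execAssigns_of_notMem {l : List (ℕ × Op)} {k : ℕ} (h : k ∉ l.map Prod.fst) (r : ℕ → ℝ) :
    execAssigns l r k = r k := by
  induction l generalizing r with
  | nil => rfl
  | cons p l ih =>
    rw [List.map_cons, List.mem_cons, not_or] at h
    rw [execAssigns, ih h.2, Function.update_of_ne h.1]

/-- A loop that passes from stage `k` of an invariant to stage `k + 1` until stage `n` is reached. -/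
theorem exists_runs_whileLT {a b n K : ℕ} {p : Program} {Inv : ℕ → MachineState → Prop}
    (step : ∀ k < n, ∀ s, Inv k s → s.reg a < s.reg b ∧
      ∃ s' t, Runs p s s' t ∧ t ≤ K ∧ Inv (k + 1) s')
    (exit : ∀ s, Inv n s → ¬ s.reg a < s.reg b) {s : MachineState} (hs : Inv 0 s) :
    ∃ s' t, Runs (.whileLT a b p) s s' t ∧ t ≤ n * (K + 1) + 1 ∧ Inv n s' := by
  have h : ∀ d k, k + d = n → ∀ s, Inv k s →
      ∃ s' t, Runs (.whileLT a b p) s s' t ∧ t ≤ d * (K + 1) + 1 ∧ Inv n s' := by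
    intro d
    induction d with
    | zero =>
      intro k hk s hs
      have hk' : k = n := by omega
      subst hk'
      exact ⟨s, 1, Runs.whileFalse (exit s hs), by omega, hs⟩
    | succ d ih =>
      intro k hk s hs
      obtain ⟨hlt, s₁, t₁, h₁, ht₁, hi₁⟩ := step k (by omega) s hs
      obtain ⟨s₂, t₂, h₂, ht₂, hi₂⟩ := ih (k + 1) (by omega) s₁ hi₁
      refine ⟨s₂, _, Runs.whileTrue hlt h₁ h₂, ?_, hi₂⟩
      rw [Nat.succ_mul]
      omega
  exact h n 0 (by omega) s hs

/-! ### The program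

The registers `0`, …, `9` hold `N`, `0`, `1`, `2`, `N₁`, `N / log² N`, `N₁³`, `N₂`, `N₁ (N₂ + 1)`
and `N + 1`; the registers `10`, …, `16` hold the index on the circle, the cosine and the sine of
its angle, the index on the sphere, its radical inverse, a power of `1 / 2` and a flag. All other
registers hold intermediate results. -/

/-- One step of the binary odometer: if the leading digit is `0` it becomes `1` and the loop ends,
otherwise it becomes `0` and the carry passes to the next digit. -/
def odometerStep : Program :=
  .ifLT 14 15 (assigns (14, .add 14 15) [(16, .zero)]) (assigns (14, .sub 14 15) [(15, .div 15 3)])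

/-- Replaces the radical inverse of `i` by that of `i + 1`. -/
def odometer : Program :=
  .seq (assigns (15, .div 2 3) [(16, .one)]) (.whileLT 1 16 odometerStep)

/-- The cosine and sine of the azimuth, and the cosine and sine of the polar angle. -/
def sphereBlock : List (ℕ × Op) :=
  [(17, .add 17 17), (17, .mul 17 13), (17, .div 17 7), (18, .sin 17), (17, .cos 17),
    (19, .add 14 14), (19, .sub 2 19), (20, .mul 14 14), (20, .sub 14 20), (20, .sqrt 20),
    (20, .add 20 20)]

/-- The entries of the rotation that carries `e₃` to the point of the sphere. -/
def sectionBlock : List (ℕ × Op) :=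
  [(22, .mul 18 18), (23, .mul 17 18), (24, .mul 21 19), (24, .add 24 22), (25, .sub 19 2),
    (26, .mul 23 25), (27, .mul 22 19), (27, .add 27 21), (28, .mul 17 20), (29, .mul 18 20),
    (30, .sub 1 28), (31, .sub 1 29)]

/-- The first two columns of the product with the rotation about the third axis. -/
def rotationBlock : List (ℕ × Op) :=
  [(38, .mul 26 12), (32, .add 32 38), (33, .mul 26 11), (38, .mul 24 12), (33, .sub 33 38),
    (34, .mul 26 11), (38, .mul 27 12), (34, .add 34 38), (35, .mul 27 11), (38, .mul 26 12),
    (35, .sub 35 38), (36, .mul 30 11), (38, .mul 31 12), (36, .add 36 38), (37, .mul 31 11),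
    (38, .mul 30 12), (37, .sub 37 38)]

/-- The output of one point, and the step to the next one on the same fibre angle. -/
def innerBody : Program :=
  .seq (assigns (17, .pi) sphereBlock) (.seq (assigns (21, .mul 17 17) sectionBlock)
    (.seq (assigns (32, .mul 24 11) rotationBlock)
      (.seq (.output !![32, 33, 28; 34, 35, 29; 36, 37, 19])
        (.seq odometer (assigns (13, .add 13 2) [])))))

/-- The output of all points with the same fibre angle. -/
def outerBody : Program :=
  .seq (assigns (11, .pi) [(11, .add 11 11), (11, .mul 11 10), (11, .div 11 4), (12, .sin 11),
      (11, .cos 11), (13, .zero), (14, .zero)])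
    (.seq (.whileLT 13 7 innerBody) (assigns (10, .add 10 2) []))

/-- The program that generates the points. -/
def pointProgram : Program :=
  .seq (assigns (2, .one) [(3, .add 2 2), (5, .log 0), (5, .mul 5 5), (5, .div 0 5), (9, .add 0 2)])
    (.seq (.whileLT 6 5 (assigns (4, .add 4 2) [(6, .mul 4 4), (6, .mul 6 4)]))
      (.seq (assigns (8, .add 4 1) [])
        (.seq (.whileLT 8 9 (assigns (7, .add 7 2) [(8, .add 8 4)]))
          (.whileLT 10 4 outerBody))))

/-! ### Correctness of the program -/

/-- The odometer at the digit of weight `c / 2`, where register `14` holds the contribution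
`c * v i` of the digits `i` that are still to be incremented. -/
theorem exists_runs_odometerLoop (i : ℕ) : ∀ (c : ℝ), 0 < c → ∀ s : MachineState,
    s.reg 1 = 0 → s.reg 3 = 2 → s.reg 14 = c * radicalInverse i → s.reg 15 = c / 2 →
    s.reg 16 = 1 → ∃ s' t, Runs (.whileLT 1 16 odometerStep) s s' t ∧ t ≤ 4 * i + 5 ∧
      s'.reg 14 = c * radicalInverse (i + 1) ∧ s'.out = s.out ∧
      ∀ k < 14, s'.reg k = s.reg k := by
  induction i using Nat.strong_induction_on with
  | _ i ih =>
    intro c hc s h1 h3 h14 h15 h16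
    have hlt : s.reg 1 < s.reg 16 := by rw [h1, h16]; norm_num
    obtain ⟨j, hj | hj⟩ := Nat.even_or_odd' i
    · have hv := radicalInverse_two_mul j
      rw [← hj] at hv
      have hv' := radicalInverse_two_mul_add_one j
      rw [← hj] at hv'
      have hcond : s.reg 14 < s.reg 15 := by
        rw [h14, h15, hv]
        have := (radicalInverse_mem_Ico j).2
        nlinarith
      refine ⟨_, _, Runs.whileTrue hlt (Runs.ifTrue hcond (runs_assigns _ _ _))
        (Runs.whileFalse ?_), ?_, ?_, rfl, ?_⟩
      · simp [execAssigns, Op.eval, h1]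
      · simp
      · simp [execAssigns, Op.eval, h14, h15, hv, hv']
        ring
      · intro k hk
        refine execAssigns_of_notMem ?_ _
        simp
        omega
    · have hv := radicalInverse_two_mul_add_one j
      rw [← hj] at hv
      have hv' : radicalInverse (i + 1) = radicalInverse (j + 1) / 2 := by
        rw [← radicalInverse_two_mul]
        congr 1
        omega
      have hcond : ¬ s.reg 14 < s.reg 15 := by
        rw [h14, h15, hv]
        have := (radicalInverse_mem_Ico j).1
        nlinarith
      obtain ⟨s', t, hrun, ht, h14', hout, hframe⟩ := ih j (by omega) (c / 2) (by positivity)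
        ⟨execAssigns [(14, .sub 14 15), (15, .div 15 3)] s.reg, s.out⟩
        (by simp [execAssigns, h1]) (by simp [execAssigns, h3])
        (by simp [execAssigns, Op.eval, h14, h15, hv]; ring)
        (by simp [execAssigns, Op.eval, h15, h3])
        (by simp [execAssigns, h16])
      refine ⟨s', _, Runs.whileTrue hlt (Runs.ifFalse hcond (runs_assigns _ _ _)) hrun, ?_, ?_,
        hout, ?_⟩
      · simp
        omega
      · rw [h14', hv']
        ring
      · intro k hk
        rw [hframe k hk]
        refine execAssigns_of_notMem ?_ _
        simp
        omega

theorem exists_runs_odometer (i : ℕ) (s : MachineState) (h1 : s.reg 1 = 0) (h2 : s.reg 2 = 1)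
    (h3 : s.reg 3 = 2) (h14 : s.reg 14 = radicalInverse i) :
    ∃ s' t, Runs odometer s s' t ∧ t ≤ 4 * i + 7 ∧ s'.reg 14 = radicalInverse (i + 1) ∧
      s'.out = s.out ∧ ∀ k < 14, s'.reg k = s.reg k := by
  obtain ⟨s', t, hrun, ht, h14', hout, hframe⟩ := exists_runs_odometerLoop i 1 one_pos
    ⟨execAssigns [(15, .div 2 3), (16, .one)] s.reg, s.out⟩
    (by simp [execAssigns, h1]) (by simp [execAssigns, h3]) (by simp [execAssigns, h14])
    (by simp [execAssigns, Op.eval, h2, h3]) (by simp [execAssigns, Op.eval])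
  refine ⟨s', _, Runs.seq (runs_assigns _ _ _) hrun, ?_, by rw [h14', one_mul], hout, ?_⟩
  · simp
    omega
  · intro k hk
    rw [hframe k hk]
    refine execAssigns_of_notMem ?_ _
    simp
    omega

/-- The matrix with Hopf coordinates `ψ`, `θ`, `φ` in terms of the cosines and sines `(C, S)` of
`ψ`, `(z, r)` of `θ` and `(c, s)` of `φ`. -/
def hopfMatrix (C S z r c s : ℝ) : Matrix (Fin 3) (Fin 3) ℝ :=
  !![(c * c * z + s * s) * C + c * s * (z - 1) * S, c * s * (z - 1) * C - (c * c * z + s * s) * S,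
      c * r;
    c * s * (z - 1) * C + (s * s * z + c * c) * S, (s * s * z + c * c) * C - c * s * (z - 1) * S,
      s * r;
    (0 - c * r) * C + (0 - s * r) * S, (0 - s * r) * C - (0 - c * r) * S, z]

/-- For points of the square that are not on its lower edge, except for the origin, Hopf coordinates
of the image under the Lambert map can be read off: this is where the convention for the azimuth at
the poles enters. -/
theorem hopf_lambert_val (t : ℝ) (x y : I) (hy1 : (y : ℝ) < 1) (hxy : (y : ℝ) = 0 → (x : ℝ) = 0) :
    (hopf (Circle.exp t) (lambert (x, y))).1 =
      hopfMatrix (Real.cos t) (Real.sin t) (1 - 2 * y) (2 * √((y : ℝ) - (y : ℝ) ^ 2))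
        (Real.cos (2 * Real.pi * x)) (Real.sin (2 * Real.pi * x)) := by
  set p := lambert (x, y) with hp
  set r := 2 * √((y : ℝ) - (y : ℝ) ^ 2) with hr
  have p0 : p.1 0 = r * Real.cos (2 * Real.pi * x) := by simp [hp, lambert, hr]
  have p1 : p.1 1 = r * Real.sin (2 * Real.pi * x) := by simp [hp, lambert, hr]
  have p2 : p.1 2 = 1 - 2 * y := by simp [hp, lambert]
  have hz : Real.cos (polarAngle p) = 1 - 2 * y := by rw [cos_polarAngle, p2]
  have hsin : Real.sin (polarAngle p) = r := by
    rw [sin_polarAngle, p2, hr, show 1 - (1 - 2 * (y : ℝ)) ^ 2 = 2 ^ 2 * ((y : ℝ) - (y : ℝ) ^ 2) by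
      ring, Real.sqrt_mul (by norm_num), Real.sqrt_sq (by norm_num)]
  have hcs : Real.cos (azimuth p) = Real.cos (2 * Real.pi * x) ∧
      Real.sin (azimuth p) = Real.sin (2 * Real.pi * x) := by
    rcases eq_or_lt_of_le y.2.1 with h0 | h0
    · have hx0 := hxy h0.symm
      have hr0 : r = 0 := by rw [hr, ← h0]; simp
      have : azimuth p = 0 := by
        rw [azimuth, p0, p1, hr0, zero_mul, zero_mul]
        exact Complex.arg_zero
      rw [this, hx0, mul_zero]
      exact ⟨rfl, rfl⟩
    · have hr0 : 0 < r := by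
        rw [hr]
        have : 0 < (y : ℝ) - (y : ℝ) ^ 2 := by nlinarith
        positivity
      have h1 := sin_mul_cos_azimuth p
      have h2 := sin_mul_sin_azimuth p
      rw [hsin, p0] at h1
      rw [hsin, p1] at h2
      exact ⟨mul_left_cancel₀ hr0.ne' h1, mul_left_cancel₀ hr0.ne' h2⟩
  rw [hopf_exp, hopfSection]
  ext i j
  fin_cases i <;> fin_cases j <;>
    simp [hopfMatrix, rotZ, rotY, hz, hsin, hcs.1, hcs.2] <;>
    ring

/-- The matrix of the point with index `j` on the circle and `i` on the sphere. -/
noncomputable def pointMatrix (N j i : ℕ) : Matrix (Fin 3) (Fin 3) ℝ :=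
  (hopf (Circle.exp (2 * Real.pi * j / numCircle N))
    (lambert (Set.projIcc (0 : ℝ) 1 zero_le_one ((i : ℝ) / numSphere N),
      Set.projIcc (0 : ℝ) 1 zero_le_one (radicalInverse i)))).1

theorem pointMatrix_eq {N j i : ℕ} (hi : i < numSphere N) :
    pointMatrix N j i = hopfMatrix (Real.cos (2 * Real.pi * j / numCircle N))
      (Real.sin (2 * Real.pi * j / numCircle N)) (1 - 2 * radicalInverse i)
      (2 * √(radicalInverse i - radicalInverse i ^ 2))
      (Real.cos (2 * Real.pi * (i / numSphere N))) (Real.sin (2 * Real.pi * (i / numSphere N))) := by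
  rw [pointMatrix, hopf_lambert_val, coe_hammersley_fst hi, coe_hammersley_snd]
  · rw [coe_hammersley_snd]
    exact (radicalInverse_mem_Ico i).2
  · rw [coe_hammersley_snd, coe_hammersley_fst hi]
    intro h
    rw [← radicalInverse_zero] at h
    rw [radicalInverse_injective h]
    simp

/-- The registers that stay the same while the points are generated. -/
structure ConstantRegisters (N : ℕ) (s : MachineState) : Prop where
  zero : s.reg 1 = 0
  one : s.reg 2 = 1
  two : s.reg 3 = 2
  circle : s.reg 4 = numCircle N
  sphere : s.reg 7 = numSphere N

theorem ConstantRegisters.of_frame {N : ℕ} {s s' : MachineState} (h : ConstantRegisters N s)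
    (hframe : ∀ k < 10, s'.reg k = s.reg k) : ConstantRegisters N s' where
  zero := by rw [hframe 1 (by norm_num), h.zero]
  one := by rw [hframe 2 (by norm_num), h.one]
  two := by rw [hframe 3 (by norm_num), h.two]
  circle := by rw [hframe 4 (by norm_num), h.circle]
  sphere := by rw [hframe 7 (by norm_num), h.sphere]

theorem execAssigns_sphereBlock (r : ℕ → ℝ) {n x y : ℝ} (h2 : r 2 = 1) (h7 : r 7 = n)
    (h13 : r 13 = x) (h14 : r 14 = y) :
    let r' := execAssigns ((17, .pi) :: sphereBlock) r
    r' 17 = Real.cos (2 * Real.pi * (x / n)) ∧ r' 18 = Real.sin (2 * Real.pi * (x / n)) ∧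
      r' 19 = 1 - 2 * y ∧ r' 20 = 2 * √(y - y ^ 2) ∧ ∀ k < 17, r' k = r k := by
  have e : 2 * Real.pi * (x / n) = (Real.pi + Real.pi) * x / n := by ring
  refine ⟨?_, ?_, ?_, ?_, fun k hk => execAssigns_of_notMem ?_ _⟩
  · simp [sphereBlock, execAssigns, Op.eval, h7, h13, e]
  · simp [sphereBlock, execAssigns, Op.eval, h7, h13, e]
  · simp [sphereBlock, execAssigns, Op.eval, h2, h14]
    ring
  · simp [sphereBlock, execAssigns, Op.eval, h14]
    rw [← two_mul, sq]
  · simp [sphereBlock]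
    omega

theorem execAssigns_sectionBlock (r : ℕ → ℝ) {c s z ρ : ℝ} (h1 : r 1 = 0) (h2 : r 2 = 1)
    (h17 : r 17 = c) (h18 : r 18 = s) (h19 : r 19 = z) (h20 : r 20 = ρ) :
    let r' := execAssigns ((21, .mul 17 17) :: sectionBlock) r
    r' 24 = c * c * z + s * s ∧ r' 26 = c * s * (z - 1) ∧ r' 27 = s * s * z + c * c ∧
      r' 28 = c * ρ ∧ r' 29 = s * ρ ∧ r' 30 = 0 - c * ρ ∧ r' 31 = 0 - s * ρ ∧ r' 19 = z ∧
      ∀ k < 17, r' k = r k := by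
  refine ⟨?_, ?_, ?_, ?_, ?_, ?_, ?_, ?_, fun k hk => execAssigns_of_notMem ?_ _⟩
  iterate 8 simp [sectionBlock, execAssigns, Op.eval, h1, h2, h17, h18, h19, h20]
  simp [sectionBlock]
  omega

theorem execAssigns_rotationBlock (r : ℕ → ℝ) {a b c d e f C S : ℝ} (h11 : r 11 = C)
    (h12 : r 12 = S) (h24 : r 24 = a) (h26 : r 26 = b) (h27 : r 27 = c) (h28 : r 28 = d)
    (h29 : r 29 = e) (h19 : r 19 = f) {g h : ℝ} (h30 : r 30 = g) (h31 : r 31 = h) :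
    let r' := execAssigns ((32, .mul 24 11) :: rotationBlock) r
    (!![32, 33, 28; 34, 35, 29; 36, 37, 19] : Matrix (Fin 3) (Fin 3) ℕ).map r' =
      !![a * C + b * S, b * C - a * S, d; b * C + c * S, c * C - b * S, e;
        g * C + h * S, h * C - g * S, f] ∧ ∀ k < 17, r' k = r k := by
  refine ⟨?_, fun k hk => execAssigns_of_notMem ?_ _⟩
  · set r' := execAssigns ((32, .mul 24 11) :: rotationBlock) r with hr'
    have e19 : r' 19 = f := by simp [hr', rotationBlock, execAssigns, h19]
    have e28 : r' 28 = d := by simp [hr', rotationBlock, execAssigns, h28]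
    have e29 : r' 29 = e := by simp [hr', rotationBlock, execAssigns, h29]
    have e32 : r' 32 = a * C + b * S := by
      simp [hr', rotationBlock, execAssigns, Op.eval, h11, h12, h24, h26]
    have e33 : r' 33 = b * C - a * S := by
      simp [hr', rotationBlock, execAssigns, Op.eval, h11, h12, h24, h26]
    have e34 : r' 34 = b * C + c * S := by
      simp [hr', rotationBlock, execAssigns, Op.eval, h11, h12, h26, h27]
    have e35 : r' 35 = c * C - b * S := by
      simp [hr', rotationBlock, execAssigns, Op.eval, h11, h12, h26, h27]
    have e36 : r' 36 = g * C + h * S := by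
      simp [hr', rotationBlock, execAssigns, Op.eval, h11, h12, h30, h31]
    have e37 : r' 37 = h * C - g * S := by
      simp [hr', rotationBlock, execAssigns, Op.eval, h11, h12, h30, h31]
    ext i j
    fin_cases i <;> fin_cases j
    exacts [e32, e33, e28, e34, e35, e29, e36, e37, e19]
  · simp [rotationBlock]
    omega

/-- The stage of the inner loop at which `k` points of the fibre angle with index `j` have been
output. -/
structure InnerInvariant (N j : ℕ) (out : List (Matrix (Fin 3) (Fin 3) ℝ)) (k : ℕ)
    (s : MachineState) : Prop where
  const : ConstantRegisters N s
  circleIndex : s.reg 10 = j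
  cos : s.reg 11 = Real.cos (2 * Real.pi * j / numCircle N)
  sin : s.reg 12 = Real.sin (2 * Real.pi * j / numCircle N)
  sphereIndex : s.reg 13 = k
  radicalInverse : s.reg 14 = radicalInverse k
  out_eq : (s.out : Multiset (Matrix (Fin 3) (Fin 3) ℝ)) =
    (Multiset.range k).map (pointMatrix N j) + out

theorem exists_runs_innerBody {N j k : ℕ} {out : List (Matrix (Fin 3) (Fin 3) ℝ)}
    (hk : k < numSphere N) {s : MachineState} (hs : InnerInvariant N j out k s) :
    ∃ s' t, Runs innerBody s s' t ∧ t ≤ 4 * k + 60 ∧ InnerInvariant N j out (k + 1) s' := by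
  obtain ⟨a17, a18, a19, a20, afr⟩ := execAssigns_sphereBlock s.reg hs.const.one hs.const.sphere
    hs.sphereIndex hs.radicalInverse
  set r₁ := execAssigns ((17, .pi) :: sphereBlock) s.reg with hr₁
  obtain ⟨b24, b26, b27, b28, b29, b30, b31, b19, bfr⟩ := execAssigns_sectionBlock r₁
    (by rw [afr 1 (by norm_num), hs.const.zero]) (by rw [afr 2 (by norm_num), hs.const.one])
    a17 a18 a19 a20
  set r₂ := execAssigns ((21, .mul 17 17) :: sectionBlock) r₁ with hr₂
  obtain ⟨hmat, cfr⟩ := execAssigns_rotationBlock r₂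
    (by rw [bfr 11 (by norm_num), afr 11 (by norm_num), hs.cos])
    (by rw [bfr 12 (by norm_num), afr 12 (by norm_num), hs.sin]) b24 b26 b27 b28 b29 b19 b30 b31
  set r₃ := execAssigns ((32, .mul 24 11) :: rotationBlock) r₂ with hr₃
  have hfr : ∀ k < 17, r₃ k = s.reg k := fun k hk => by rw [cfr k hk, bfr k hk, afr k hk]
  obtain ⟨s₄, t₄, h₄, ht₄, v₄, out₄, fr₄⟩ := exists_runs_odometer k
    ⟨r₃, (!![32, 33, 28; 34, 35, 29; 36, 37, 19] : Matrix (Fin 3) (Fin 3) ℕ).map r₃ :: s.out⟩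
    ((hfr 1 (by norm_num)).trans hs.const.zero) ((hfr 2 (by norm_num)).trans hs.const.one)
    ((hfr 3 (by norm_num)).trans hs.const.two)
    ((hfr 14 (by norm_num)).trans hs.radicalInverse)
  have hfr' : ∀ k < 14, s₄.reg k = s.reg k := fun k hk => by
    rw [fr₄ k hk]
    exact hfr k (by omega)
  have hlast : ∀ k, k ≠ 13 → execAssigns [(13, .add 13 2)] s₄.reg k = s₄.reg k := fun k hk =>
    execAssigns_of_notMem (by simpa using hk) _
  refine ⟨_, _, Runs.seq (runs_assigns _ _ s) (Runs.seq (runs_assigns _ _ _)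
    (Runs.seq (runs_assigns _ _ _) (Runs.seq (Runs.output _ _) (Runs.seq h₄
      (runs_assigns _ _ _))))), ?_, ?_⟩
  · simp [sphereBlock, sectionBlock, rotationBlock]
    omega
  · constructor
    · exact hs.const.of_frame fun k hk =>
        (hlast k (by omega)).trans (hfr' k (by omega))
    · exact (hlast 10 (by norm_num)).trans ((hfr' 10 (by norm_num)).trans hs.circleIndex)
    · exact (hlast 11 (by norm_num)).trans ((hfr' 11 (by norm_num)).trans hs.cos)
    · exact (hlast 12 (by norm_num)).trans ((hfr' 12 (by norm_num)).trans hs.sin)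
    · simp [execAssigns, Op.eval, hfr', hs.sphereIndex, hs.const.one]
    · exact (hlast 14 (by norm_num)).trans v₄
    · rw [out₄, ← Multiset.cons_coe, hs.out_eq, hmat, Multiset.range_succ, Multiset.map_cons,
        Multiset.cons_add, pointMatrix_eq hk]
      rfl

/-- The stage of the outer loop at which the points of `k` fibre angles have been output. -/
structure OuterInvariant (N k : ℕ) (s : MachineState) : Prop where
  const : ConstantRegisters N s
  circleIndex : s.reg 10 = k
  out_eq : (s.out : Multiset (Matrix (Fin 3) (Fin 3) ℝ)) =
    (Multiset.range k).bind fun j => (Multiset.range (numSphere N)).map (pointMatrix N j)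

theorem exists_runs_outerBody {N k : ℕ} {s : MachineState} (hs : OuterInvariant N k s) :
    ∃ s' t, Runs outerBody s s' t ∧ t ≤ numSphere N * (4 * numSphere N + 61) + 10 ∧
      OuterInvariant N (k + 1) s' := by
  set l : List (ℕ × Op) := [(11, .add 11 11), (11, .mul 11 10), (11, .div 11 4), (12, .sin 11),
      (11, .cos 11), (13, .zero), (14, .zero)] with hl
  set r₁ := execAssigns ((11, .pi) :: l) s.reg with hr₁
  have hfr : ∀ k < 11, r₁ k = s.reg k := fun k hk => by
    refine execAssigns_of_notMem ?_ _
    simp [hl]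
    omega
  have e : 2 * Real.pi * k / numCircle N = (Real.pi + Real.pi) * k / numCircle N := by ring
  have h0 : InnerInvariant N k s.out 0 ⟨r₁, s.out⟩ := by
    constructor
    · exact hs.const.of_frame fun k hk => hfr k (by omega)
    · exact (hfr 10 (by norm_num)).trans hs.circleIndex
    · simp [hr₁, hl, execAssigns, Op.eval, hs.const.circle, hs.circleIndex, e]
    · simp [hr₁, hl, execAssigns, Op.eval, hs.const.circle, hs.circleIndex, e]
    · simp [hr₁, hl, execAssigns, Op.eval]
    · simp [hr₁, hl, execAssigns, Op.eval, radicalInverse_zero]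
    · simp
  obtain ⟨s₂, t₂, h₂, ht₂, hi₂⟩ := exists_runs_whileLT (a := 13) (b := 7) (p := innerBody)
    (Inv := InnerInvariant N k s.out) (n := numSphere N) (K := 4 * numSphere N + 60)
    (fun i hi s' hs' => by
      refine ⟨by rw [hs'.sphereIndex, hs'.const.sphere]; exact_mod_cast hi, ?_⟩
      obtain ⟨s'', t, hrun, ht, hinv⟩ := exists_runs_innerBody hi hs'
      exact ⟨s'', t, hrun, by omega, hinv⟩)
    (fun s' hs' => by rw [hs'.sphereIndex, hs'.const.sphere]; exact lt_irrefl _) h0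
  have hlast : ∀ k, k ≠ 10 → execAssigns [(10, .add 10 2)] s₂.reg k = s₂.reg k := fun k hk =>
    execAssigns_of_notMem (by simpa using hk) _
  refine ⟨_, _, Runs.seq (runs_assigns _ _ s) (Runs.seq h₂ (runs_assigns _ _ _)), ?_, ?_⟩
  · rw [show 4 * numSphere N + 60 + 1 = 4 * numSphere N + 61 from rfl] at ht₂
    simp only [List.length_cons, List.length_nil]
    omega
  · constructor
    · exact hi₂.const.of_frame fun k hk => hlast k (by omega)
    · simp [execAssigns, Op.eval, hi₂.circleIndex, hi₂.const.one]
    · rw [hi₂.out_eq, hs.out_eq, Multiset.range_succ, Multiset.cons_bind]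

/-- `N₁` is found with a comparison of real numbers, without cube roots and rounding. -/
theorem lt_numCircle_iff {N k : ℕ} (hN : 2 ≤ N) :
    k < numCircle N ↔ (k : ℝ) * k * k < N / (Real.log N * Real.log N) := by
  have hx := half_le_circleScale hN
  have h1 : k < numCircle N ↔ (k : ℝ) < circleScale N := Nat.lt_ceil
  rw [h1, ← pow_lt_pow_iff_left₀ (Nat.cast_nonneg k) (by linarith) three_ne_zero, circleScale_pow]
  ring_nf

/-- The number of steps is `O(N₁ N₂²)`, as each of the `N₁ N₂` points costs `O(N₂)` steps. -/
theorem efficientlyGenerated_so3Points : EfficientlyGenerated so3Points := by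
  refine ⟨pointProgram, 100, 3, fun N hN => ?_⟩
  set r₁ := execAssigns [(2, .one), (3, .add 2 2), (5, .log 0), (5, .mul 5 5), (5, .div 0 5),
    (9, .add 0 2)] (inputState N).reg with hr₁
  -- the first loop finds `N₁`
  obtain ⟨s₂, t₂, h₂, ht₂, hi₂⟩ := exists_runs_whileLT (a := 6) (b := 5)
    (p := assigns (4, .add 4 2) [(6, .mul 4 4), (6, .mul 6 4)]) (n := numCircle N) (K := 3)
    (s := ⟨r₁, []⟩)
    (Inv := fun k s => s.reg 4 = k ∧ s.reg 6 = (k : ℝ) * k * k ∧ s.out = [] ∧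
      ∀ l, l ≠ 4 → l ≠ 6 → s.reg l = r₁ l)
    (fun k hk s hs => by
      obtain ⟨a4, a6, aout, afr⟩ := hs
      have a2 : s.reg 2 = 1 := by
        rw [afr 2 (by norm_num) (by norm_num)]
        simp [hr₁, execAssigns, Op.eval]
      refine ⟨?_, _, _, runs_assigns _ _ _, by simp, ?_, ?_, aout, ?_⟩
      · rw [a6, afr 5 (by norm_num) (by norm_num)]
        simpa [hr₁, execAssigns, Op.eval, inputState] using (lt_numCircle_iff hN).1 hk
      · simp [execAssigns, Op.eval, a4, a2]
      · simp [execAssigns, Op.eval, a4, a2]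
      · intro l hl4 hl6
        rw [← afr l hl4 hl6]
        exact execAssigns_of_notMem (by simp [hl4, hl6]) _)
    (fun s hs => by
      obtain ⟨a4, a6, aout, afr⟩ := hs
      rw [a6, afr 5 (by norm_num) (by norm_num)]
      have := mt (lt_numCircle_iff hN).2 (lt_irrefl (numCircle N))
      simpa [hr₁, execAssigns, Op.eval, inputState] using this)
    ⟨by simp [hr₁, execAssigns, inputState], by simp [hr₁, execAssigns, inputState], rfl,
      fun _ _ _ => rfl⟩
  obtain ⟨b4, b6, bout, bfr⟩ := hi₂
  set r₃ := execAssigns [(8, .add 4 1)] s₂.reg with hr₃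
  have c8 : r₃ 8 = numCircle N := by
    have b1 : s₂.reg 1 = 0 := by
      rw [bfr 1 (by norm_num) (by norm_num)]
      simp [hr₁, execAssigns, inputState]
    simp [hr₃, execAssigns, Op.eval, b4, b1]
  have cfr : ∀ l, l ≠ 8 → r₃ l = s₂.reg l := fun l hl =>
    execAssigns_of_notMem (by simpa using hl) _
  have c4 : r₃ 4 = numCircle N := by rw [cfr 4 (by norm_num), b4]
  have c2 : r₃ 2 = 1 := by
    rw [cfr 2 (by norm_num), bfr 2 (by norm_num) (by norm_num)]
    simp [hr₁, execAssigns, Op.eval]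
  have c9 : r₃ 9 = N + 1 := by
    rw [cfr 9 (by norm_num), bfr 9 (by norm_num) (by norm_num)]
    simp [hr₁, execAssigns, Op.eval, inputState]
  have hcond : ∀ k : ℕ, k < numSphere N ↔ (numCircle N : ℝ) * (k + 1) < N + 1 := by
    intro k
    rw [numSphere, ← Nat.succ_le_iff, Nat.le_div_iff_mul_le (numCircle_pos hN), mul_comm,
      ← Nat.lt_succ_iff]
    exact_mod_cast Iff.rfl
  -- the second loop finds `N₂`
  obtain ⟨s₄, t₄, h₄, ht₄, hi₄⟩ := exists_runs_whileLT (a := 8) (b := 9)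
    (p := assigns (7, .add 7 2) [(8, .add 8 4)]) (n := numSphere N) (K := 2)
    (s := ⟨r₃, s₂.out⟩)
    (Inv := fun k s => s.reg 7 = k ∧ s.reg 8 = (numCircle N : ℝ) * (k + 1) ∧ s.out = [] ∧
      ∀ l, l ≠ 7 → l ≠ 8 → s.reg l = r₃ l)
    (fun k hk s hs => by
      obtain ⟨a7, a8, aout, afr⟩ := hs
      have a2 : s.reg 2 = 1 := by rw [afr 2 (by norm_num) (by norm_num), c2]
      have a4 : s.reg 4 = numCircle N := by rw [afr 4 (by norm_num) (by norm_num), c4]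
      refine ⟨?_, _, _, runs_assigns _ _ _, by simp, ?_, ?_, aout, ?_⟩
      · rw [a8, afr 9 (by norm_num) (by norm_num), c9]
        exact (hcond k).1 hk
      · simp [execAssigns, Op.eval, a7, a2]
      · simp [execAssigns, Op.eval, a8, a4]
        ring
      · intro l hl7 hl8
        rw [← afr l hl7 hl8]
        exact execAssigns_of_notMem (by simp [hl7, hl8]) _)
    (fun s hs => by
      obtain ⟨a7, a8, aout, afr⟩ := hs
      rw [a8, afr 9 (by norm_num) (by norm_num), c9]
      exact mt (hcond _).2 (lt_irrefl _))
    ⟨by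
      change r₃ 7 = _
      rw [cfr 7 (by norm_num), bfr 7 (by norm_num) (by norm_num)]
      simp [hr₁, execAssigns, inputState], by simp [c8], bout, fun _ _ _ => rfl⟩
  obtain ⟨d7, d8, dout, dfr⟩ := hi₄
  have e4 : ∀ l, l ≠ 4 → l ≠ 6 → l ≠ 7 → l ≠ 8 → s₄.reg l = r₁ l := fun l h4 h6 h7 h8 => by
    rw [dfr l h7 h8, cfr l h8, bfr l h4 h6]
  have h0 : OuterInvariant N 0 s₄ := by
    refine ⟨⟨?_, ?_, ?_, ?_, d7⟩, ?_, ?_⟩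
    · rw [e4 1] <;> norm_num [hr₁, execAssigns, inputState]
    · rw [e4 2] <;> norm_num [hr₁, execAssigns, Op.eval]
    · rw [e4 3] <;> norm_num [hr₁, execAssigns, Op.eval]
    · rw [dfr 4 (by norm_num) (by norm_num), c4]
    · rw [e4 10] <;> norm_num [hr₁, execAssigns, inputState]
    · rw [dout]
      simp
  obtain ⟨s₅, t₅, h₅, ht₅, hi₅⟩ := exists_runs_whileLT (a := 10) (b := 4) (p := outerBody)
    (Inv := OuterInvariant N) (n := numCircle N)
    (K := numSphere N * (4 * numSphere N + 61) + 10)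
    (fun k hk s hs => ⟨by rw [hs.circleIndex, hs.const.circle]; exact_mod_cast hk,
      exists_runs_outerBody hs⟩)
    (fun s hs => by rw [hs.circleIndex, hs.const.circle]; exact lt_irrefl _) h0
  refine ⟨s₅, _, Runs.seq (runs_assigns _ _ _) (Runs.seq h₂ (Runs.seq (runs_assigns _ _ _)
    (Runs.seq h₄ h₅))), ?_, ?_⟩
  · have hc := numCircle_le hN
    have hsN : numSphere N ≤ N := Nat.div_le_self _ _
    have h1 : t₅ ≤ N * (N * (4 * N + 61) + 11) + 1 := by
      refine ht₅.trans (Nat.add_le_add_right (Nat.mul_le_mul hc ?_) 1)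
      exact Nat.add_le_add_right (Nat.mul_le_mul hsN (by omega)) 11
    have h2 : t₂ ≤ N * 4 + 1 := ht₂.trans (by omega)
    have h3 : t₄ ≤ N * 3 + 1 := ht₄.trans (by omega)
    have h4 : N * (N * (4 * N + 61) + 11) + 1 + (N * 4 + 1) + (N * 3 + 1) + 10 ≤ 100 * N ^ 3 := by
      have h5 : 4 * N ≤ N ^ 3 := by nlinarith
      have h6 : 2 * (N * N) ≤ N ^ 3 := by nlinarith
      nlinarith
    simp only [List.length_cons, List.length_nil]
    omega
  · rw [hi₅.out_eq, so3Points, so3PointsOf, fiberedProductPoints, Multiset.map_map]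
    simp only [equispacedPoints, hammersleyPoints, SProd.sprod, Multiset.product,
      Multiset.bind_map, Multiset.map_bind, Multiset.map_map]
    rfl

end MotionSampling

theorem mainTheorem4 :
    -- the explicit point set, of size `N` up to rounding (and exactly `N` after adding points)
    (∃ C : ℝ, ∀ N : ℕ, 2 ≤ N →
      (MotionSampling.so3Points N).Nodup ∧
      Multiset.card (MotionSampling.so3Points N)
        = MotionSampling.numCircle N * MotionSampling.numSphere N ∧
      Multiset.card (MotionSampling.so3Points N) ≤ N ∧
      N < Multiset.card (MotionSampling.so3Points N) + MotionSampling.numCircle N ∧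
      MotionSampling.discrepancy MotionSampling.haarSO3 (MotionSampling.so3Points N)
          MotionSampling.localCartesianConvexSets
        ≤ C * (Real.log N ^ (2 / 3 : ℝ) / (N : ℝ) ^ (1 / 3 : ℝ)) ∧
      ∀ Q : Multiset MotionSampling.SO3,
        MotionSampling.so3Points N ≤ Q → Multiset.card Q = N →
        MotionSampling.discrepancy MotionSampling.haarSO3 Q
            MotionSampling.localCartesianConvexSets
          ≤ C * (Real.log N ^ (2 / 3 : ℝ) / (N : ℝ) ^ (1 / 3 : ℝ))) ∧
    -- it is efficiently generated
    MotionSampling.EfficientlyGenerated MotionSampling.so3Points ∧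
    -- any other discrepancy-optimal points of the unit square may replace the Hammersley points
    (∀ A : ℝ, ∃ C : ℝ, ∀ N : ℕ, 2 ≤ N → ∀ T : Multiset (unitInterval × unitInterval),
      Multiset.card T = MotionSampling.numSphere N →
      MotionSampling.discrepancy MeasureTheory.volume T MotionSampling.unitSquareRectangles
        ≤ A * (Real.log (MotionSampling.numSphere N) / MotionSampling.numSphere N) →
      MotionSampling.discrepancy MotionSampling.haarSO3 (MotionSampling.so3PointsOf N T)
          MotionSampling.localCartesianConvexSets
        ≤ C * (Real.log N ^ (2 / 3 : ℝ) / (N : ℝ) ^ (1 / 3 : ℝ))) :=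
  ⟨MotionSampling.exists_so3Points_bound, MotionSampling.efficientlyGenerated_so3Points,
    MotionSampling.exists_discrepancy_so3PointsOf_le⟩
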